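/- **Setting.** For $h:\mathbb R\to\mathbb C$ and $T>0$ write $\mathbb E_T|h|^2=\frac1{2T}\int_{-T}^{T}|h(t)|^2\,dt$. Fourier transforms are $\widehat g(f)=\int g(t)e^{-2\pi i ft}\,dt$, understood in the sense of tempered distributions, and $\mathsf{supp}(\widehat g)$ is the support of that distribution. Write $\log^+x=\max(0,\log x)$. An *algorithm* is one fixed program for a randomized real RAM: it stores real numbers in registers and in an array, uses unit-cost operations $+,-,\times,\div,\sin,\cos,\exp,\log$, comparisons, rational constants and $\pi$, counted loops in which every iteration is charged, can draw independent uniform random numbers from $[0,1]$, and can sample the observed signal $y$ at a time $t\in[-T,T]$ of its choice (each such request counts as one sample; requests outside $[-T,T]$ count as well and return $0$). **Theorem.** There is an absolute constant $\epsilon>0$ such that for every fixed real polynomial $p$ there are constants $A,C>0$, $a,c\in\mathbb N$ and an algorithm with the following property. Let $T,F,\Delta,S,\delta>0$, let $R\in\mathbb R$, put $$\Delta'=\Delta+\frac{A\,(R+S)\,\log^{a}(2+R+S)}{T}\qquad\Big(\text{that is, }\Delta'=\Delta+\tfrac{\widetilde O(R+S)}{T}\Big),$$ let $f_0\in[-F,F]$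 and let $g:\mathbb R\to\mathbb C$ be a measurable signal with $\mathbb E_T|g|^2>0$ such that 1. $\mathsf{supp}(\widehat g)\subseteq[f_0-\Delta,f_0+\Delta]$; 2. $\sup_{t\in[-T,T]}|g(t)|^2\le R\cdot\mathbb E_T|g|^2$; 3. $|g(t)|^2\le p(R)\cdot\mathbb E_T|g|^2\cdot|t/T|^{S}$ for all $t\notin[-T,T]$. Let $\eta$ be any measurable noise, square integrable on $[-T,T]$, with $\mathbb E_T|\eta|^2\le\epsilon\,\mathbb E_T|g|^2$, and let $y=g+\eta$ be observable on $[-T,T]$. Then the algorithm, given $(T,F,\Delta,R,S,\delta)$ and sample access to $y$, always takes at most $C\,R\,\log^+\frac{F}{\Delta'\delta}$ samples and at most $C\big(1+R+S+\log^+\frac{F}{\Delta'\delta}\big)^{c}$ steps, and with probability at least $1-\delta$ over its random numbers it outputs $\widetilde f$ with $$|\widetilde f-f_0|\le C\,\Delta'.$$ -/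

import Mathlib

open MeasureTheory
open scoped SchwartzMap FourierTransform

/-- The distributional Fourier transform of `g` (with kernel `exp (-2πi f t)`) is supported in the
closed set `K`: it annihilates every compactly supported smooth function whose support misses `K`,
where `⟨ĝ, φ⟩ = ⟨g, φ̂⟩ = ∫ g φ̂`. -/
def FourierSupportIn (g : ℝ → ℂ) (K : Set ℝ) : Prop :=
  ∀ φ : 𝓢(ℝ, ℂ), HasCompactSupport (φ : ℝ → ℂ) → Disjoint (tsupport (φ : ℝ → ℂ)) K →
    ∫ t : ℝ, g t * (𝓕 φ) t = 0

/-- The mean square `E_{t ∈ [-T,T]} |h(t)|²` for `t` uniform in `[-T,T]`. -/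
noncomputable def meanSq (T : ℝ) (h : ℝ → ℂ) : ℝ :=
  ⨍ t in Set.Icc (-T) T, ‖h t‖ ^ 2

/-- `Δ' = Δ + Õ(R + S) / T`, the `Õ` being `A (R + S) log(2 + R + S)^a`. -/
noncomputable def widenedBand (A : ℝ) (a : ℕ) (T Δ R S : ℝ) : ℝ :=
  Δ + A * (R + S) * Real.log (2 + R + S) ^ a / T

/-! A uniform randomized real RAM with an oracle for the observed signal. Programs are finite
syntactic objects whose only literals are rational numbers and `π`; loops are counted, so that every
program halts, and every elementary operation and every loop iteration is charged one step. -/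

namespace RealRAM

/-- Real expressions over registers and an array of reals with indirect addressing. -/
inductive Expr : Type
  | const (q : ℚ)
  | pi
  | reg (i : ℕ)
  | load (addr : Expr)
  | add (e₁ e₂ : Expr)
  | sub (e₁ e₂ : Expr)
  | mul (e₁ e₂ : Expr)
  | div (e₁ e₂ : Expr)
  | sin (e : Expr)
  | cos (e : Expr)
  | exp (e : Expr)
  | log (e : Expr)

/-- Programs. -/
inductive Prog : Type
  | skip
  /-- `reg i := e` -/
  | assign (i : ℕ) (e : Expr)
  /-- `array[⌊addr⌋] := e` -/
  | store (addr e : Expr)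
  /-- one sample: ask for the signal at time `e`; the real and imaginary parts of the answer are
  put into registers `i` and `j` -/
  | sample (i j : ℕ) (e : Expr)
  /-- put a fresh uniform random element of `[0,1]` into register `i` -/
  | rand (i : ℕ)
  | seq (P Q : Prog)
  /-- if `e₁ ≤ e₂` then `P` else `Q` -/
  | ite (e₁ e₂ : Expr) (P Q : Prog)
  /-- repeat `P` for `⌊e⌋` rounds (none if `e < 1`); `e` is evaluated once, before the first -/
  | loop (e : Expr) (P : Prog)

/-- Configurations of the machine, with counters for the random numbers drawn, the samples taken
and the elementary steps executed. -/
structure State where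
  reg : ℕ → ℝ
  array : ℕ → ℝ
  draws : ℕ
  samples : ℕ
  steps : ℕ

/-- The value of an expression. -/
noncomputable def Expr.eval (s : State) : Expr → ℝ
  | .const q => (q : ℝ)
  | .pi => Real.pi
  | .reg i => s.reg i
  | .load e => s.array ⌊e.eval s⌋₊
  | .add e₁ e₂ => e₁.eval s + e₂.eval s
  | .sub e₁ e₂ => e₁.eval s - e₂.eval s
  | .mul e₁ e₂ => e₁.eval s * e₂.eval s
  | .div e₁ e₂ => e₁.eval s / e₂.eval s
  | .sin e => Real.sin (e.eval s)
  | .cos e => Real.cos (e.eval s)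
  | .exp e => Real.exp (e.eval s)
  | .log e => Real.log (e.eval s)

/-- The cost of evaluating an expression: its number of nodes. -/
def Expr.cost : Expr → ℕ
  | .const _ => 1
  | .pi => 1
  | .reg _ => 1
  | .load e => e.cost + 1
  | .add e₁ e₂ => e₁.cost + e₂.cost + 1
  | .sub e₁ e₂ => e₁.cost + e₂.cost + 1
  | .mul e₁ e₂ => e₁.cost + e₂.cost + 1
  | .div e₁ e₂ => e₁.cost + e₂.cost + 1
  | .sin e => e.cost + 1
  | .cos e => e.cost + 1
  | .exp e => e.cost + 1
  | .log e => e.cost + 1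

/-- Charge `n` steps. -/
def State.charge (n : ℕ) (s : State) : State :=
  { s with steps := s.steps + n }

open Classical in
/-- Execution of a program with signal oracle `y` and random numbers `ω 0, ω 1, …`. -/
noncomputable def exec (y : ℝ → ℂ) (ω : ℕ → unitInterval) : Prog → State → State
  | .skip, s => s
  | .assign i e, s =>
      { s with reg := Function.update s.reg i (e.eval s), steps := s.steps + (e.cost + 1) }
  | .store addr e, s =>
      { s with
        array := Function.update s.array ⌊addr.eval s⌋₊ (e.eval s)
        steps := s.steps + (addr.cost + e.cost + 1) }
  | .sample i j e, s =>
      { s with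
        reg := Function.update (Function.update s.reg i (y (e.eval s)).re) j (y (e.eval s)).im
        samples := s.samples + 1
        steps := s.steps + (e.cost + 1) }
  | .rand i, s =>
      { s with
        reg := Function.update s.reg i (ω s.draws : ℝ)
        draws := s.draws + 1
        steps := s.steps + 1 }
  | .seq P Q, s => exec y ω Q (exec y ω P s)
  | .ite e₁ e₂ P Q, s =>
      if e₁.eval s ≤ e₂.eval s then
        exec y ω P (s.charge (e₁.cost + e₂.cost + 1))
      else
        exec y ω Q (s.charge (e₁.cost + e₂.cost + 1))
  | .loop e P, s =>
      (fun s' => (exec y ω P s').charge 1)^[⌊e.eval s⌋₊] (s.charge (e.cost + 1))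

/-- The start configuration on a list of real inputs: the inputs are in registers `0, 1, …`, all
other registers, the array and the counters are zero. -/
def State.init (inputs : List ℝ) : State where
  reg i := inputs.getD i 0
  array _ := 0
  draws := 0
  samples := 0
  steps := 0

/-- The final configuration of a run; the output is its register `0`. -/
noncomputable def run (P : Prog) (inputs : List ℝ) (y : ℝ → ℂ) (ω : ℕ → unitInterval) : State :=
  exec y ω P (State.init inputs)

/-- The law of an infinite sequence of independent uniform random elements of `[0,1]`. -/
noncomputable def coinLaw : Measure (ℕ → unitInterval) :=
  Measure.infinitePi fun _ => (volume : Measure unitInterval)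

end RealRAM

/-! A signal whose spectrum lies near `f₀` is, on average, rotated by `exp (2πi f₀ β)` under a shift
by `β`, so the phase of its autocorrelation at lag `β` reveals `f₀` modulo `1/β`. Two obstacles
remain: the signal is seen on `[-T, T]` only, and the correlation has to be estimated from few noisy
samples.

Truncation. Multiplying `g` by a band-limited cut-off `H` widens its spectrum by the bandwidth of
`H`, while `g H` stays close in mean square to `g` cut off sharply at `±T`: the bound by `R` limits
the loss in strips of relative width about `1/R` near the ends, and the growth `|t/T|^S` is absorbed
by the decay of `H`. A cut-off made of `k ≈ (R + S) log (2 + R + S)` factors has bandwidth about `k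
log k / T`, which is the `Õ(R + S)/T` in `Δ'` (`exists_bandlimited_cutoff`, `exists_factor_count`).
Hence at lags well below `1/Δ'` the truncated autocorrelation has the right phase and nearly full
size (`truncated_autocorrelation_bound`).

Sampling. A lagged product at a random time has second moment at most `R E²`, `E` being the mean
square of `g`, so `O(R)` times suffice by Chebyshev; the noise is small only in mean square and
enters through Markov (`measure_lagSum_deviation_le`). To test whether `f₀` is within `w` of a
centre `c`, a random lag of order `1/w` is used and the estimate is rotated back by `c`: it should
point in direction `1`, and then its angle corrects the centre to within `w/2`. The random lag makes
aliases unlikely. Such a step misbehaves with probability at most `1/10^4`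
(`measure_not_goodStep_le`).

Search. Amplifying every level of a bisection separately would cost too many samples. Instead the
search backtracks: it keeps a stack of centres of halving widths, descends when the top is accepted,
pops it when it is rejected, and at the finest width records the corrected centre. A potential (good
records, plus good minus bad centres on the stack) gains at least `1` in every round that behaves
and loses at most `1` in the others (`SearchInv.searchRound`). By an adaptive Chernoff bound
(`measure_many_failures_le`), at most an eighth of the `8 log (F/(Δ'δ))` rounds fail, except with
probability `δ`; then most records are near `f₀`, and a vote among the records finds such a one
(`majority_near`). The remaining lemmas check that the RAM program performs this search within its
budget. -/

/-! ### Autocorrelation and power spectrum. -/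

section Autocorrelation

open scoped ContDiff ComplexConjugate

theorem integral_fourier_mul_eq {f g : ℝ → ℂ} (hf : Integrable f) (hg : Integrable g) :
    ∫ ξ, 𝓕 f ξ * g ξ = ∫ x, f x * 𝓕 g x := by
  have := VectorFourier.integral_fourierIntegral_smul_eq_flip (L := innerₗ ℝ) (μ := volume)
    (ν := volume) Real.continuous_fourierChar continuous_inner hf hg
  simpa [flip_innerₗ] using! this

theorem fourierInv_apply_eq_fourier_neg (f : ℝ → ℂ) (x : ℝ) : 𝓕⁻ f x = 𝓕 f (-x) := by
  rw [Real.fourierInv_eq_fourier_neg]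

theorem continuous_fourier_of_integrable {f : ℝ → ℂ} (hf : Integrable f) : Continuous (𝓕 f) :=
  VectorFourier.fourierIntegral_continuous (L := innerₗ ℝ) Real.continuous_fourierChar
    (by exact continuous_inner) hf

theorem continuous_fourierInv_of_integrable {f : ℝ → ℂ} (hf : Integrable f) :
    Continuous (𝓕⁻ f) := by
  have : 𝓕⁻ f = fun x => 𝓕 f (-x) := by
    ext x; exact fourierInv_apply_eq_fourier_neg f x
  rw [this]
  exact (continuous_fourier_of_integrable hf).comp continuous_neg

/-- Without continuity of `h`, inversion can hold only almost everywhere. Both sides are paired with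
test functions, and the transforms are moved onto the test function, where Schwartz inversion
applies. -/
theorem ae_eq_fourierInv_fourier {h : ℝ → ℂ} (hh : Integrable h) (hF : Integrable (𝓕 h)) :
    h =ᵐ[volume] 𝓕⁻ (𝓕 h) := by
  refine ae_eq_of_integral_contDiff_smul_eq hh.locallyIntegrable
    (continuous_fourierInv_of_integrable hF).locallyIntegrable ?_
  intro q hq hqc
  have hqc' : HasCompactSupport (fun x => (q x : ℂ)) := hqc.comp_left (g := fun x : ℝ => (x : ℂ)) (by simp)
  let χ : 𝓢(ℝ, ℂ) := hqc'.toSchwartzMap (Complex.ofRealCLM.contDiff.comp hq)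
  have hχ : ∀ x, χ x = q x := fun x => rfl
  have e1 : ∫ x, 𝓕⁻ (𝓕 h) x * χ x = ∫ x, 𝓕 h x * 𝓕⁻ χ x := by
    have := integral_fourier_mul_eq hF (g := fun x => χ (-x)) χ.integrable.comp_neg
    rw [← integral_neg_eq_self] at this
    simp only [neg_neg] at this
    simp_rw [fourierInv_apply_eq_fourier_neg]
    rw [this]
    congr 1; ext x
    congr 1
    rw [SchwartzMap.fourierInv_coe, fourierInv_apply_eq_fourier_neg,
      ← fourierInv_apply_eq_fourier_neg, Real.fourierInv_eq_fourier_comp_neg]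
  have e2 : ∫ x, 𝓕 h x * 𝓕⁻ χ x = ∫ x, h x * χ x := by
    rw [integral_fourier_mul_eq hh (𝓕⁻ χ).integrable]
    congr 1; ext x; congr 1
    rw [← SchwartzMap.fourier_coe, FourierTransform.fourier_fourierInv_eq]
  rw [e2] at e1
  simp only [hχ] at e1
  simp only [Complex.real_smul]
  simp_rw [mul_comm ((q _ : ℝ) : ℂ)]
  exact e1.symm

/-- The autocorrelation of `h` is the inverse Fourier transform of its power spectrum. -/
theorem integral_autocorrelation {h : ℝ → ℂ} (hh : Integrable h) (hF : Integrable (𝓕 h)) (β : ℝ) :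
    ∫ t, h (t + β) * conj (h t) =
      ∫ ξ : ℝ, Complex.exp (2 * Real.pi * ξ * β * Complex.I) * ((‖𝓕 h ξ‖ ^ 2 : ℝ) : ℂ) := by
  have hinv := ae_eq_fourierInv_fourier hh hF
  have hshift : (fun t => h (t + β)) =ᵐ[volume] fun t => 𝓕⁻ (𝓕 h) (t + β) :=
    (measurePreserving_add_right volume β).quasiMeasurePreserving.ae_eq_comp hinv
  let m : ℝ → ℂ := fun ξ => Complex.exp (2 * Real.pi * ξ * β * Complex.I) * 𝓕 h ξ
  have hnorm : ∀ ξ : ℝ, ‖Complex.exp (2 * Real.pi * ξ * β * Complex.I)‖ = 1 := by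
    intro ξ
    have := Complex.norm_exp_ofReal_mul_I (2 * Real.pi * ξ * β)
    push_cast at this
    exact this
  have hm : Integrable m := by
    refine hF.bdd_mul (c := 1) (by fun_prop) ?_
    filter_upwards with ξ
    exact (hnorm ξ).le
  have hm' : ∀ t, 𝓕⁻ (𝓕 h) (t + β) = 𝓕 m (-t) := by
    intro t
    rw [Real.fourierInv_eq', Real.fourier_eq']
    congr 1; ext ξ
    simp only [m, smul_eq_mul, RCLike.inner_apply, conj_trivial]
    rw [← mul_assoc (Complex.exp _) (Complex.exp _), ← Complex.exp_add]
    congr 2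
    push_cast
    ring
  have hc : Integrable fun t => conj (h (-t)) :=
    (Complex.conjLIE.toContinuousLinearEquiv.toContinuousLinearMap.integrable_comp hh.comp_neg)
  calc ∫ t, h (t + β) * conj (h t) = ∫ t, 𝓕 m (-t) * conj (h t) := by
        refine integral_congr_ae ?_
        filter_upwards [hshift] with t ht
        rw [ht, hm']
    _ = ∫ t, 𝓕 m t * conj (h (-t)) := by
        rw [← integral_neg_eq_self]; simp
    _ = ∫ ξ, m ξ * 𝓕 (fun t => conj (h (-t))) ξ := integral_fourier_mul_eq hm hc
    _ = _ := by
        congr 1; ext ξ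
        have : 𝓕 (fun t => conj (h (-t))) ξ = conj (𝓕 h ξ) := by
          rw [Real.fourier_eq', Real.fourier_eq', ← integral_conj, ← integral_neg_eq_self]
          congr 1; ext t
          simp only [smul_eq_mul, RCLike.inner_apply, conj_trivial, neg_neg, map_mul]
          rw [← Complex.exp_conj]
          have h2 : conj (2 : ℂ) = 2 := Complex.conj_ofNat 2
          simp [h2]
        rw [this]
        simp only [m]
        rw [mul_assoc, Complex.mul_conj]
        push_cast
        rw [Complex.normSq_eq_norm_sq]
        push_cast
        rfl

/-- A signal whose spectrum lies within `W` of `f₀` is, on average, rotated by `f₀ β` when it is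
shifted by `β`. -/
theorem norm_autocorrelation_sub_le {h : ℝ → ℂ} (hh : Integrable h) {f₀ W : ℝ}
    (hW : ∀ ξ, ξ ∉ Set.Icc (f₀ - W) (f₀ + W) → 𝓕 h ξ = 0) (β : ℝ) :
    ‖(∫ t, h (t + β) * conj (h t)) -
        Complex.exp (2 * Real.pi * f₀ * β * Complex.I) * (∫ t, ‖h t‖ ^ 2 : ℝ)‖ ≤
      2 * Real.pi * |β| * W * ∫ t, ‖h t‖ ^ 2 := by
  have hcont := continuous_fourier_of_integrable hh
  have hsupp : HasCompactSupport (𝓕 h) := HasCompactSupport.intro isCompact_Icc hW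
  have hF : Integrable (𝓕 h) := hcont.integrable_of_hasCompactSupport hsupp
  have hF2 : Integrable (fun ξ => ‖𝓕 h ξ‖ ^ 2) := by
    refine (hcont.norm.pow 2).integrable_of_hasCompactSupport ?_
    exact HasCompactSupport.intro (K := Set.Icc (f₀ - W) (f₀ + W)) isCompact_Icc
      fun ξ hξ => by simp [hW ξ hξ]
  -- Plancherel is the lag-zero case of the autocorrelation formula.
  have h0 : (∫ t, ‖h t‖ ^ 2 : ℝ) = ∫ ξ, ‖𝓕 h ξ‖ ^ 2 := by
    have := integral_autocorrelation hh hF 0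
    simp only [add_zero, Complex.mul_conj, Complex.normSq_eq_norm_sq] at this
    simp only [Complex.ofReal_zero, mul_zero, zero_mul, Complex.exp_zero, one_mul] at this
    rw [integral_complex_ofReal, integral_complex_ofReal] at this
    exact_mod_cast this
  rw [h0, integral_autocorrelation hh hF β, ← integral_complex_ofReal, ← integral_const_mul]
  have hexp : ∀ ξ : ℝ, ‖Complex.exp (2 * Real.pi * ξ * β * Complex.I)‖ = 1 := by
    intro ξ
    have := Complex.norm_exp_ofReal_mul_I (2 * Real.pi * ξ * β)
    push_cast at this
    exact this
  have i1 : Integrable fun ξ : ℝ =>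
      Complex.exp (2 * Real.pi * ξ * β * Complex.I) * ((‖𝓕 h ξ‖ ^ 2 : ℝ) : ℂ) := by
    refine hF2.ofReal.bdd_mul (c := 1) (by fun_prop) ?_
    filter_upwards with ξ
    exact (hexp ξ).le
  have i2 : Integrable fun ξ : ℝ =>
      Complex.exp (2 * Real.pi * f₀ * β * Complex.I) * ((‖𝓕 h ξ‖ ^ 2 : ℝ) : ℂ) :=
    hF2.ofReal.const_mul _
  rw [← integral_sub i1 i2]
  refine (norm_integral_le_integral_norm _).trans ?_
  rw [← integral_const_mul]
  refine integral_mono_of_nonneg (by filter_upwards with ξ; positivity) (hF2.const_mul _) ?_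
  filter_upwards with ξ
  rw [← sub_mul, norm_mul, Complex.norm_real, Real.norm_of_nonneg (by positivity : (0:ℝ) ≤ ‖𝓕 h ξ‖ ^ 2)]
  by_cases hξ : ξ ∈ Set.Icc (f₀ - W) (f₀ + W)
  · refine mul_le_mul_of_nonneg_right ?_ (by positivity)
    have e : Complex.exp (2 * Real.pi * ξ * β * Complex.I) -
        Complex.exp (2 * Real.pi * f₀ * β * Complex.I) =
        Complex.exp (2 * Real.pi * f₀ * β * Complex.I) *
          (Complex.exp (Complex.I * ((2 * Real.pi * (ξ - f₀) * β : ℝ) : ℂ)) - 1) := by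
      rw [mul_sub, mul_one, ← Complex.exp_add]
      congr 2
      push_cast
      ring
    rw [e, norm_mul, hexp, one_mul]
    refine (Real.norm_exp_I_mul_ofReal_sub_one_le).trans ?_
    rw [Real.norm_eq_abs, abs_mul, abs_mul, abs_of_pos Real.two_pi_pos]
    have : |ξ - f₀| ≤ W := abs_le.2 ⟨by linarith [hξ.1], by linarith [hξ.2]⟩
    have h2 := mul_le_mul_of_nonneg_left this (by positivity : 0 ≤ 2 * Real.pi * |β|)
    linarith
  · simp [hW ξ hξ]

end Autocorrelation

/-! ### Windows of compact spectrum and fast decay in time. -/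

section Window

open scoped ContDiff ComplexConjugate Convolution Pointwise

/-- `φ` is a smooth spectral window supported in `[-B, B]` with nonnegative Fourier transform
`ψ ≤ 1` and `ψ t ≥ 1 - L B |t|`. -/
structure SpectralWindow (L B : ℝ) (φ : 𝓢(ℝ, ℂ)) (ψ : ℝ → ℝ) : Prop where
  tsupport_subset : tsupport (φ : ℝ → ℂ) ⊆ Set.Icc (-B) B
  fourier_eq : ∀ t, 𝓕 φ t = (ψ t : ℂ)
  nonneg : ∀ t, 0 ≤ ψ t
  le_one : ∀ t, ψ t ≤ 1
  near_zero : ∀ t, 1 - L * B * |t| ≤ ψ t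

theorem tsupport_schwartz_convolution_subset {φ₁ φ₂ : 𝓢(ℝ, ℂ)} {B₁ B₂ : ℝ}
    (h₁ : tsupport (φ₁ : ℝ → ℂ) ⊆ Set.Icc (-B₁) B₁)
    (h₂ : tsupport (φ₂ : ℝ → ℂ) ⊆ Set.Icc (-B₂) B₂) :
    tsupport (SchwartzMap.convolution (ContinuousLinearMap.mul ℂ ℂ) φ₁ φ₂ : ℝ → ℂ) ⊆
      Set.Icc (-(B₁ + B₂)) (B₁ + B₂) := by
  refine closure_minimal ?_ isClosed_Icc
  have e : (SchwartzMap.convolution (ContinuousLinearMap.mul ℂ ℂ) φ₁ φ₂ : ℝ → ℂ) =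
      (φ₁ : ℝ → ℂ) ⋆[ContinuousLinearMap.mul ℂ ℂ] (φ₂ : ℝ → ℂ) := by
    ext x; exact SchwartzMap.convolution_apply _ _ _ _
  rw [e]
  refine (support_convolution_subset_swap _).trans ?_
  rintro _ ⟨x, hx, z, hz, rfl⟩
  have hx' := h₂ (subset_closure hx)
  have hz' := h₁ (subset_closure hz)
  simp only [Set.mem_Icc] at *
  constructor <;> linarith [hx'.1, hx'.2, hz'.1, hz'.2]

theorem fourier_schwartz_convolution (φ₁ φ₂ : 𝓢(ℝ, ℂ)) (t : ℝ) :
    𝓕 (SchwartzMap.convolution (ContinuousLinearMap.mul ℂ ℂ) φ₁ φ₂) t = 𝓕 φ₁ t * 𝓕 φ₂ t := by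
  rw [SchwartzMap.fourier_convolution]
  simp

/-- Bandwidths add and transforms multiply. The linear lower bound survives because `(1 - ψ₁)(1 -
ψ₂) ≥ 0` gives `ψ₁ψ₂ ≥ ψ₁ + ψ₂ - 1`. -/
theorem SpectralWindow.conv {L B₁ B₂ : ℝ} {φ₁ φ₂ : 𝓢(ℝ, ℂ)} {ψ₁ ψ₂ : ℝ → ℝ}
    (h₁ : SpectralWindow L B₁ φ₁ ψ₁) (h₂ : SpectralWindow L B₂ φ₂ ψ₂) :
    SpectralWindow L (B₁ + B₂) (SchwartzMap.convolution (ContinuousLinearMap.mul ℂ ℂ) φ₁ φ₂)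
      (fun t => ψ₁ t * ψ₂ t) where
  tsupport_subset := tsupport_schwartz_convolution_subset h₁.tsupport_subset h₂.tsupport_subset
  fourier_eq t := by
    rw [fourier_schwartz_convolution, h₁.fourier_eq, h₂.fourier_eq]; push_cast; rfl
  nonneg t := mul_nonneg (h₁.nonneg t) (h₂.nonneg t)
  le_one t := mul_le_one₀ (h₁.le_one t) (h₂.nonneg t) (h₂.le_one t)
  near_zero t := by
    have a := h₁.near_zero t
    have b := h₂.near_zero t
    have c := h₁.le_one t
    have d := h₂.le_one t
    nlinarith [mul_nonneg (sub_nonneg.2 c) (sub_nonneg.2 d)]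

/-- A normalised even bump: evenness makes its transform real, unit mass bounds it by `1`, and on
`|x| ≤ 1/2` the phase `2πxt` is at most `π|t|`. -/
theorem exists_even_bump : ∃ θ : 𝓢(ℝ, ℂ), tsupport (θ : ℝ → ℂ) ⊆ Set.Icc (-(1 / 2)) (1 / 2) ∧
    ∃ ρ : ℝ → ℝ, (∀ t, 𝓕 θ t = (ρ t : ℂ)) ∧ (∀ t, |ρ t| ≤ 1) ∧
      ∀ t, |ρ t - 1| ≤ Real.pi * |t| := by
  let f : ContDiffBump (0 : ℝ) := ⟨1 / 4, 1 / 2, by norm_num, by norm_num⟩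
  let n : ℝ → ℝ := f.normed volume
  have hn0 : ∀ x, 0 ≤ n x := f.nonneg_normed
  have hnsupp : tsupport n = Set.Icc (-(1 / 2)) (1 / 2) := by
    have : tsupport n = Metric.closedBall 0 (1 / 2) := f.tsupport_normed_eq
    rw [this, Real.closedBall_eq_Icc]; norm_num
  have hnint : ∫ x, n x = 1 := f.integral_normed
  have hni : Integrable n := f.integrable_normed
  have hnc : HasCompactSupport n := f.hasCompactSupport_normed
  have hnev : ∀ x, n (-x) = n x := fun x => f.normed_neg x
  have hc : HasCompactSupport (fun x => (n x : ℂ)) :=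
    hnc.comp_left (g := fun x : ℝ => (x : ℂ)) (by simp)
  let θ : 𝓢(ℝ, ℂ) := hc.toSchwartzMap (Complex.ofRealCLM.contDiff.comp f.contDiff_normed)
  have hθ : ∀ x, θ x = n x := fun x => rfl
  have hfour : ∀ t, 𝓕 θ t = ∫ x : ℝ, Complex.exp (((-2 * Real.pi * (x * t) : ℝ) : ℂ) * Complex.I) * n x := by
    intro t
    rw [SchwartzMap.fourier_coe, Real.fourier_eq']
    simp [hθ, mul_comm]
  have hle : ∀ t, ‖𝓕 θ t‖ ≤ 1 := by
    intro t
    rw [hfour, ← hnint]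
    refine (norm_integral_le_integral_norm _).trans (le_of_eq ?_)
    congr 1; ext x
    rw [norm_mul, Complex.norm_exp_ofReal_mul_I, one_mul, Complex.norm_real,
      Real.norm_of_nonneg (hn0 x)]
  have hreal : ∀ t, conj (𝓕 θ t) = 𝓕 θ t := by
    intro t
    rw [hfour, ← integral_conj, ← integral_neg_eq_self]
    congr 1; ext x
    rw [hnev, map_mul, ← Complex.exp_conj, map_mul, Complex.conj_ofReal, Complex.conj_I,
      Complex.conj_ofReal]
    congr 2
    push_cast; ring
  have hre : ∀ t, 𝓕 θ t = ((𝓕 θ t).re : ℂ) := fun t => (Complex.conj_eq_iff_re.1 (hreal t)).symm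
  refine ⟨θ, ?_, fun t => (𝓕 θ t).re, hre, ?_, ?_⟩
  · rw [← hnsupp]
    exact closure_mono fun x hx => by
      simp only [Function.mem_support, hθ] at hx ⊢
      exact_mod_cast hx
  · intro t
    exact (Complex.abs_re_le_norm _).trans (hle t)
  · intro t
    have e1 : ((𝓕 θ t).re - 1 : ℝ) = (𝓕 θ t - 1).re := by simp
    rw [e1]
    refine (Complex.abs_re_le_norm _).trans ?_
    have e2 : (1 : ℂ) = ∫ x, ((n x : ℝ) : ℂ) := by
      rw [integral_complex_ofReal, hnint]; simp
    have i1 : Integrable fun x : ℝ =>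
        Complex.exp (((-2 * Real.pi * (x * t) : ℝ) : ℂ) * Complex.I) * ((n x : ℝ) : ℂ) := by
      refine Integrable.bdd_mul (c := 1) hni.ofReal (by fun_prop) ?_
      filter_upwards with x
      exact (Complex.norm_exp_ofReal_mul_I _).le
    have i2 : Integrable fun x : ℝ => ((n x : ℝ) : ℂ) := hni.ofReal
    rw [hfour, e2, ← integral_sub i1 i2]
    refine (norm_integral_le_integral_norm _).trans ?_
    have e3 : Real.pi * |t| = ∫ x, Real.pi * |t| * n x := by
      rw [integral_const_mul, hnint, mul_one]
    rw [e3]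
    refine integral_mono_of_nonneg (by filter_upwards with x; positivity) (hni.const_mul _) ?_
    filter_upwards with x
    rw [← sub_one_mul, norm_mul, Complex.norm_real, Real.norm_of_nonneg (hn0 x)]
    by_cases hx : x ∈ tsupport n
    · refine mul_le_mul_of_nonneg_right ?_ (hn0 x)
      rw [mul_comm _ Complex.I]
      refine Real.norm_exp_I_mul_ofReal_sub_one_le.trans ?_
      rw [hnsupp] at hx
      have hx' : |x| ≤ 1 / 2 := abs_le.2 hx
      rw [Real.norm_eq_abs, abs_mul, abs_mul, abs_mul]
      have : |(-2 : ℝ)| = 2 := by norm_num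
      rw [this, abs_of_pos Real.pi_pos]
      have := mul_le_mul_of_nonneg_left hx' (by positivity : 0 ≤ 2 * Real.pi * |t|)
      linarith
    · have : n x = 0 := image_eq_zero_of_notMem_tsupport hx
      simp [this]

/-- Convolving the bump with itself squares the transform and so makes it nonnegative; `ρ² ≥ 2ρ - 1`
gives the slope `2π`. Rescaling to bandwidth `b` turns Schwartz decay into decay in `b|t|`. -/
theorem exists_scaled_window : ∃ C L : ℝ, 1 ≤ C ∧ 0 < L ∧ ∀ b : ℝ, 0 < b →
    ∃ (φ : 𝓢(ℝ, ℂ)) (ψ : ℝ → ℝ), SpectralWindow L b φ ψ ∧ ∀ t, b * |t| * ψ t ≤ C := by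
  obtain ⟨θ, hsupp, ρ, hρ, hρ1, hρn⟩ := exists_even_bump
  obtain ⟨C, hC0, hC⟩ := (𝓕 θ).decay 1 0
  refine ⟨max C 1, 2 * Real.pi, le_max_right _ _, by positivity, fun b hb => ?_⟩
  let φ₁ := SchwartzMap.convolution (ContinuousLinearMap.mul ℂ ℂ) θ θ
  have hφ₁s : tsupport (φ₁ : ℝ → ℂ) ⊆ Set.Icc (-1) 1 := by
    have := tsupport_schwartz_convolution_subset hsupp hsupp
    norm_num at this
    exact this
  have hφ₁F : ∀ t, 𝓕 φ₁ t = ((ρ t ^ 2 : ℝ) : ℂ) := by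
    intro t
    rw [fourier_schwartz_convolution, hρ]; push_cast; ring
  have hsub : tsupport (fun x : ℝ => (b⁻¹ : ℂ) * φ₁ (x / b)) ⊆ Set.Icc (-b) b := by
    refine closure_minimal (fun x hx => ?_) isClosed_Icc
    have : φ₁ (x / b) ≠ 0 := right_ne_zero_of_mul hx
    have := hφ₁s (subset_closure this)
    rw [Set.mem_Icc, le_div_iff₀ hb, div_le_iff₀ hb] at this
    constructor <;> linarith [this.1, this.2]
  have hcs : HasCompactSupport (fun x : ℝ => (b⁻¹ : ℂ) * φ₁ (x / b)) :=
    HasCompactSupport.of_support_subset_isCompact isCompact_Icc (subset_closure.trans hsub)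
  have hsm : ContDiff ℝ ∞ (fun x : ℝ => (b⁻¹ : ℂ) * φ₁ (x / b)) :=
    contDiff_const.mul ((φ₁.smooth _).comp (contDiff_id.div_const b))
  refine ⟨hcs.toSchwartzMap hsm, fun t => ρ (b * t) ^ 2, ⟨hsub, ?_, ?_, ?_, ?_⟩, ?_⟩
  · intro t
    rw [← hφ₁F, SchwartzMap.fourier_coe, SchwartzMap.fourier_coe, Real.fourier_eq', Real.fourier_eq']
    simp only [HasCompactSupport.toSchwartzMap_toFun, smul_eq_mul, RCLike.inner_apply, conj_trivial]
    have := Measure.integral_comp_div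
      (fun x : ℝ => Complex.exp (((-2 * Real.pi * (b * t * x) : ℝ) : ℂ) * Complex.I) * φ₁ x) b
    rw [abs_of_pos hb] at this
    have h2 : ∫ x : ℝ, Complex.exp (((-2 * Real.pi * (b * t * x) : ℝ) : ℂ) * Complex.I) * φ₁ x =
        (b⁻¹ : ℂ) * ∫ x : ℝ, Complex.exp (((-2 * Real.pi * (b * t * (x / b)) : ℝ) : ℂ) * Complex.I) *
          φ₁ (x / b) := by
      rw [this, Complex.real_smul, ← mul_assoc, inv_mul_cancel₀ (by exact_mod_cast hb.ne'), one_mul]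
    rw [h2, ← integral_const_mul]
    congr 1; ext x
    have : b * t * (x / b) = t * x := by field_simp
    rw [this]
    change _ * ((b⁻¹ : ℂ) * φ₁ (x / b)) = _
    ring
  · intro t; positivity
  · intro t
    have := hρ1 (b * t)
    simpa using pow_le_one₀ (n := 2) (abs_nonneg _) this
  · intro t
    have h1 := hρn (b * t)
    have h2 := hρ1 (b * t)
    rw [abs_mul, abs_of_pos hb] at h1
    rw [abs_le] at h1 h2
    nlinarith [h1.1, h1.2, h2.1, h2.2, sq_nonneg (ρ (b * t) - 1)]
  · intro t
    have h1 := hC (b * t)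
    simp only [pow_one, norm_iteratedFDeriv_zero] at h1
    rw [hρ, Complex.norm_real, Real.norm_eq_abs, Real.norm_eq_abs, abs_mul, abs_of_pos hb] at h1
    have h2 := hρ1 (b * t)
    have h3 : ρ (b * t) ^ 2 ≤ |ρ (b * t)| := by
      rw [← sq_abs]; nlinarith [abs_nonneg (ρ (b * t))]
    calc b * |t| * ρ (b * t) ^ 2 ≤ b * |t| * |ρ (b * t)| := by gcongr
      _ ≤ C := h1
      _ ≤ _ := le_max_left _ _

/-- The bandwidths `b/(j+1)` add up to only `b` times a harmonic sum. Yet at time `t` every factor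
with `j + 1 ≤ b|t|/(2C)` is at most `1/2`, so the product decays exponentially at a rate of order
`b` up to `|t| ≈ k/b`, and like `|t|^(-k)` beyond: near-exponential decay for a logarithmic loss of
bandwidth. -/
theorem exists_product_window : ∃ C L : ℝ, 1 ≤ C ∧ 0 < L ∧ ∀ b : ℝ, 0 < b → ∀ k : ℕ, 0 < k →
    ∃ (φ : 𝓢(ℝ, ℂ)) (ψ : ℝ → ℝ),
      SpectralWindow L (b * ∑ j ∈ Finset.range k, ((j : ℝ) + 1)⁻¹) φ ψ ∧
      ∀ t, t ≠ 0 → ψ t ≤ ∏ j ∈ Finset.range k, min 1 (C * (j + 1) / (b * |t|)) := by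
  obtain ⟨C, L, hC, hL, H⟩ := exists_scaled_window
  refine ⟨C, L, hC, hL, fun b hb k hk => ?_⟩
  have key : ∀ j : ℕ, ∃ (φ : 𝓢(ℝ, ℂ)) (ψ : ℝ → ℝ), SpectralWindow L (b * ((j : ℝ) + 1)⁻¹) φ ψ ∧
      ∀ t, t ≠ 0 → ψ t ≤ min 1 (C * (j + 1) / (b * |t|)) := by
    intro j
    obtain ⟨φ, ψ, hw, hd⟩ := H (b * ((j : ℝ) + 1)⁻¹) (by positivity)
    refine ⟨φ, ψ, hw, fun t ht => le_min (hw.le_one t) ?_⟩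
    have ht' : 0 < |t| := abs_pos.2 ht
    rw [le_div_iff₀ (by positivity)]
    have := hd t
    have h2 : b * ((j : ℝ) + 1)⁻¹ * |t| * ψ t * (j + 1) = ψ t * (b * |t|) := by
      field_simp
    rw [← h2]
    gcongr
  induction k, hk using Nat.le_induction with
  | base => simpa using key 0
  | succ k hk ih =>
    obtain ⟨φ₁, ψ₁, w₁, d₁⟩ := ih
    obtain ⟨φ₂, ψ₂, w₂, d₂⟩ := key k
    refine ⟨SchwartzMap.convolution (ContinuousLinearMap.mul ℂ ℂ) φ₁ φ₂, fun t => ψ₁ t * ψ₂ t,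
      ?_, ?_⟩
    · rw [Finset.sum_range_succ, mul_add]
      exact w₁.conv w₂
    · intro t ht
      rw [Finset.prod_range_succ]
      refine mul_le_mul (d₁ t ht) (d₂ t ht) (w₂.nonneg t) ?_
      refine Finset.prod_nonneg fun j _ => le_min zero_le_one ?_
      positivity

end Window

/-! ### Band-limited cut-offs of `[-T, T]`. -/

section Filter

open scoped ContDiff ComplexConjugate

/-- Here `v` is time in units of `T`. For `v ≥ 1/2` each factor is at most `(3/4)/(1+v)`, and `k ≥ S
+ 4` of them absorb the power. For smaller `v` the first `⌊2kv⌋` factors are at most `1/2`, the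
power is at most `exp (kv)`, and `2 log 2 - 1 > 1/4` leaves the exponential. -/
theorem prod_min_mul_rpow_le {k : ℕ} (hk : 0 < k) {S κ v : ℝ} (hκ1 : κ ≤ 1)
    (hv0 : 0 < v) (hκv : κ ≤ v) (hS : 0 ≤ S) (hSk : S + 4 ≤ k) :
    (∏ j ∈ Finset.range k, min 1 (((j : ℝ) + 1) / (4 * k * v))) * (1 + v) ^ (S + 4) ≤
      2 * Real.exp (-(k * κ / 4)) := by
  have hk' : (0 : ℝ) < k := by exact_mod_cast hk
  have hpos : ∀ j : ℕ, 0 ≤ min 1 (((j : ℝ) + 1) / (4 * k * v)) := fun j =>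
    le_min zero_le_one (by positivity)
  rcases le_or_gt (1 / 2) v with hv | hv
  · have h1 : ∏ j ∈ Finset.range k, min 1 (((j : ℝ) + 1) / (4 * k * v)) ≤
        ((3 / 4) / (1 + v)) ^ k := by
      calc _ ≤ ∏ _j ∈ Finset.range k, (3 / 4) / (1 + v) := by
            refine Finset.prod_le_prod (fun j _ => hpos j) fun j hj => (min_le_right _ _).trans ?_
            have hjk : (j : ℝ) + 1 ≤ k := by exact_mod_cast Finset.mem_range.1 hj
            rw [div_le_div_iff₀ (by positivity) (by positivity)]
            nlinarith [mul_le_mul_of_nonneg_right hjk (by linarith : 0 ≤ 1 + v),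
              mul_nonneg hk'.le (by linarith : 0 ≤ 2 * v - 1)]
        _ = _ := by rw [Finset.prod_const, Finset.card_range]
    have h2 : (1 + v) ^ (S + 4) ≤ (1 + v) ^ k := by
      rw [← Real.rpow_natCast]
      exact Real.rpow_le_rpow_of_exponent_le (by linarith) hSk
    calc _ ≤ ((3 / 4) / (1 + v)) ^ k * (1 + v) ^ k :=
          mul_le_mul h1 h2 (by positivity) (by positivity)
      _ = (3 / 4) ^ k := by rw [← mul_pow]; congr 1; field_simp
      _ ≤ (Real.exp (-(1 / 4))) ^ k := by
          gcongr
          linarith [Real.add_one_le_exp (-(1 / 4) : ℝ)]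
      _ = Real.exp (-(k / 4)) := by rw [← Real.exp_nat_mul]; congr 1; ring
      _ ≤ Real.exp (-(k * κ / 4)) := by
          apply Real.exp_le_exp.2
          nlinarith
      _ ≤ _ := by linarith [Real.exp_pos (-(k * κ / 4))]
  · set q := ⌊2 * k * v⌋₊ with hq
    have hqk : q ≤ k := by
      refine Nat.floor_le_of_le ?_
      nlinarith
    have hqle : (q : ℝ) ≤ 2 * k * v := Nat.floor_le (by positivity)
    have hqge : 2 * k * v - 1 ≤ q := (Nat.sub_one_lt_floor _).le
    have h1 : ∏ j ∈ Finset.range k, min 1 (((j : ℝ) + 1) / (4 * k * v)) ≤ (1 / 2) ^ q := by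
      calc _ ≤ ∏ j ∈ Finset.range q, min 1 (((j : ℝ) + 1) / (4 * k * v)) := by
            rw [← Finset.prod_range_mul_prod_Ico _ hqk]
            refine mul_le_of_le_one_right (Finset.prod_nonneg fun j _ => hpos j) ?_
            exact Finset.prod_le_one (fun j _ => hpos j) fun j _ => min_le_left _ _
        _ ≤ ∏ _j ∈ Finset.range q, (1 / 2 : ℝ) := by
            refine Finset.prod_le_prod (fun j _ => hpos j) fun j hj => (min_le_right _ _).trans ?_
            have hjk : (j : ℝ) + 1 ≤ q := by exact_mod_cast Finset.mem_range.1 hj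
            rw [div_le_div_iff₀ (by positivity) (by positivity)]
            nlinarith
        _ = _ := by simp
    have h2 : ((1 : ℝ) / 2) ^ q ≤ 2 * Real.exp (-(Real.log 2 * (2 * k * v))) := by
      have : ((1 : ℝ) / 2) ^ q = Real.exp (-(Real.log 2 * q)) := by
        rw [one_div, inv_pow, Real.exp_neg, mul_comm, Real.exp_nat_mul,
          Real.exp_log (by norm_num)]
      rw [this]
      have e : 2 * Real.exp (-(Real.log 2 * (2 * k * v))) =
          Real.exp (Real.log 2 + -(Real.log 2 * (2 * k * v))) := by
        rw [Real.exp_add, Real.exp_log (by norm_num)]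
      rw [e]
      apply Real.exp_le_exp.2
      nlinarith [Real.log_pos (by norm_num : (1 : ℝ) < 2)]
    have h3 : (1 + v) ^ (S + 4) ≤ Real.exp (k * v) := by
      calc (1 + v) ^ (S + 4) ≤ (Real.exp v) ^ (S + 4) := by
            apply Real.rpow_le_rpow (by linarith) _ (by linarith)
            linarith [Real.add_one_le_exp v]
        _ = Real.exp (v * (S + 4)) := by rw [← Real.exp_mul]
        _ ≤ _ := Real.exp_le_exp.2 (by nlinarith)
    calc _ ≤ (2 * Real.exp (-(Real.log 2 * (2 * k * v)))) * Real.exp (k * v) :=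
          mul_le_mul (h1.trans h2) h3 (by positivity) (by positivity)
      _ = 2 * Real.exp (-(Real.log 2 * (2 * k * v)) + k * v) := by rw [Real.exp_add]; ring
      _ ≤ _ := by
          gcongr
          have hl := Real.log_two_gt_d9
          have : k * κ ≤ k * v := by gcongr
          have h5 : 0 < k * v := by positivity
          nlinarith

/-- Multiplying a spectral window by a Dirichlet-type kernel integrates its Fourier transform over
a moving interval. -/
theorem exists_fourier_eq_setIntegral {L B : ℝ} {φ : 𝓢(ℝ, ℂ)} {ψ : ℝ → ℝ}
    (hw : SpectralWindow L B φ ψ) {T : ℝ} (hT : 0 ≤ T) (c : ℝ) :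
    ∃ χ : 𝓢(ℝ, ℂ), tsupport (χ : ℝ → ℂ) ⊆ Set.Icc (-B) B ∧
      ∀ t, 𝓕 χ t = ((c * ∫ x in Set.Icc (t - T) (t + T), ψ x : ℝ) : ℂ) := by
  let u : ℝ → ℂ := (Set.Icc (-T) T).indicator fun _ => 1
  have hu : Integrable u := (integrable_indicator_iff measurableSet_Icc).2 (by simp)
  have hui : ∀ n : ℕ, (n : ℕ∞) ≤ (⊤ : ℕ∞) → Integrable fun v => ‖v‖ ^ n * ‖u v‖ := by
    intro n _
    have : (fun v : ℝ => ‖v‖ ^ n * ‖u v‖) = (Set.Icc (-T) T).indicator fun v => ‖v‖ ^ n := by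
      ext v
      by_cases hv : v ∈ Set.Icc (-T) T <;> simp [u, hv]
    rw [this, integrable_indicator_iff measurableSet_Icc]
    exact (continuous_norm.pow n).continuousOn.integrableOn_compact isCompact_Icc
  have hD : ContDiff ℝ ∞ (𝓕 u) := Real.contDiff_fourier hui
  let f : ℝ → ℂ := fun x => (c : ℂ) * (φ x * 𝓕 u x)
  have hfs : tsupport f ⊆ Set.Icc (-B) B := by
    refine closure_minimal (fun x hx => ?_) isClosed_Icc
    exact hw.tsupport_subset (subset_closure (left_ne_zero_of_mul (right_ne_zero_of_mul hx)))
  have hfc : HasCompactSupport f :=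
    HasCompactSupport.of_support_subset_isCompact isCompact_Icc (subset_closure.trans hfs)
  have hfd : ContDiff ℝ ∞ f := contDiff_const.mul ((φ.smooth _).mul hD)
  refine ⟨hfc.toSchwartzMap hfd, hfs, fun t => ?_⟩
  have e0 : 𝓕 (hfc.toSchwartzMap hfd) t = 𝓕 f t := by
    rw [SchwartzMap.fourier_coe]; rfl
  have e1 : 𝓕 f t = (c : ℂ) * ∫ x, 𝓕 u x * (Complex.exp (((-2 * Real.pi * (x * t) : ℝ) : ℂ) * Complex.I) * φ x) := by
    rw [Real.fourier_eq', ← integral_const_mul]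
    congr 1; ext x
    simp only [f, smul_eq_mul, RCLike.inner_apply, conj_trivial]
    rw [mul_comm t x]
    ring
  let m : ℝ → ℂ := fun x => Complex.exp (((-2 * Real.pi * (x * t) : ℝ) : ℂ) * Complex.I) * φ x
  have hm : Integrable m := by
    refine φ.integrable.bdd_mul (c := 1) (by fun_prop) ?_
    filter_upwards with x
    exact (Complex.norm_exp_ofReal_mul_I _).le
  have hmF : ∀ s, 𝓕 m s = (ψ (t + s) : ℂ) := by
    intro s
    rw [← hw.fourier_eq, SchwartzMap.fourier_coe, Real.fourier_eq', Real.fourier_eq']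
    congr 1; ext x
    simp only [m, smul_eq_mul, RCLike.inner_apply, conj_trivial]
    rw [← mul_assoc, ← Complex.exp_add]
    congr 2
    push_cast; ring
  have e2 : ∫ x, 𝓕 u x * m x = ∫ s, u s * 𝓕 m s := integral_fourier_mul_eq hu hm
  have e3 : ∫ s, u s * 𝓕 m s = ∫ s in Set.Icc (-T) T, (ψ (t + s) : ℂ) := by
    rw [← integral_indicator measurableSet_Icc]
    congr 1; ext s
    by_cases hs : s ∈ Set.Icc (-T) T <;> simp [u, hs, hmF]
  rw [e0, e1]
  change (c : ℂ) * ∫ x, 𝓕 u x * m x = _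
  rw [e2, e3, integral_complex_ofReal]
  push_cast
  congr 2
  rw [integral_Icc_eq_integral_Ioc, integral_Icc_eq_integral_Ioc,
    ← intervalIntegral.integral_of_le (by linarith), ← intervalIntegral.integral_of_le (by linarith),
    intervalIntegral.integral_comp_add_left (fun x => ψ x) t]
  simp [sub_eq_add_neg]

end Filter

section Filter

open scoped ContDiff ComplexConjugate

theorem SpectralWindow.integrable {L B : ℝ} {φ : 𝓢(ℝ, ℂ)} {ψ : ℝ → ℝ}
    (hw : SpectralWindow L B φ ψ) : Integrable ψ := by
  have : ψ = fun t => (𝓕 φ t).re := by ext t; rw [hw.fourier_eq]; simp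
  rw [this]
  exact (𝓕 φ).integrable.re

/-- `ψ ≥ 1/2` for `|x| ≤ 1/(2LB)`. This keeps the normalising factor `(∫ ψ)⁻¹` of the cut-off at
most of order `B`. -/
theorem SpectralWindow.one_le_mul_integral {L B : ℝ} {φ : 𝓢(ℝ, ℂ)} {ψ : ℝ → ℝ}
    (hw : SpectralWindow L B φ ψ) (hLB : 0 < L * B) : 1 ≤ 2 * (L * B) * ∫ x, ψ x := by
  set r := 1 / (2 * (L * B)) with hr
  have hr0 : 0 < r := by positivity
  have h1 : ∫ x in Set.Icc (-r) r, (1 / 2 : ℝ) ≤ ∫ x in Set.Icc (-r) r, ψ x := by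
    refine setIntegral_mono_on (by simp) hw.integrable.integrableOn measurableSet_Icc ?_
    intro x hx
    have := hw.near_zero x
    have h2 : L * B * |x| ≤ L * B * r := by gcongr; exact abs_le.2 hx
    have h3 : L * B * r = 1 / 2 := by
      rw [hr]; field_simp; exact div_self hLB.ne'
    linarith
  have h2 : ∫ x in Set.Icc (-r) r, ψ x ≤ ∫ x, ψ x :=
    setIntegral_le_integral hw.integrable (Filter.Eventually.of_forall hw.nonneg)
  have h3 : ∫ x in Set.Icc (-r) r, (1 / 2 : ℝ) = r := by
    rw [setIntegral_const]
    simp only [Measure.real, Real.volume_Icc, smul_eq_mul]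
    rw [ENNReal.toReal_ofReal (by linarith)]; ring
  rw [h3] at h1
  have h4 : 2 * (L * B) * r = 1 := by
    rw [hr]; field_simp; exact div_self hLB.ne'
  calc (1 : ℝ) = 2 * (L * B) * r := h4.symm
    _ ≤ _ := by gcongr; exact h1.trans h2

theorem integrable_one_add_abs_div_sq {T : ℝ} (hT : 0 < T) :
    Integrable fun x : ℝ => ((1 + |x| / T) ^ 2)⁻¹ := by
  have h : Integrable fun x : ℝ => (1 + ‖x‖) ^ (-2 : ℝ) := integrable_one_add_norm (by simp)
  have h2 := h.comp_div hT.ne'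
  refine h2.congr (Filter.Eventually.of_forall fun x => ?_)
  simp only [norm_div, Real.norm_eq_abs, abs_of_pos hT]
  rw [Real.rpow_neg (by positivity)]
  norm_num

theorem integral_one_add_abs_div_sq {T : ℝ} (hT : 0 < T) :
    ∫ x : ℝ, ((1 + |x| / T) ^ 2)⁻¹ = T * ∫ x : ℝ, ((1 + |x|) ^ 2)⁻¹ := by
  have := Measure.integral_comp_div (fun x : ℝ => ((1 + |x|) ^ 2)⁻¹) T
  simpa [abs_div, abs_of_pos hT] using this

/-- Of the exponent `S + 4`, two powers pay for integrability of the tail; the other `S + 2` are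
evaluated at its inner end `y`. -/
theorem tail_setIntegral_le {ψ : ℝ → ℝ} (hψ : Integrable ψ) {T M S κ y : ℝ} (hT : 0 < T)
    (hM : 0 ≤ M) (hy : κ * T ≤ y) (hκ : 0 < κ) (hS : 0 ≤ S)
    (hd : ∀ x, κ * T ≤ |x| → ψ x * (1 + |x| / T) ^ (S + 4) ≤ M) :
    ∫ x in {x : ℝ | y ≤ |x|}, ψ x ≤
      M * (T * ∫ x : ℝ, ((1 + |x|) ^ 2)⁻¹) * (1 + y / T) ^ (-(S + 2)) := by
  have hms : MeasurableSet {x : ℝ | y ≤ |x|} := measurableSet_le measurable_const measurable_norm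
  have hy0 : 0 < y := lt_of_lt_of_le (by positivity) hy
  rw [← integral_one_add_abs_div_sq hT, mul_right_comm, ← integral_const_mul]
  have hi := (integrable_one_add_abs_div_sq hT).const_mul (M * (1 + y / T) ^ (-(S + 2)))
  calc _ ≤ ∫ x in {x : ℝ | y ≤ |x|}, M * (1 + y / T) ^ (-(S + 2)) * ((1 + |x| / T) ^ 2)⁻¹ := by
        refine setIntegral_mono_on hψ.integrableOn hi.integrableOn hms fun x hx => ?_
        have hx' : y ≤ |x| := hx
        have h1 := hd x (hy.trans hx')
        have hp : 0 < 1 + |x| / T := by positivity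
        have hpy : 0 < 1 + y / T := by positivity
        have e : (1 + |x| / T) ^ (S + 4) = (1 + |x| / T) ^ (S + 2) * (1 + |x| / T) ^ 2 := by
          rw [← Real.rpow_natCast, ← Real.rpow_add hp]; congr 1; push_cast; ring
        rw [e] at h1
        have h2 : (1 + y / T) ^ (S + 2) ≤ (1 + |x| / T) ^ (S + 2) :=
          Real.rpow_le_rpow hpy.le (by gcongr) (by linarith)
        have hA : 0 < (1 + y / T) ^ (S + 2) := by positivity
        have hA' : 0 < (1 + |x| / T) ^ (S + 2) := by positivity
        rw [Real.rpow_neg hpy.le]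
        calc ψ x ≤ M / ((1 + |x| / T) ^ (S + 2) * (1 + |x| / T) ^ 2) := by
              rw [le_div_iff₀ (by positivity)]; exact h1
          _ ≤ M / ((1 + y / T) ^ (S + 2) * (1 + |x| / T) ^ 2) := by gcongr
          _ = _ := by rw [div_eq_mul_inv, mul_inv, mul_assoc]
    _ ≤ _ := setIntegral_le_integral hi (Filter.Eventually.of_forall fun x => by positivity)

/-- A band-limited cut-off: close to `1` on `[-(1-2κ)T, (1-2κ)T]`, between `0` and `1`, and
decaying faster than `|t/T| ^ (-S)` outside `[-T, T]`. -/
theorem exists_bandlimited_cutoff : ∃ C : ℝ, 1 ≤ C ∧ ∀ (T S κ : ℝ) (k : ℕ), 0 < T → 0 ≤ S →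
    0 < κ → κ ≤ 1 → S + 4 ≤ k → ∃ (χ : 𝓢(ℝ, ℂ)) (H : ℝ → ℝ),
      tsupport (χ : ℝ → ℂ) ⊆
        Set.Icc (-(C * k / T * ∑ j ∈ Finset.range k, ((j : ℝ) + 1)⁻¹))
          (C * k / T * ∑ j ∈ Finset.range k, ((j : ℝ) + 1)⁻¹) ∧
      (∀ t, 𝓕 χ t = (H t : ℂ)) ∧ (∀ t, 0 ≤ H t) ∧ (∀ t, H t ≤ 1) ∧
      (∀ t, |t| ≤ T * (1 - 2 * κ) → 1 - H t ≤ C * k ^ 2 * Real.exp (-(k * κ / 4))) ∧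
      (∀ t, T ≤ |t| →
        H t ≤ C * k ^ 2 * Real.exp (-(k * κ / 4)) * (|t| / T) ^ (-(S + 2))) := by
  obtain ⟨C₀, L, hC₀, hL, hwin⟩ := exists_product_window
  set c₁ := ∫ x : ℝ, ((1 + |x|) ^ 2)⁻¹ with hc₁
  have hc₁0 : 0 ≤ c₁ := integral_nonneg fun x => by positivity
  refine ⟨max (4 * C₀) (16 * L * C₀ * c₁), by
    exact le_max_of_le_left (by linarith), fun T S κ k hT hS hκ hκ1 hSk => ?_⟩
  set C := max (4 * C₀) (16 * L * C₀ * c₁)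
  have hk0 : (0 : ℝ) < k := by linarith
  have hk : 0 < k := by exact_mod_cast hk0
  -- This bandwidth turns the factor bounds into `(j+1)/(4kv)` with `v = |t|/T`, the form of
  -- `prod_min_mul_rpow_le`.
  obtain ⟨φ, ψ, hw, hdec⟩ := hwin (4 * C₀ * k / T) (by positivity) k hk
  set B := 4 * C₀ * k / T * ∑ j ∈ Finset.range k, ((j : ℝ) + 1)⁻¹ with hB
  have hsum_le : ∑ j ∈ Finset.range k, ((j : ℝ) + 1)⁻¹ ≤ k := by
    calc _ ≤ ∑ _j ∈ Finset.range k, (1 : ℝ) :=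
          Finset.sum_le_sum fun j _ => inv_le_one_of_one_le₀ (by linarith [Nat.cast_nonneg (α := ℝ) j])
      _ = k := by simp
  have hsum_pos : 0 < ∑ j ∈ Finset.range k, ((j : ℝ) + 1)⁻¹ :=
    Finset.sum_pos (fun j _ => by positivity) ⟨0, Finset.mem_range.2 hk⟩
  have hB0 : 0 < B := by positivity
  set I := ∫ x, ψ x with hI
  have hI1 : 1 ≤ 2 * (L * B) * I := hw.one_le_mul_integral (by positivity)
  have hI0 : 0 < I := by
    by_contra hcon
    have : 2 * (L * B) * I ≤ 0 := mul_nonpos_of_nonneg_of_nonpos (by positivity) (not_lt.1 hcon)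
    linarith
  have hψi := hw.integrable
  set M := 2 * Real.exp (-(k * κ / 4)) with hM
  have hdM : ∀ x, κ * T ≤ |x| → ψ x * (1 + |x| / T) ^ (S + 4) ≤ M := by
    intro x hx
    have hx0 : 0 < |x| := lt_of_lt_of_le (by positivity) hx
    have h1 := hdec x (abs_pos.1 hx0)
    have h2 := prod_min_mul_rpow_le hk (S := S) (v := |x| / T) hκ1 (by positivity)
      (by rw [le_div_iff₀ hT]; exact hx) hS hSk
    refine le_trans (mul_le_mul_of_nonneg_right h1 (by positivity)) (le_trans (le_of_eq ?_) h2)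
    congr 1
    refine Finset.prod_congr rfl fun j _ => ?_
    congr 1
    field_simp
  set m := C * k ^ 2 * Real.exp (-(k * κ / 4)) with hm
  have hmI : I⁻¹ * (M * (T * c₁)) ≤ m := by
    have h1 : I⁻¹ ≤ 2 * (L * B) := by
      rw [inv_le_iff_one_le_mul₀ hI0]; exact hI1
    have h2 : T * B ≤ 4 * C₀ * k ^ 2 := by
      have : T * B = 4 * C₀ * k * ∑ j ∈ Finset.range k, ((j : ℝ) + 1)⁻¹ := by
        rw [hB]; field_simp
      rw [this, pow_two, ← mul_assoc]
      gcongr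
    calc I⁻¹ * (M * (T * c₁)) ≤ 2 * (L * B) * (M * (T * c₁)) := by gcongr
      _ = 4 * L * c₁ * (T * B) * Real.exp (-(k * κ / 4)) := by rw [hM]; ring
      _ ≤ 4 * L * c₁ * (4 * C₀ * k ^ 2) * Real.exp (-(k * κ / 4)) := by gcongr
      _ = (16 * L * C₀ * c₁) * k ^ 2 * Real.exp (-(k * κ / 4)) := by ring
      _ ≤ m := by
        rw [hm]; gcongr; exact le_max_right _ _
  have htail : ∀ y, κ * T ≤ y → I⁻¹ * ∫ x in {x : ℝ | y ≤ |x|}, ψ x ≤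
      m * (1 + y / T) ^ (-(S + 2)) := by
    intro y hy
    have hy0 : 0 < y := lt_of_lt_of_le (by positivity) hy
    have h := tail_setIntegral_le hψi hT (by positivity : 0 ≤ M) hy hκ hS hdM
    calc _ ≤ I⁻¹ * (M * (T * c₁) * (1 + y / T) ^ (-(S + 2))) := by gcongr
      _ = I⁻¹ * (M * (T * c₁)) * (1 + y / T) ^ (-(S + 2)) := by ring
      _ ≤ _ := by gcongr
  have hm0 : 0 ≤ m := by positivity
  -- The cut-off is the average of `ψ` over an interval of half-length `T'`. The margin `κT` on
  -- either side means that a point with `|t| ≤ T(1 - 2κ)` misses only mass of `ψ` beyond `κT`, and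
  -- a point with `|t| ≥ T` meets only such mass.
  set T' := T * (1 - κ) with hT'
  have hT'0 : 0 ≤ T' := mul_nonneg hT.le (by linarith)
  obtain ⟨χ, hχs, hχF⟩ := exists_fourier_eq_setIntegral hw hT'0 I⁻¹
  refine ⟨χ, fun t => I⁻¹ * ∫ x in Set.Icc (t - T') (t + T'), ψ x, hχs.trans ?_, hχF, ?_, ?_, ?_, ?_⟩
  · have hBC : B ≤ C * k / T * ∑ j ∈ Finset.range k, ((j : ℝ) + 1)⁻¹ := by
      rw [hB]; gcongr; exact le_max_left _ _
    exact Set.Icc_subset_Icc (neg_le_neg hBC) hBC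
  · intro t
    exact mul_nonneg (by positivity) (integral_nonneg fun x => hw.nonneg x)
  · intro t
    have : ∫ x in Set.Icc (t - T') (t + T'), ψ x ≤ I :=
      setIntegral_le_integral hψi (Filter.Eventually.of_forall hw.nonneg)
    rw [inv_mul_le_iff₀ hI0]; linarith
  · intro t ht
    have hsplit := integral_add_compl (s := Set.Icc (t - T') (t + T')) measurableSet_Icc hψi
    have hsub : (Set.Icc (t - T') (t + T'))ᶜ ⊆ {x : ℝ | κ * T ≤ |x|} := by
      intro x hx
      by_contra hcon
      simp only [Set.mem_ofPred_eq, not_le, abs_lt] at hcon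
      rw [abs_le] at ht
      apply hx
      constructor <;> nlinarith [ht.1, ht.2, hcon.1, hcon.2]
    have h1 : ∫ x in (Set.Icc (t - T') (t + T'))ᶜ, ψ x ≤ ∫ x in {x : ℝ | κ * T ≤ |x|}, ψ x :=
      setIntegral_mono_set hψi.integrableOn (Filter.Eventually.of_forall hw.nonneg)
        hsub.eventuallyLE
    have h2 := htail (κ * T) le_rfl
    have h3 : (1 + κ * T / T) ^ (-(S + 2)) ≤ 1 :=
      Real.rpow_le_one_of_one_le_of_nonpos (by rw [le_add_iff_nonneg_right]; positivity) (by linarith)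
    have h4 : I⁻¹ * ∫ x in (Set.Icc (t - T') (t + T'))ᶜ, ψ x ≤ m := by
      calc _ ≤ I⁻¹ * ∫ x in {x : ℝ | κ * T ≤ |x|}, ψ x := by gcongr
        _ ≤ _ := h2
        _ ≤ m * 1 := by gcongr
        _ = m := mul_one m
    have h5 : I⁻¹ * I = 1 := inv_mul_cancel₀ hI0.ne'
    rw [← hI] at hsplit
    have h6 : I⁻¹ * ∫ x in Set.Icc (t - T') (t + T'), ψ x =
        1 - I⁻¹ * ∫ x in (Set.Icc (t - T') (t + T'))ᶜ, ψ x := by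
      rw [← h5, ← hsplit]; ring
    simp only [h6]
    linarith
  · intro t ht
    have hy : κ * T ≤ |t| - T' := by rw [hT']; nlinarith
    have hsub : Set.Icc (t - T') (t + T') ⊆ {x : ℝ | |t| - T' ≤ |x|} := by
      intro x hx
      simp only [Set.mem_ofPred_eq]
      have h1 : |t - x| ≤ T' := abs_le.2 ⟨by linarith [hx.1, hx.2], by linarith [hx.1, hx.2]⟩
      have h2 := abs_sub_abs_le_abs_sub t x
      linarith
    have h1 : ∫ x in Set.Icc (t - T') (t + T'), ψ x ≤ ∫ x in {x : ℝ | |t| - T' ≤ |x|}, ψ x :=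
      setIntegral_mono_set hψi.integrableOn (Filter.Eventually.of_forall hw.nonneg)
        hsub.eventuallyLE
    calc _ ≤ I⁻¹ * ∫ x in {x : ℝ | |t| - T' ≤ |x|}, ψ x :=
          mul_le_mul_of_nonneg_left h1 (by positivity)
      _ ≤ m * (1 + (|t| - T') / T) ^ (-(S + 2)) := htail _ hy
      _ ≤ _ := by
        gcongr ?_ * ?_
        have ht0 : 0 < |t| := lt_of_lt_of_le hT ht
        refine Real.rpow_le_rpow_of_nonpos (by positivity) ?_ (by linarith)
        have : 1 + (|t| - T') / T = |t| / T + κ := by rw [hT']; field_simp; ring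
        rw [this]; linarith

end Filter

/-! ### The autocorrelation of the truncated signal. -/

section Correlation

open scoped ComplexConjugate

theorem setIntegral_Icc_eq_meanSq {T : ℝ} (hT : 0 < T) (h : ℝ → ℂ) :
    ∫ t in Set.Icc (-T) T, ‖h t‖ ^ 2 = 2 * T * meanSq T h := by
  have hv : volume.real (Set.Icc (-T) T) = 2 * T := by
    rw [Measure.real, Real.volume_Icc, ENNReal.toReal_ofReal (by linarith)]; ring
  rw [meanSq, setAverage_eq, hv, smul_eq_mul]
  field_simp

theorem integral_norm_sq_indicator {T : ℝ} (hT : 0 < T) (h : ℝ → ℂ) :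
    ∫ t, ‖(Set.Icc (-T) T).indicator h t‖ ^ 2 = 2 * T * meanSq T h := by
  rw [← setIntegral_Icc_eq_meanSq hT, ← integral_indicator measurableSet_Icc]
  congr 1; ext t
  by_cases ht : t ∈ Set.Icc (-T) T <;> simp [ht]

theorem mul_le_half_add {s a b : ℝ} (hs : 0 < s) : a * b ≤ s / 2 * a ^ 2 + 1 / (2 * s) * b ^ 2 := by
  have h : s / 2 * a ^ 2 + 1 / (2 * s) * b ^ 2 - a * b = (s * a - b) ^ 2 / (2 * s) := by
    field_simp; ring
  have : 0 ≤ (s * a - b) ^ 2 / (2 * s) := by positivity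
  linarith

/-- Weighting the inequality of means by `s` makes each cross term cost `sN`, and the quadratic term
costs `s²N ≤ sN`. The norm is kept inside the integral because the same bound feeds Markov's
inequality for the noise. -/
theorem integral_norm_lagProduct_sub_le {G d : ℝ → ℂ} (hG : Measurable G) (hd : Measurable d)
    (hG2 : Integrable fun t => ‖G t‖ ^ 2) (hd2 : Integrable fun t => ‖d t‖ ^ 2) {s N : ℝ}
    (hs : 0 < s) (hs1 : s ≤ 1) (hN : ∫ t, ‖G t‖ ^ 2 ≤ N) (hdN : ∫ t, ‖d t‖ ^ 2 ≤ s ^ 2 * N) (β : ℝ) :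
    Integrable (fun t => G (t + β) * conj (G t)) ∧
    Integrable (fun t => (G (t + β) + d (t + β)) * conj (G t + d t)) ∧
    ∫ t, ‖(G (t + β) + d (t + β)) * conj (G t + d t) - G (t + β) * conj (G t)‖ ≤ 3 * s * N := by
  have hN0 : 0 ≤ N := (integral_nonneg fun t => by positivity).trans hN
  have hG2' : Integrable fun t => ‖G (t + β)‖ ^ 2 := hG2.comp_add_right β
  have hd2' : Integrable fun t => ‖d (t + β)‖ ^ 2 := hd2.comp_add_right β
  have eG : ∫ t, ‖G (t + β)‖ ^ 2 = ∫ t, ‖G t‖ ^ 2 := integral_add_right_eq_self (fun t => ‖G t‖ ^ 2) β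
  have ed : ∫ t, ‖d (t + β)‖ ^ 2 = ∫ t, ‖d t‖ ^ 2 := integral_add_right_eq_self (fun t => ‖d t‖ ^ 2) β
  have prodInt : ∀ u v : ℝ → ℂ, Measurable u → Measurable v → Integrable (fun t => ‖u t‖ ^ 2) →
      Integrable (fun t => ‖v t‖ ^ 2) → Integrable fun t => u t * conj (v t) := by
    intro u v hu hv hu2 hv2
    refine Integrable.mono' ((hu2.const_mul (1 / 2)).add (hv2.const_mul (1 / 2)))
      (hu.mul (Complex.continuous_conj.measurable.comp hv)).aestronglyMeasurable ?_
    filter_upwards with t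
    rw [norm_mul, RCLike.norm_conj]
    have := mul_le_half_add (s := 1) (a := ‖u t‖) (b := ‖v t‖) one_pos
    simpa using this
  have hGs : Measurable fun t => G (t + β) := hG.comp (measurable_add_const β)
  have hds : Measurable fun t => d (t + β) := hd.comp (measurable_add_const β)
  have i1 := prodInt _ _ hGs hG hG2' hG2
  have i2 := prodInt _ _ hGs hd hG2' hd2
  have i3 := prodInt _ _ hds hG hd2' hG2
  have i4 := prodInt _ _ hds hd hd2' hd2
  have isum : Integrable fun t => (G (t + β) + d (t + β)) * conj (G t + d t) := by
    refine (((i1.add i2).add i3).add i4).congr (Filter.Eventually.of_forall fun t => ?_)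
    simp only [Pi.add_apply, map_add]
    ring
  refine ⟨i1, isum, ?_⟩
  have hbound : ∀ t, ‖(G (t + β) + d (t + β)) * conj (G t + d t) - G (t + β) * conj (G t)‖ ≤
      (s / 2 * ‖G (t + β)‖ ^ 2 + 1 / (2 * s) * ‖d t‖ ^ 2) +
      (s / 2 * ‖G t‖ ^ 2 + 1 / (2 * s) * ‖d (t + β)‖ ^ 2) +
      (1 / 2 * ‖d (t + β)‖ ^ 2 + 1 / 2 * ‖d t‖ ^ 2) := by
    intro t
    have e : (G (t + β) + d (t + β)) * conj (G t + d t) - G (t + β) * conj (G t) =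
        G (t + β) * conj (d t) + d (t + β) * conj (G t) + d (t + β) * conj (d t) := by
      rw [map_add]; ring
    rw [e]
    refine norm_add₃_le.trans ?_
    simp only [norm_mul, RCLike.norm_conj]
    have h1 := mul_le_half_add (a := ‖G (t + β)‖) (b := ‖d t‖) hs
    have h2 := mul_le_half_add (a := ‖G t‖) (b := ‖d (t + β)‖) hs
    have h3 := mul_le_half_add (a := ‖d (t + β)‖) (b := ‖d t‖) one_pos
    norm_num at h3
    linarith
  have ib := (((hG2'.const_mul (s / 2)).add (hd2.const_mul (1 / (2 * s)))).add
    ((hG2.const_mul (s / 2)).add (hd2'.const_mul (1 / (2 * s))))).add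
      ((hd2'.const_mul (1 / 2)).add (hd2.const_mul (1 / 2)))
  refine (integral_mono_of_nonneg (Filter.Eventually.of_forall fun t => norm_nonneg _) ib
    (Filter.Eventually.of_forall hbound)).trans ?_
  rw [integral_add' (((hG2'.const_mul (s / 2)).add (hd2.const_mul (1 / (2 * s)))).add
      ((hG2.const_mul (s / 2)).add (hd2'.const_mul (1 / (2 * s)))))
      ((hd2'.const_mul (1 / 2)).add (hd2.const_mul (1 / 2))),
    integral_add' ((hG2'.const_mul (s / 2)).add (hd2.const_mul (1 / (2 * s))))
      ((hG2.const_mul (s / 2)).add (hd2'.const_mul (1 / (2 * s)))),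
    integral_add' (hG2'.const_mul (s / 2)) (hd2.const_mul (1 / (2 * s))),
    integral_add' (hG2.const_mul (s / 2)) (hd2'.const_mul (1 / (2 * s))),
    integral_add' (hd2'.const_mul (1 / 2)) (hd2.const_mul (1 / 2))]
  simp only [integral_const_mul, eG, ed]
  have hA : 1 / (2 * s) * ∫ t, ‖d t‖ ^ 2 ≤ s / 2 * N := by
    calc _ ≤ 1 / (2 * s) * (s ^ 2 * N) := by gcongr
      _ = _ := by field_simp
  have hB : s / 2 * ∫ t, ‖G t‖ ^ 2 ≤ s / 2 * N := by gcongr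
  have hC : s ^ 2 * N ≤ s * N := by
    apply mul_le_mul_of_nonneg_right _ hN0
    nlinarith
  linarith

theorem norm_autocorrelation_perturb_le {G d : ℝ → ℂ} (hG : Measurable G) (hd : Measurable d)
    (hG2 : Integrable fun t => ‖G t‖ ^ 2) (hd2 : Integrable fun t => ‖d t‖ ^ 2) {s N : ℝ}
    (hs : 0 < s) (hs1 : s ≤ 1) (hN : ∫ t, ‖G t‖ ^ 2 ≤ N) (hdN : ∫ t, ‖d t‖ ^ 2 ≤ s ^ 2 * N) (β : ℝ) :
    ‖(∫ t, (G (t + β) + d (t + β)) * conj (G t + d t)) - ∫ t, G (t + β) * conj (G t)‖ ≤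
      3 * s * N := by
  obtain ⟨i1, isum, h⟩ := integral_norm_lagProduct_sub_le hG hd hG2 hd2 hs hs1 hN hdN β
  rw [← integral_sub isum i1]
  exact (norm_integral_le_integral_norm _).trans h

theorem mul_fourier_eq_fourier_translate (χ : 𝓢(ℝ, ℂ)) {B : ℝ}
    (hχ : tsupport (χ : ℝ → ℂ) ⊆ Set.Icc (-B) B) (ξ : ℝ) :
    ∃ χ' : 𝓢(ℝ, ℂ), HasCompactSupport (χ' : ℝ → ℂ) ∧
      tsupport (χ' : ℝ → ℂ) ⊆ Set.Icc (ξ - B) (ξ + B) ∧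
      ∀ t, 𝓕 χ' t = Complex.exp (((-2 * Real.pi * (t * ξ) : ℝ) : ℂ) * Complex.I) * 𝓕 χ t := by
  let f : ℝ → ℂ := fun x => χ (x - ξ)
  have hfs : tsupport f ⊆ Set.Icc (ξ - B) (ξ + B) := by
    refine closure_minimal (fun x hx => ?_) isClosed_Icc
    have := hχ (subset_closure (show x - ξ ∈ Function.support χ from hx))
    constructor <;> linarith [this.1, this.2]
  have hfc : HasCompactSupport f :=
    HasCompactSupport.of_support_subset_isCompact isCompact_Icc (subset_closure.trans hfs)
  have hfd : ContDiff ℝ (⊤ : ℕ∞) f := (χ.smooth _).comp (contDiff_id.sub contDiff_const)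
  refine ⟨hfc.toSchwartzMap hfd, hfc, hfs, fun t => ?_⟩
  have e0 : 𝓕 (hfc.toSchwartzMap hfd) t = 𝓕 f t := by
    rw [SchwartzMap.fourier_coe]; rfl
  rw [e0, SchwartzMap.fourier_coe, Real.fourier_eq', Real.fourier_eq', ← integral_const_mul,
    ← integral_add_right_eq_self _ ξ]
  congr 1; ext x
  simp only [f, smul_eq_mul, RCLike.inner_apply, conj_trivial, add_sub_cancel_right]
  rw [← mul_assoc (Complex.exp _) (Complex.exp _), ← Complex.exp_add]
  congr 2
  push_cast; ring

/-- The value at `ξ` is the distribution `ĝ` paired with the translate of `χ` to `ξ`, whose support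
misses that of `ĝ`. -/
theorem fourier_mul_eq_zero_of_fourierSupportIn {g : ℝ → ℂ} {f₀ Δ B : ℝ}
    (hg : FourierSupportIn g (Set.Icc (f₀ - Δ) (f₀ + Δ))) (χ : 𝓢(ℝ, ℂ))
    (hχ : tsupport (χ : ℝ → ℂ) ⊆ Set.Icc (-B) B) {ξ : ℝ}
    (hξ : ξ ∉ Set.Icc (f₀ - (Δ + B)) (f₀ + (Δ + B))) :
    𝓕 (fun t => g t * 𝓕 χ t) ξ = 0 := by
  obtain ⟨χ', hc, hs, hF⟩ := mul_fourier_eq_fourier_translate χ hχ ξ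
  have hdisj : Disjoint (tsupport (χ' : ℝ → ℂ)) (Set.Icc (f₀ - Δ) (f₀ + Δ)) := by
    rw [Set.disjoint_left]
    intro x hx hx'
    have := hs hx
    apply hξ
    constructor <;> linarith [this.1, this.2, hx'.1, hx'.2]
  rw [← hg χ' hc hdisj, Real.fourier_eq']
  congr 1; ext t
  rw [hF]
  simp only [smul_eq_mul, RCLike.inner_apply, conj_trivial]
  rw [mul_comm ξ t]
  ring

end Correlation

section Correlation

open scoped ComplexConjugate

theorem integrableOn_norm_sq_of_le {g : ℝ → ℂ} (hg : Measurable g) {T M : ℝ}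
    (h : ∀ t ∈ Set.Icc (-T) T, ‖g t‖ ^ 2 ≤ M) :
    IntegrableOn (fun t => ‖g t‖ ^ 2) (Set.Icc (-T) T) := by
  refine Measure.integrableOn_of_bounded (M := M) (by simp) (hg.norm.pow_const 2).aestronglyMeasurable ?_
  rw [ae_restrict_iff' measurableSet_Icc]
  filter_upwards with t ht
  rw [Real.norm_of_nonneg (by positivity)]
  exact h t ht

/-- A mean square cannot exceed the supremum. -/
theorem one_le_of_norm_sq_le_mul_meanSq {g : ℝ → ℂ} (hg : Measurable g) {T R : ℝ} (hT : 0 < T)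
    (hE : 0 < meanSq T g) (h : ∀ t ∈ Set.Icc (-T) T, ‖g t‖ ^ 2 ≤ R * meanSq T g) : 1 ≤ R := by
  have h1 := setIntegral_mono_on (integrableOn_norm_sq_of_le hg h) (integrableOn_const (by simp) :
    IntegrableOn (fun _ : ℝ => R * meanSq T g) (Set.Icc (-T) T)) measurableSet_Icc h
  rw [setIntegral_Icc_eq_meanSq hT, setIntegral_const] at h1
  simp only [Measure.real, Real.volume_Icc, smul_eq_mul] at h1
  rw [ENNReal.toReal_ofReal (by linarith)] at h1
  have h2 : 0 < 2 * T * meanSq T g := by positivity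
  by_contra hcon
  nlinarith

/-- Truncating a tame signal with a band-limited cut-off changes it little in mean square. -/
theorem cutoff_approximation {g : ℝ → ℂ} (hg : Measurable g) {H : ℝ → ℝ} (hH : Measurable H)
    {T S κ m R Q : ℝ} (hT : 0 < T) (hS : 0 ≤ S) (hκ : 0 < κ) (hm : 0 ≤ m)
    (hR : 0 ≤ R) (hQ : 0 ≤ Q) (hE : 0 < meanSq T g)
    (hin : ∀ t ∈ Set.Icc (-T) T, ‖g t‖ ^ 2 ≤ R * meanSq T g)
    (hout : ∀ t ∉ Set.Icc (-T) T, ‖g t‖ ^ 2 ≤ Q * meanSq T g * |t / T| ^ S)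
    (hH0 : ∀ t, 0 ≤ H t) (hH1 : ∀ t, H t ≤ 1) (hHin : ∀ t, |t| ≤ T * (1 - 2 * κ) → 1 - H t ≤ m)
    (hHout : ∀ t, T ≤ |t| → H t ≤ m * (|t| / T) ^ (-(S + 2))) :
    Integrable (fun t => g t * H t) ∧
    Integrable (fun t => ‖g t * H t - (Set.Icc (-T) T).indicator g t‖ ^ 2) ∧
    ∫ t, ‖g t * H t - (Set.Icc (-T) T).indicator g t‖ ^ 2 ≤
      (2 * m + 4 * κ * R + 4 * Q * m * ∫ x : ℝ, ((1 + |x|) ^ 2)⁻¹) * (T * meanSq T g) := by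
  set E := meanSq T g with hEdef
  have hI := integrable_one_add_abs_div_sq hT
  have hweight_in : ∀ t : ℝ, |t| ≤ T → 1 ≤ 4 * ((1 + |t| / T) ^ 2)⁻¹ := by
    intro t ht
    have h1 : |t| / T ≤ 1 := (div_le_one hT).2 ht
    have h0 : 0 ≤ |t| / T := by positivity
    rw [← div_eq_mul_inv, le_div_iff₀ (by positivity)]
    nlinarith
  -- Growth of order `S` against decay of order `S + 2` leaves an inverse square, comparable to an
  -- integrable weight of total mass proportional to `T`.
  have hweight_out : ∀ t : ℝ, T ≤ |t| →
      (|t| / T) ^ S * (|t| / T) ^ (-(S + 2)) ≤ 4 * ((1 + |t| / T) ^ 2)⁻¹ := by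
    intro t ht
    have h1 : 1 ≤ |t| / T := (one_le_div hT).2 ht
    rw [← Real.rpow_add (by linarith), show S + -(S + 2) = -((2 : ℕ) : ℝ) by push_cast; ring,
      Real.rpow_neg (by linarith), Real.rpow_natCast, ← div_eq_mul_inv,
      inv_le_comm₀ (by positivity) (by positivity), inv_div]
    rw [div_le_iff₀ (by norm_num)]
    nlinarith
  have hnot : ∀ t : ℝ, t ∉ Set.Icc (-T) T → T ≤ |t| := by
    intro t ht
    by_contra hcon
    exact ht (abs_le.1 (not_le.1 hcon).le)
  have hmeas : Measurable fun t => g t * H t := hg.mul (Complex.measurable_ofReal.comp hH)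
  have hmeas' : Measurable fun t => g t * H t - (Set.Icc (-T) T).indicator g t :=
    hmeas.sub (hg.indicator measurableSet_Icc)
  refine ⟨?_, ?_⟩
  · refine Integrable.mono' (hI.const_mul (4 * √(R * E) + 4 * m * √(Q * E)))
      hmeas.aestronglyMeasurable (Filter.Eventually.of_forall fun t => ?_)
    rw [norm_mul, Complex.norm_real, Real.norm_of_nonneg (hH0 t)]
    have hw0 : 0 ≤ ((1 + |t| / T) ^ 2)⁻¹ := by positivity
    by_cases ht : t ∈ Set.Icc (-T) T
    · have h1 : ‖g t‖ ≤ √(R * E) := Real.le_sqrt_of_sq_le (hin t ht)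
      have h2 := hweight_in t (abs_le.2 ht)
      calc ‖g t‖ * H t ≤ √(R * E) * 1 := mul_le_mul h1 (hH1 t) (hH0 t) (by positivity)
        _ ≤ √(R * E) * (4 * ((1 + |t| / T) ^ 2)⁻¹) := by gcongr
        _ ≤ (4 * √(R * E) + 4 * m * √(Q * E)) * ((1 + |t| / T) ^ 2)⁻¹ := by
            have : 0 ≤ 4 * m * √(Q * E) * ((1 + |t| / T) ^ 2)⁻¹ := by positivity
            linarith
    · have hT' := hnot t ht
      have h1 := hout t ht
      rw [abs_div, abs_of_pos hT] at h1
      have hone : 1 ≤ |t| / T := (one_le_div hT).2 hT'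
      have hp1 : 1 ≤ (|t| / T) ^ S := Real.one_le_rpow hone hS
      have h2 : ‖g t‖ ≤ √(Q * E) * (|t| / T) ^ S := by
        refine (Real.le_sqrt_of_sq_le h1).trans ?_
        rw [Real.sqrt_mul (by positivity)]
        gcongr
        rw [Real.sqrt_le_left (by linarith)]
        nlinarith
      calc ‖g t‖ * H t ≤ √(Q * E) * (|t| / T) ^ S * (m * (|t| / T) ^ (-(S + 2))) :=
            mul_le_mul h2 (hHout t hT') (hH0 t) (by positivity)
        _ = m * √(Q * E) * ((|t| / T) ^ S * (|t| / T) ^ (-(S + 2))) := by ring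
        _ ≤ m * √(Q * E) * (4 * ((1 + |t| / T) ^ 2)⁻¹) :=
                mul_le_mul_of_nonneg_left (hweight_out t hT') (by positivity)
        _ ≤ _ := by
            have : 0 ≤ 4 * √(R * E) * ((1 + |t| / T) ^ 2)⁻¹ := by positivity
            linarith
  -- Near `±T` the cut-off is only known to lie between `0` and `1`, so the pointwise bound `R E` is
  -- used there; the length `4κT` of this region yields the term `4κR`.
  · let strip : Set ℝ := Set.Icc (-T) (-(T * (1 - 2 * κ))) ∪ Set.Icc (T * (1 - 2 * κ)) T
    have hstripm : MeasurableSet strip := measurableSet_Icc.union measurableSet_Icc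
    have hstripv : volume strip ≤ ENNReal.ofReal (4 * κ * T) := by
      refine (measure_union_le _ _).trans ?_
      rw [Real.volume_Icc, Real.volume_Icc, ← ENNReal.ofReal_add (by nlinarith [mul_pos hκ hT])
        (by nlinarith [mul_pos hκ hT])]
      apply ENNReal.ofReal_le_ofReal
      linarith
    have hstripi : IntegrableOn (fun _ : ℝ => R * E) strip := by
      refine integrableOn_const (hs := ?_)
      exact ne_of_lt (hstripv.trans_lt ENNReal.ofReal_lt_top)
    have hG2 : Integrable fun t => ‖(Set.Icc (-T) T).indicator g t‖ ^ 2 := by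
      have := (integrable_indicator_iff measurableSet_Icc).2 (integrableOn_norm_sq_of_le hg hin)
      refine this.congr (Filter.Eventually.of_forall fun t => ?_)
      by_cases ht : t ∈ Set.Icc (-T) T <;> simp [ht]
    have hbI : Integrable fun t => m * ‖(Set.Icc (-T) T).indicator g t‖ ^ 2 +
        strip.indicator (fun _ => R * E) t + Q * E * m * 4 * ((1 + |t| / T) ^ 2)⁻¹ :=
      ((hG2.const_mul m).add ((integrable_indicator_iff hstripm).2 hstripi)).add (hI.const_mul _)
    have hb : ∀ t, ‖g t * H t - (Set.Icc (-T) T).indicator g t‖ ^ 2 ≤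
        m * ‖(Set.Icc (-T) T).indicator g t‖ ^ 2 +
        strip.indicator (fun _ => R * E) t + Q * E * m * 4 * ((1 + |t| / T) ^ 2)⁻¹ := by
      intro t
      have hw0 : 0 ≤ Q * E * m * 4 * ((1 + |t| / T) ^ 2)⁻¹ := by positivity
      have hs0 : 0 ≤ strip.indicator (fun _ => R * E) t :=
        Set.indicator_nonneg (fun _ _ => by positivity) t
      have hg0 : 0 ≤ m * ‖(Set.Icc (-T) T).indicator g t‖ ^ 2 := by positivity
      have h0 := hH0 t
      have h1 := hH1 t
      by_cases ht : t ∈ Set.Icc (-T) T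
      · have e : ‖g t * H t - (Set.Icc (-T) T).indicator g t‖ ^ 2 = ‖g t‖ ^ 2 * (1 - H t) ^ 2 := by
          rw [Set.indicator_of_mem ht]
          have : g t * H t - g t = g t * ((H t - 1 : ℝ) : ℂ) := by push_cast; ring
          rw [this, norm_mul, mul_pow, Complex.norm_real, Real.norm_eq_abs, sq_abs]; ring
        rw [e]
        by_cases hst : t ∈ strip
        · rw [Set.indicator_of_mem hst]
          have : ‖g t‖ ^ 2 * (1 - H t) ^ 2 ≤ ‖g t‖ ^ 2 * 1 := by
            gcongr
            nlinarith
          linarith [hin t ht]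
        · have hin' : |t| ≤ T * (1 - 2 * κ) := by
            by_contra hcon
            apply hst
            rcases le_or_gt 0 t with h | h
            · rw [abs_of_nonneg h] at hcon
              exact Or.inr ⟨(not_le.1 hcon).le, ht.2⟩
            · rw [abs_of_neg h] at hcon
              exact Or.inl ⟨ht.1, by linarith [not_le.1 hcon]⟩
          have h2 := hHin t hin'
          have : ‖g t‖ ^ 2 * (1 - H t) ^ 2 ≤ ‖g t‖ ^ 2 * m := by
            gcongr
            nlinarith
          rw [Set.indicator_of_mem ht] at hg0 ⊢
          linarith
      · have hT' := hnot t ht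
        rw [Set.indicator_of_notMem ht, sub_zero, norm_mul, mul_pow, Complex.norm_real,
          Real.norm_eq_abs, sq_abs]
        have h3 := hout t ht
        rw [abs_div, abs_of_pos hT] at h3
        have h4 := hHout t hT'
        have h5 : H t ^ 2 ≤ m * (|t| / T) ^ (-(S + 2)) := by nlinarith
        have : ‖g t‖ ^ 2 * H t ^ 2 ≤ Q * E * m * 4 * ((1 + |t| / T) ^ 2)⁻¹ := by
          calc _ ≤ Q * E * (|t| / T) ^ S * (m * (|t| / T) ^ (-(S + 2))) := by gcongr
            _ = Q * E * m * ((|t| / T) ^ S * (|t| / T) ^ (-(S + 2))) := by ring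
            _ ≤ Q * E * m * (4 * ((1 + |t| / T) ^ 2)⁻¹) :=
                mul_le_mul_of_nonneg_left (hweight_out t hT') (by positivity)
            _ = _ := by ring
        rw [Set.indicator_of_notMem ht] at hg0
        linarith
    refine ⟨Integrable.mono' hbI (hmeas'.norm.pow_const 2).aestronglyMeasurable
      (Filter.Eventually.of_forall fun t => ?_), ?_⟩
    · rw [Real.norm_of_nonneg (by positivity)]; exact hb t
    · refine (integral_mono_of_nonneg (Filter.Eventually.of_forall fun t => by positivity) hbI
        (Filter.Eventually.of_forall hb)).trans ?_
      have i1 : Integrable fun t => m * ‖(Set.Icc (-T) T).indicator g t‖ ^ 2 := hG2.const_mul m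
      have i2 : Integrable fun t => strip.indicator (fun _ => R * E) t :=
        (integrable_indicator_iff hstripm).2 hstripi
      have i3 : Integrable fun t : ℝ => Q * E * m * 4 * ((1 + |t| / T) ^ 2)⁻¹ := hI.const_mul _
      have i12 : Integrable fun t => m * ‖(Set.Icc (-T) T).indicator g t‖ ^ 2 +
          strip.indicator (fun _ => R * E) t := i1.add i2
      rw [integral_add i12 i3, integral_add i1 i2, integral_const_mul,
        integral_norm_sq_indicator hT, integral_indicator hstripm, setIntegral_const,
        integral_const_mul, integral_one_add_abs_div_sq hT, ← hEdef, smul_eq_mul]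
      have hv : volume.real strip ≤ 4 * κ * T :=
        ENNReal.toReal_le_of_le_ofReal (by positivity) hstripv
      have : volume.real strip * (R * E) ≤ 4 * κ * T * (R * E) := by gcongr
      linarith

end Correlation

section Correlation

open scoped ComplexConjugate

theorem Polynomial.exists_eval_le_mul_pow (p : Polynomial ℝ) :
    ∃ (Cp : ℝ) (d : ℕ), 1 ≤ Cp ∧ ∀ x : ℝ, 1 ≤ x → p.eval x ≤ Cp * x ^ d := by
  refine ⟨1 + ∑ i ∈ Finset.range (p.natDegree + 1), |p.coeff i|, p.natDegree, ?_, fun x hx => ?_⟩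
  · have : 0 ≤ ∑ i ∈ Finset.range (p.natDegree + 1), |p.coeff i| :=
      Finset.sum_nonneg fun i _ => abs_nonneg _
    linarith
  · rw [Polynomial.eval_eq_sum_range, add_mul, Finset.sum_mul]
    have h1 : ∑ i ∈ Finset.range (p.natDegree + 1), p.coeff i * x ^ i ≤
        ∑ i ∈ Finset.range (p.natDegree + 1), |p.coeff i| * x ^ p.natDegree := by
      refine Finset.sum_le_sum fun i hi => ?_
      have hi' : i ≤ p.natDegree := Nat.lt_succ_iff.1 (Finset.mem_range.1 hi)
      calc p.coeff i * x ^ i ≤ |p.coeff i| * x ^ i := by gcongr; exact le_abs_self _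
        _ ≤ _ := by gcongr
    have : 0 ≤ 1 * x ^ p.natDegree := by positivity
    linarith

theorem exists_large_mul_sq_mul_exp_le {a M γ : ℝ} (ha : 0 < a) (hγ : 0 < γ) (x : ℝ) :
    ∃ K : ℝ, x ≤ K ∧ M * (K ^ 2 * Real.exp (-(a * K))) ≤ γ := by
  have h := Real.tendsto_pow_mul_exp_neg_atTop_nhds_zero 2
  have h2 : Filter.Tendsto (fun K : ℝ => a * K) Filter.atTop Filter.atTop :=
    Filter.tendsto_id.const_mul_atTop ha
  have h3 := (h.comp h2).const_mul (M / a ^ 2)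
  rw [mul_zero] at h3
  have h4 := h3.eventually (ge_mem_nhds hγ)
  obtain ⟨K, hK1, hK2⟩ := (h4.and (Filter.eventually_ge_atTop x)).exists
  refine ⟨K, hK2, le_trans (le_of_eq ?_) hK1⟩
  simp only [Function.comp]
  field_simp

theorem sum_range_inv_le_one_add_log (k : ℕ) :
    ∑ j ∈ Finset.range k, ((j : ℝ) + 1)⁻¹ ≤ 1 + Real.log k := by
  have := harmonic_le_one_add_log k
  simpa [harmonic] using this

/-- The choice of the number of factors of the cut-off. -/
theorem exists_factor_count {C c₁ Cp s : ℝ} (d : ℕ) (hC : 1 ≤ C) (hc₁ : 0 ≤ c₁) (hCp : 1 ≤ Cp)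
    (hs : 0 < s) :
    ∃ A : ℕ, 0 < A ∧ ∀ R S : ℝ, 1 ≤ R → 0 < S → ∃ k : ℕ, S + 4 ≤ k ∧
      C * k ^ 2 * Real.exp (-(k * (s ^ 2 / (4 * R)) / 4)) * (2 + 4 * (Cp * R ^ d) * c₁) ≤ s ^ 2 ∧
      C * k * ∑ j ∈ Finset.range k, ((j : ℝ) + 1)⁻¹ ≤ A * (R + S) * Real.log (2 + R + S) ^ 2 := by
  obtain ⟨K, hKx, hK⟩ := exists_large_mul_sq_mul_exp_le (a := s ^ 2 / 16)
    (M := 4 * C * Cp * (2 + 4 * c₁) * Real.exp (d + 4)) (γ := s ^ 2) (by positivity) (by positivity)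
    (max 4 (16 * (d + 4) / s ^ 2))
  have hK4 : 4 ≤ K := (le_max_left _ _).trans hKx
  have hKd : (d : ℝ) + 4 ≤ s ^ 2 / 16 * K := by
    have := (le_max_right _ _).trans hKx
    rw [div_le_iff₀ (by positivity)] at this
    linarith
  refine ⟨⌈C * (2 * K * (2 * K + 3))⌉₊, Nat.ceil_pos.2 (by positivity), fun R S hR hS => ?_⟩
  set X := 2 + R + S with hX
  have hX3 : 3 ≤ X := by linarith
  set l := Real.log X with hl
  have hl1 : 1 ≤ l := by
    rw [hl, Real.le_log_iff_exp_le (by linarith)]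
    linarith [Real.exp_one_lt_d9]
  have hlX : l ≤ X := (Real.log_le_sub_one_of_pos (by linarith)).trans (by linarith)
  -- With `κ = s²/(4R)` and `k ≥ K R l`, the exponential is at most `X^(-K s²/16)`. It has to beat
  -- `X^4` from `k²` and `X^d` from the polynomial, hence the condition `d + 4 ≤ s² K / 16` on `K`.
  set x := K * (R + S) * l with hx
  have hRS : 1 ≤ R + S := by linarith
  have hRSX : R + S ≤ X := by linarith
  have hxK : K * (R + S) ≤ x := by
    rw [hx]; exact le_mul_of_one_le_right (by positivity) hl1
  have hx1 : 1 ≤ x := by nlinarith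
  set k := ⌈x⌉₊ with hk
  have hkx : x ≤ k := Nat.le_ceil x
  have hk2x : (k : ℝ) ≤ 2 * x := by
    have := Nat.ceil_lt_add_one (by linarith : 0 ≤ x)
    linarith
  have hkX : (k : ℝ) ≤ 2 * K * X ^ 2 := by
    calc (k : ℝ) ≤ 2 * (K * (R + S) * l) := hk2x
      _ ≤ 2 * (K * X * X) := by gcongr
      _ = _ := by ring
  have hk0 : (0 : ℝ) < k := by linarith
  refine ⟨k, by nlinarith, ?_, ?_⟩
  · have hexp : Real.exp (-(k * (s ^ 2 / (4 * R)) / 4)) ≤ Real.exp (-(s ^ 2 / 16 * K * l)) := by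
      apply Real.exp_le_exp.2
      rw [neg_le_neg_iff]
      have h1 : K * R * l ≤ k := by
        refine le_trans ?_ hkx
        rw [hx]; gcongr; linarith
      calc s ^ 2 / 16 * K * l = K * R * l * (s ^ 2 / (4 * R)) / 4 := by field_simp; ring
        _ ≤ _ := by gcongr
    have hQ : 2 + 4 * (Cp * R ^ d) * c₁ ≤ Cp * X ^ d * (2 + 4 * c₁) := by
      have h1 : 1 ≤ X ^ d := one_le_pow₀ (by linarith)
      have h2 : R ^ d ≤ X ^ d := by gcongr; linarith
      have h3 : 1 ≤ Cp * X ^ d := one_le_mul_of_one_le_of_one_le hCp h1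
      have h4 : Cp * R ^ d ≤ Cp * X ^ d := by gcongr
      nlinarith [mul_le_mul_of_nonneg_right h4 hc₁]
    have hXl : ∀ n : ℕ, X ^ n = Real.exp (n * l) := by
      intro n; rw [Real.exp_nat_mul, hl, Real.exp_log (by linarith)]
    calc _ ≤ C * (2 * K * X ^ 2) ^ 2 * Real.exp (-(s ^ 2 / 16 * K * l)) *
          (Cp * X ^ d * (2 + 4 * c₁)) := by gcongr
      _ = 4 * C * Cp * (2 + 4 * c₁) * K ^ 2 * (X ^ (d + 4) * Real.exp (-(s ^ 2 / 16 * K * l))) := by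
          rw [pow_add]; ring
      _ ≤ 4 * C * Cp * (2 + 4 * c₁) * K ^ 2 * Real.exp ((d + 4) + -(s ^ 2 / 16 * K)) := by
          gcongr
          -- The coefficient `d + 4 - s² K / 16` of `l` is nonpositive and `l ≥ 1`, so `l` may be
          -- replaced by `1`, which removes `R` and `S`.
          rw [hXl, ← Real.exp_add]
          apply Real.exp_le_exp.2
          push_cast
          nlinarith
      _ = 4 * C * Cp * (2 + 4 * c₁) * Real.exp (d + 4) *
            (K ^ 2 * Real.exp (-(s ^ 2 / 16 * K))) := by rw [Real.exp_add]; ring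
      _ ≤ s ^ 2 := hK
  · have hlog : 1 + Real.log k ≤ (2 * K + 3) * l := by
      have h1 : Real.log k ≤ Real.log (2 * K * X ^ 2) := Real.log_le_log hk0 hkX
      rw [Real.log_mul (by positivity) (by positivity), Real.log_pow] at h1
      have h2 : Real.log (2 * K) ≤ 2 * K - 1 := Real.log_le_sub_one_of_pos (by positivity)
      push_cast at h1
      nlinarith
    have hlk : 0 ≤ 1 + Real.log k := by
      have := Real.log_natCast_nonneg k
      linarith
    calc _ ≤ C * (2 * x) * ((2 * K + 3) * l) := by
          gcongr
          exact (sum_range_inv_le_one_add_log k).trans hlog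
      _ = C * (2 * K * (2 * K + 3)) * (R + S) * l ^ 2 := by rw [hx]; ring
      _ ≤ _ := by
          gcongr
          exact Nat.le_ceil _

/-- For a tame signal with clustered spectrum, the truncated autocorrelation at a small lag `β` has
the phase `2π f₀ β` and nearly full size. -/
theorem truncated_autocorrelation_bound {s : ℝ} (hs : 0 < s) (hs1 : s ≤ 1) (p : Polynomial ℝ) :
    ∃ A : ℕ, 0 < A ∧ ∀ T Δ R S f₀ : ℝ, ∀ g : ℝ → ℂ, 0 < T → 0 < Δ → 0 < S → Measurable g →
      0 < meanSq T g → FourierSupportIn g (Set.Icc (f₀ - Δ) (f₀ + Δ)) →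
      (∀ t ∈ Set.Icc (-T) T, ‖g t‖ ^ 2 ≤ R * meanSq T g) →
      (∀ t ∉ Set.Icc (-T) T, ‖g t‖ ^ 2 ≤ p.eval R * meanSq T g * |t / T| ^ S) →
      ∀ β : ℝ,
        ‖(∫ t, (Set.Icc (-T) T).indicator g (t + β) * conj ((Set.Icc (-T) T).indicator g t)) -
          Complex.exp (2 * Real.pi * f₀ * β * Complex.I) * (2 * T * meanSq T g : ℝ)‖ ≤
        (6 * s + 8 * Real.pi * |β| * widenedBand A 2 T Δ R S) * (2 * T * meanSq T g) := by
  obtain ⟨C, hC, hcut⟩ := exists_bandlimited_cutoff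
  obtain ⟨Cp, d, hCp, hp⟩ := p.exists_eval_le_mul_pow
  set c₁ := ∫ x : ℝ, ((1 + |x|) ^ 2)⁻¹ with hc₁
  have hc₁0 : 0 ≤ c₁ := integral_nonneg fun x => by positivity
  obtain ⟨A, hA, hk⟩ := exists_factor_count d hC hc₁0 hCp hs
  refine ⟨A, hA, fun T Δ R S f₀ g hT hΔ hS hg hE hsupp hin hout β => ?_⟩
  have hR : 1 ≤ R := one_le_of_norm_sq_le_mul_meanSq hg hT hE hin
  obtain ⟨k, hkS, hkm, hkB⟩ := hk R S hR hS
  -- In units of `T E` the squared truncation error may be `2s²`: the strips take `4κR = s²`, and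
  -- the choice of `k` keeps the remaining terms within the other `s²`.
  set κ := s ^ 2 / (4 * R) with hκ
  have hκ0 : 0 < κ := by positivity
  have hκ1 : κ ≤ 1 := by
    rw [hκ, div_le_one (by positivity)]
    nlinarith
  obtain ⟨χ, H, hχs, hχF, hH0, hH1, hHin, hHout⟩ := hcut T S κ k hT hS.le hκ0 hκ1 hkS
  set B := C * k / T * ∑ j ∈ Finset.range k, ((j : ℝ) + 1)⁻¹ with hB
  set m := C * k ^ 2 * Real.exp (-(k * κ / 4)) with hm
  set E := meanSq T g with hEdef
  have hm0 : 0 ≤ m := by positivity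
  have hout' : ∀ t ∉ Set.Icc (-T) T, ‖g t‖ ^ 2 ≤ (Cp * R ^ d) * E * |t / T| ^ S := by
    intro t ht
    refine (hout t ht).trans ?_
    gcongr
    exact hp R hR
  have hHm : Measurable H := by
    have : H = fun t => (𝓕 χ t).re := by ext t; rw [hχF]; simp
    rw [this]
    exact (Complex.continuous_re.comp (𝓕 χ).continuous).measurable
  obtain ⟨hi, hd2, hdle⟩ := cutoff_approximation hg hHm hT hS.le hκ0 hm0 (by linarith)
    (by positivity) hE hin hout' hH0 hH1 hHin hHout
  set G := (Set.Icc (-T) T).indicator g with hG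
  set dd : ℝ → ℂ := fun t => g t * H t - G t with hdd
  have hGm : Measurable G := hg.indicator measurableSet_Icc
  have hddm : Measurable dd := (hg.mul (Complex.measurable_ofReal.comp hHm)).sub hGm
  have hG2 : Integrable fun t => ‖G t‖ ^ 2 := by
    have := (integrable_indicator_iff measurableSet_Icc).2 (integrableOn_norm_sq_of_le hg hin)
    refine this.congr (Filter.Eventually.of_forall fun t => ?_)
    by_cases ht : t ∈ Set.Icc (-T) T <;> simp [G, ht]
  have hGN : ∫ t, ‖G t‖ ^ 2 = 2 * T * E := integral_norm_sq_indicator hT g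
  have hddN : ∫ t, ‖dd t‖ ^ 2 ≤ s ^ 2 * (2 * T * E) := by
    refine hdle.trans ?_
    have h1 : 4 * κ * R = s ^ 2 := by rw [hκ]; field_simp
    have h2 : 2 * m + 4 * κ * R + 4 * (Cp * R ^ d) * m * c₁ ≤ s ^ 2 * 2 := by
      rw [h1]; linarith
    calc _ ≤ s ^ 2 * 2 * (T * E) := by gcongr
      _ = _ := by ring
  have hsum : ∀ t, G t + dd t = g t * H t := fun t => by simp [hdd]
  have hβ := norm_autocorrelation_perturb_le hGm hddm hG2 hd2 hs hs1 hGN.le hddN β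
  -- Lag zero compares the energies `Nh` and `N` of the smooth and the sharp truncation. Together
  -- with lag `β` this accounts for `6s = 3s + 3s`, and `Nh ≤ 4N` for the factor `8π`.
  have h0 := norm_autocorrelation_perturb_le hGm hddm hG2 hd2 hs hs1 hGN.le hddN 0
  simp only [hsum, add_zero] at hβ h0
  have e1 : ∀ z : ℂ, z * conj z = ((‖z‖ ^ 2 : ℝ) : ℂ) := fun z => by
    rw [Complex.mul_conj, Complex.normSq_eq_norm_sq]
  simp only [e1] at h0
  rw [integral_complex_ofReal, integral_complex_ofReal, ← Complex.ofReal_sub, Complex.norm_real,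
    Real.norm_eq_abs, hGN] at h0
  have hW : ∀ ξ, ξ ∉ Set.Icc (f₀ - (Δ + B)) (f₀ + (Δ + B)) → 𝓕 (fun t => g t * H t) ξ = 0 := by
    intro ξ hξ
    have := fourier_mul_eq_zero_of_fourierSupportIn hsupp χ hχs hξ
    simpa only [hχF] using this
  have hauto := norm_autocorrelation_sub_le hi hW β
  set N := 2 * T * E with hN
  have hN0 : 0 < N := by positivity
  set Nh := ∫ t, ‖g t * H t‖ ^ 2 with hNh
  have hNh4 : Nh ≤ 4 * N := by
    have := (abs_le.1 h0).2
    nlinarith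
  have hNh0 : 0 ≤ Nh := integral_nonneg fun t => by positivity
  have hWD : Δ + B ≤ widenedBand A 2 T Δ R S := by
    rw [widenedBand]
    have : B = C * k * (∑ j ∈ Finset.range k, ((j : ℝ) + 1)⁻¹) / T := by rw [hB]; ring
    rw [this]
    gcongr
  set e : ℂ := Complex.exp (2 * Real.pi * f₀ * β * Complex.I) with he
  have hen : ‖e‖ = 1 := by
    have := Complex.norm_exp_ofReal_mul_I (2 * Real.pi * f₀ * β)
    push_cast at this
    exact this
  set rG := ∫ t, G (t + β) * conj (G t)
  set rh := ∫ t, g (t + β) * H (t + β) * conj (g t * H t)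
  have hdecomp : rG - e * (N : ℂ) = -(rh - rG) + (rh - e * (Nh : ℂ)) + e * ((Nh - N : ℝ) : ℂ) := by
    push_cast; ring
  rw [hdecomp]
  refine norm_add₃_le.trans ?_
  rw [norm_neg, norm_mul, hen, one_mul, Complex.norm_real, Real.norm_eq_abs]
  have hB0 : 0 ≤ Δ + B := by positivity
  have hD0 : 0 ≤ widenedBand A 2 T Δ R S := hB0.trans hWD
  have h5 : 2 * Real.pi * |β| * (Δ + B) * Nh ≤
      8 * Real.pi * |β| * widenedBand A 2 T Δ R S * N := by
    calc _ ≤ 2 * Real.pi * |β| * (widenedBand A 2 T Δ R S) * (4 * N) := by gcongr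
      _ = _ := by ring
  linarith

end Correlation

/-! ### Coin sequences and random sampling times. -/

section Coins

open ProbabilityTheory
open scoped ComplexConjugate

namespace RealRAM

instance : IsProbabilityMeasure coinLaw := by unfold coinLaw; infer_instance

/-- Use the first `N` coins of one sequence, followed by another sequence. -/
def glueCoins (N : ℕ) (q : (ℕ → unitInterval) × (ℕ → unitInterval)) : ℕ → unitInterval :=
  fun i => if i < N then q.1 i else q.2 (i - N)

theorem glueCoins_lt {N i : ℕ} (h : i < N) (q : (ℕ → unitInterval) × (ℕ → unitInterval)) :
    glueCoins N q i = q.1 i := if_pos h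

theorem glueCoins_add (N i : ℕ) (q : (ℕ → unitInterval) × (ℕ → unitInterval)) :
    glueCoins N q (N + i) = q.2 i := by
  simp [glueCoins]

theorem measurable_glueCoins (N : ℕ) : Measurable (glueCoins N) := by
  refine measurable_pi_lambda _ fun i => ?_
  unfold glueCoins
  split_ifs <;> fun_prop

/-- Independence of past and future in the form used later: with the first `N` coins fixed, the rest
is again a fresh sequence with the same law. -/
theorem measurePreserving_glueCoins (N : ℕ) :
    MeasurePreserving (glueCoins N) (coinLaw.prod coinLaw) coinLaw := by
  refine ⟨measurable_glueCoins N, ?_⟩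
  unfold coinLaw
  refine Measure.eq_infinitePi _ fun s t ht => ?_
  rw [Measure.map_apply (measurable_glueCoins N) (MeasurableSet.pi s.countable_toSet fun i _ => ht i)]
  set s₁ := s.filter (· < N)
  set s₂ := (s.filter (fun i => ¬ i < N)).image (· - N)
  have hpre : glueCoins N ⁻¹' (Set.pi s t) =
      (Set.pi s₁ t) ×ˢ (Set.pi s₂ fun i => t (N + i)) := by
    ext q
    simp only [Set.mem_preimage, Set.mem_pi, Finset.mem_coe, Set.mem_prod]
    constructor
    · intro h
      refine ⟨fun i hi => ?_, fun i hi => ?_⟩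
      · obtain ⟨his, hiN⟩ := Finset.mem_filter.1 hi
        simpa [glueCoins, hiN] using h i his
      · obtain ⟨j, hj, rfl⟩ := Finset.mem_image.1 hi
        obtain ⟨hjs, hjN⟩ := Finset.mem_filter.1 hj
        have := h j hjs
        rw [Nat.add_sub_cancel' (not_lt.1 hjN)]
        simpa [glueCoins, hjN] using this
    · rintro ⟨h1, h2⟩ i hi
      by_cases hiN : i < N
      · simpa [glueCoins, hiN] using h1 i (Finset.mem_filter.2 ⟨hi, hiN⟩)
      · have := h2 (i - N) (Finset.mem_image.2 ⟨i, Finset.mem_filter.2 ⟨hi, hiN⟩, rfl⟩)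
        rw [Nat.add_sub_cancel' (not_lt.1 hiN)] at this
        simpa [glueCoins, hiN] using this
  rw [hpre, Measure.prod_prod, Measure.infinitePi_pi _ fun i _ => ht i,
    Measure.infinitePi_pi _ fun i _ => ht (N + i),
    Finset.prod_image (by
      intro i hi j hj hij
      have hi' := (Finset.mem_filter.1 hi).2
      have hj' := (Finset.mem_filter.1 hj).2
      simp only at hij
      omega),
    ← Finset.prod_filter_mul_prod_filter_not s (· < N)]
  congr 1
  refine Finset.prod_congr rfl fun i hi => ?_
  rw [Nat.add_sub_cancel' (not_lt.1 (Finset.mem_filter.1 hi).2)]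

theorem lintegral_coinLaw_eq_glue (N : ℕ) {f : (ℕ → unitInterval) → ENNReal} (hf : Measurable f) :
    ∫⁻ ω, f ω ∂coinLaw = ∫⁻ ω, ∫⁻ ω', f (glueCoins N (ω, ω')) ∂coinLaw ∂coinLaw := by
  rw [← (measurePreserving_glueCoins N).lintegral_comp hf,
    lintegral_prod (fun q => f (glueCoins N q)) (hf.comp (measurable_glueCoins N)).aemeasurable]

/-- The sampling time chosen by a coin. -/
noncomputable def sampleTime (T : ℝ) (u : unitInterval) : ℝ := T * (2 * (u : ℝ) - 1)

theorem measurable_sampleTime (T : ℝ) : Measurable (sampleTime T) := by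
  unfold sampleTime; fun_prop

theorem map_sampleTime {T : ℝ} (hT : 0 < T) :
    Measure.map (sampleTime T) (volume : Measure unitInterval) =
      ENNReal.ofReal (2 * T)⁻¹ • volume.restrict (Set.Icc (-T) T) := by
  let f : ℝ → ℝ := fun x => T * (2 * x - 1)
  have hf : Measurable f := by fun_prop
  have h1 : Measure.map ((↑) : unitInterval → ℝ) volume = volume.restrict (Set.Icc (0 : ℝ) 1) := by
    exact map_comap_subtype_coe measurableSet_Icc volume
  have h2 : sampleTime T = f ∘ ((↑) : unitInterval → ℝ) := rfl
  have h3 : Measure.map f volume = ENNReal.ofReal (2 * T)⁻¹ • volume := by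
    have e : f = (fun x => x - T) ∘ (fun x => 2 * T * x) := by
      ext x; simp only [f, Function.comp]; ring
    rw [e, ← Measure.map_map (by fun_prop) (by fun_prop),
      Real.map_volume_mul_left (by positivity), Measure.map_smul, map_sub_right_eq_self,
      abs_of_pos (by positivity)]
  rw [h2, ← Measure.map_map hf measurable_subtype_coe, h1, ← Measure.restrict_smul, ← h3,
    Measure.restrict_map hf measurableSet_Icc]
  congr 2
  ext x
  simp only [f, Set.mem_preimage, Set.mem_Icc]
  constructor
  · rintro ⟨a, b⟩; constructor <;> nlinarith
  · rintro ⟨a, b⟩; constructor <;> nlinarith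

theorem map_eval_coinLaw (i : ℕ) :
    Measure.map (fun ω : ℕ → unitInterval => ω i) coinLaw = volume :=
  Measure.infinitePi_map_eval _ i

theorem map_sampleTime_eval {T : ℝ} (hT : 0 < T) (i : ℕ) :
    Measure.map (fun ω : ℕ → unitInterval => sampleTime T (ω i)) coinLaw =
      ENNReal.ofReal (2 * T)⁻¹ • volume.restrict (Set.Icc (-T) T) := by
  rw [← map_sampleTime hT, ← map_eval_coinLaw i, Measure.map_map (measurable_sampleTime T) (by fun_prop)]
  rfl

theorem integral_sampleTime {T : ℝ} (hT : 0 < T) (i : ℕ) {E : Type*} [NormedAddCommGroup E]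
    [NormedSpace ℝ E] {f : ℝ → E} (hf : StronglyMeasurable f) :
    ∫ ω, f (sampleTime T (ω i)) ∂coinLaw = (2 * T)⁻¹ • ∫ t in Set.Icc (-T) T, f t := by
  have hm : Measurable fun ω : ℕ → unitInterval => sampleTime T (ω i) :=
    (measurable_sampleTime T).comp (measurable_pi_apply i)
  rw [← integral_map hm.aemeasurable hf.aestronglyMeasurable, map_sampleTime_eval hT,
    integral_smul_measure, ENNReal.toReal_ofReal (by positivity)]

theorem integrable_sampleTime {T : ℝ} (hT : 0 < T) (i : ℕ) {E : Type*} [NormedAddCommGroup E]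
    {f : ℝ → E} (hfi : IntegrableOn f (Set.Icc (-T) T)) :
    Integrable (fun ω : ℕ → unitInterval => f (sampleTime T (ω i))) coinLaw := by
  have hm : Measurable fun ω : ℕ → unitInterval => sampleTime T (ω i) :=
    (measurable_sampleTime T).comp (measurable_pi_apply i)
  have h : Integrable f (Measure.map (fun ω : ℕ → unitInterval => sampleTime T (ω i)) coinLaw) := by
    rw [map_sampleTime_eval hT]
    exact hfi.smul_measure ENNReal.ofReal_ne_top
  exact h.comp_measurable hm

/-- Chebyshev's inequality for the empirical mean of a bounded function of the sampling times. -/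
theorem chebyshev_sampleTime {T : ℝ} (hT : 0 < T) {f : ℝ → ℝ} (hf : Measurable f) {M V c : ℝ}
    (hM : ∀ t, |f t| ≤ M) (hV : (2 * T)⁻¹ * ∫ t in Set.Icc (-T) T, f t ^ 2 ≤ V) (hc : 0 < c)
    (n : ℕ) :
    coinLaw {ω | c ≤ |∑ i ∈ Finset.range n, f (sampleTime T (ω i)) -
        n * ((2 * T)⁻¹ * ∫ t in Set.Icc (-T) T, f t)|} ≤ ENNReal.ofReal (n * V / c ^ 2) := by
  let X : ℕ → (ℕ → unitInterval) → ℝ := fun i ω => f (sampleTime T (ω i))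
  have hXm : ∀ i, Measurable (X i) := fun i =>
    hf.comp ((measurable_sampleTime T).comp (measurable_pi_apply i))
  have hXL : ∀ i, MemLp (X i) 2 coinLaw := fun i =>
    MemLp.of_bound (hXm i).aestronglyMeasurable M (Filter.Eventually.of_forall fun ω => hM _)
  have hindep : iIndepFun X coinLaw :=
    iIndepFun_infinitePi (X := fun _ u => f (sampleTime T u))
      fun i => hf.comp (measurable_sampleTime T)
  have hvar : variance (∑ i ∈ Finset.range n, X i) coinLaw ≤ n * V := by
    rw [IndepFun.variance_sum (fun i _ => hXL i) fun i _ j _ hij => hindep.indepFun hij]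
    calc _ ≤ ∑ _i ∈ Finset.range n, V := by
          refine Finset.sum_le_sum fun i _ => ?_
          refine (variance_le_expectation_sq (hXm i).aestronglyMeasurable).trans ?_
          refine le_trans (le_of_eq ?_) hV
          exact integral_sampleTime hT i (hf.pow_const 2).stronglyMeasurable
      _ = _ := by simp
  have hmean : coinLaw[∑ i ∈ Finset.range n, X i] = n * ((2 * T)⁻¹ * ∫ t in Set.Icc (-T) T, f t) := by
    simp only [Finset.sum_apply]
    rw [integral_finsetSum _ fun i _ => (hXL i).integrable (by norm_num)]
    have : ∀ i, ∫ ω, X i ω ∂coinLaw = (2 * T)⁻¹ * ∫ t in Set.Icc (-T) T, f t := fun i =>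
      integral_sampleTime hT i hf.stronglyMeasurable
    simp [this]
  have h := meas_ge_le_variance_div_sq (μ := coinLaw)
    (memLp_finsetSum' (Finset.range n) fun i _ => hXL i) hc
  rw [hmean] at h
  simp only [Finset.sum_apply] at h
  refine h.trans (ENNReal.ofReal_le_ofReal ?_)
  gcongr

/-- Markov's inequality for a sum of a nonnegative function of the sampling times. -/
theorem markov_sampleTime {T : ℝ} (hT : 0 < T) {f : ℝ → ℝ} (hf : Measurable f) (hf0 : ∀ t, 0 ≤ f t)
    (hfi : IntegrableOn f (Set.Icc (-T) T)) {V c : ℝ}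
    (hV : (2 * T)⁻¹ * ∫ t in Set.Icc (-T) T, f t ≤ V) (hc : 0 < c) (n : ℕ) :
    coinLaw {ω | c ≤ ∑ i ∈ Finset.range n, f (sampleTime T (ω i))} ≤ ENNReal.ofReal (n * V / c) := by
  have hint : ∀ i, Integrable (fun ω : ℕ → unitInterval => f (sampleTime T (ω i))) coinLaw :=
    fun i => integrable_sampleTime hT i hfi
  have h := mul_meas_ge_le_integral_of_nonneg (μ := coinLaw)
    (f := fun ω => ∑ i ∈ Finset.range n, f (sampleTime T (ω i)))
    (Filter.Eventually.of_forall fun ω => Finset.sum_nonneg fun i _ => hf0 _)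
    (integrable_finsetSum _ fun i _ => hint i) c
  rw [integral_finsetSum _ fun i _ => hint i] at h
  have h2 : ∑ i ∈ Finset.range n, ∫ ω, f (sampleTime T (ω i)) ∂coinLaw ≤ n * V := by
    calc _ ≤ ∑ _i ∈ Finset.range n, V := Finset.sum_le_sum fun i _ =>
          (le_of_eq (integral_sampleTime hT i hf.stronglyMeasurable)).trans hV
      _ = _ := by simp
  rw [← ofReal_measureReal (measure_ne_top _ _)]
  apply ENNReal.ofReal_le_ofReal
  rw [le_div_iff₀ hc]
  linarith

end RealRAM

end Coins

/-! ### The empirical correlation and the random lag. -/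

section Batch

open ProbabilityTheory
open scoped ComplexConjugate

namespace RealRAM

/-- The sum of lagged products of `Y` over `n` random sampling times. -/
noncomputable def lagSum (Y : ℝ → ℂ) (T β : ℝ) (n : ℕ) (ω : ℕ → unitInterval) : ℂ :=
  ∑ i ∈ Finset.range n, Y (sampleTime T (ω i) + β) * conj (Y (sampleTime T (ω i)))

/-- As `|G|² ≤ R E`, the products of `G` have second moment at most `R E²`, and Chebyshev applies to
their real and imaginary parts. The terms containing `d` have no variance bound, only a small `L¹`
norm, hence Markov. The deviation is shared out as `ζ/8 + ζ/8` for Chebyshev, `ζ/4` for Markov and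
`ζ/4` for the bias, less than `ζ` in total. -/
theorem measure_lagSum_deviation_le {G d : ℝ → ℂ} (hG : Measurable G) (hd : Measurable d)
    {T E R s ζ β : ℝ} {e : ℂ} {n : ℕ} (hT : 0 < T) (hE : 0 < E) (hR : 0 ≤ R) (hs : 0 < s)
    (hs1 : s ≤ 1) (hζ : 0 < ζ) (hn : 0 < n)
    (hG0 : ∀ t ∉ Set.Icc (-T) T, G t = 0) (hGR : ∀ t, ‖G t‖ ^ 2 ≤ R * E)
    (hG2 : Integrable fun t => ‖G t‖ ^ 2) (hGE : ∫ t, ‖G t‖ ^ 2 = 2 * T * E)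
    (hd2 : Integrable fun t => ‖d t‖ ^ 2) (hdE : ∫ t, ‖d t‖ ^ 2 ≤ s ^ 2 * (2 * T * E))
    (he : ‖(∫ t, G (t + β) * conj (G t)) - e * (2 * T * E : ℝ)‖ ≤ ζ / 4 * (2 * T * E)) :
    coinLaw {ω | ζ * (n * E) ≤ ‖lagSum (G + d) T β n ω - e * (n * E : ℝ)‖} ≤
      ENNReal.ofReal (128 * R / (ζ ^ 2 * n) + 12 * s / ζ) := by
  have hn' : (0 : ℝ) < n := by exact_mod_cast hn
  obtain ⟨i1, isum, hrest⟩ := integral_norm_lagProduct_sub_le hG hd hG2 hd2 hs hs1 hGE.le hdE β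
  let q : ℝ → ℂ := fun t => G (t + β) * conj (G t)
  have hGs : Measurable fun t => G (t + β) := hG.comp (measurable_add_const β)
  have hds : Measurable fun t => d (t + β) := hd.comp (measurable_add_const β)
  have hqm : Measurable q := hGs.mul (Complex.continuous_conj.measurable.comp hG)
  have hq2 : ∀ t, ‖q t‖ ^ 2 ≤ R * E * ‖G t‖ ^ 2 := by
    intro t
    simp only [q, norm_mul, RCLike.norm_conj, mul_pow]
    gcongr
    exact hGR _
  have hqM : ∀ t, ‖q t‖ ≤ R * E := by
    intro t
    refine le_of_sq_le_sq ?_ (by positivity)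
    refine (hq2 t).trans ?_
    rw [pow_two (R * E)]
    gcongr
    exact hGR t
  set M : ℂ := ((2 * T)⁻¹ : ℝ) • ∫ t in Set.Icc (-T) T, q t with hM
  have hqset : ∫ t in Set.Icc (-T) T, q t = ∫ t, q t :=
    setIntegral_eq_integral_of_forall_compl_eq_zero fun t ht => by simp [q, hG0 t ht]
  have hMe : ‖M - e * (E : ℝ)‖ ≤ ζ / 4 * E := by
    have h1 : M - e * (E : ℝ) = ((2 * T)⁻¹ : ℝ) • ((∫ t, q t) - e * (2 * T * E : ℝ)) := by
      rw [hM, hqset, smul_sub]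
      congr 1
      have hTc : (T : ℂ) ≠ 0 := by exact_mod_cast hT.ne'
      rw [Complex.real_smul]
      push_cast
      field_simp
    rw [h1, norm_smul, Real.norm_of_nonneg (by positivity)]
    calc _ ≤ (2 * T)⁻¹ * (ζ / 4 * (2 * T * E)) := by gcongr
      _ = _ := by field_simp
  have hV : ∀ f : ℝ → ℝ, (∀ t, |f t| ≤ ‖q t‖) → Measurable f →
      (2 * T)⁻¹ * ∫ t in Set.Icc (-T) T, f t ^ 2 ≤ R * E ^ 2 := by
    intro f hf hfm
    have h1 : ∫ t in Set.Icc (-T) T, f t ^ 2 ≤ ∫ t in Set.Icc (-T) T, R * E * ‖G t‖ ^ 2 := by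
      refine integral_mono_of_nonneg (Filter.Eventually.of_forall fun t => by positivity)
        (hG2.integrableOn.const_mul _) (Filter.Eventually.of_forall fun t => ?_)
      exact (sq_le_sq.2 ((hf t).trans (le_abs_self _))).trans (hq2 t)
    have h2 : ∫ t in Set.Icc (-T) T, R * E * ‖G t‖ ^ 2 ≤ R * E * (2 * T * E) := by
      rw [integral_const_mul]
      gcongr
      rw [← hGE]
      exact setIntegral_le_integral hG2 (Filter.Eventually.of_forall fun t => by positivity)
    calc _ ≤ (2 * T)⁻¹ * (R * E * (2 * T * E)) := by gcongr; exact h1.trans h2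
      _ = _ := by field_simp
  have hqi : IntegrableOn q (Set.Icc (-T) T) := i1.integrableOn
  have hMre : (2 * T)⁻¹ * ∫ t in Set.Icc (-T) T, (q t).re = M.re := by
    have := Complex.reCLM.integral_comp_comm hqi
    simp only [Complex.reCLM_apply] at this
    rw [this, hM, Complex.real_smul, Complex.re_ofReal_mul]
  have hMim : (2 * T)⁻¹ * ∫ t in Set.Icc (-T) T, (q t).im = M.im := by
    have := Complex.imCLM.integral_comp_comm hqi
    simp only [Complex.imCLM_apply] at this
    rw [this, hM, Complex.real_smul, Complex.im_ofReal_mul]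
  have hc : 0 < ζ * (n * E) / 8 := by positivity
  have hrem : Measurable fun t => (q t).re := Complex.measurable_re.comp hqm
  have himm : Measurable fun t => (q t).im := Complex.measurable_im.comp hqm
  have c1 := chebyshev_sampleTime hT hrem (fun t => (Complex.abs_re_le_norm _).trans (hqM t))
    (hV _ (fun t => Complex.abs_re_le_norm _) hrem) hc n
  have c2 := chebyshev_sampleTime hT himm (fun t => (Complex.abs_im_le_norm _).trans (hqM t))
    (hV _ (fun t => Complex.abs_im_le_norm _) himm) hc n
  rw [hMre] at c1
  rw [hMim] at c2
  let r : ℝ → ℝ := fun t => ‖(G (t + β) + d (t + β)) * conj (G t + d t) - G (t + β) * conj (G t)‖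
  have hrm : Measurable r :=
    (((hGs.add hds).mul (Complex.continuous_conj.measurable.comp (hG.add hd))).sub hqm).norm
  have hri : Integrable r := (isum.sub i1).norm
  have c3 := markov_sampleTime hT hrm (fun t => norm_nonneg _) hri.integrableOn
    (V := 3 * s * E) (by
      calc _ ≤ (2 * T)⁻¹ * (3 * s * (2 * T * E)) := by
            gcongr
            exact (setIntegral_le_integral hri
              (Filter.Eventually.of_forall fun t => norm_nonneg _)).trans hrest
        _ = _ := by field_simp) (by positivity : 0 < ζ * (n * E) / 4) n
  have hsub : {ω | ζ * (n * E) ≤ ‖lagSum (G + d) T β n ω - e * (n * E : ℝ)‖} ⊆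
      ({ω | ζ * (n * E) / 8 ≤ |∑ i ∈ Finset.range n, (q (sampleTime T (ω i))).re - n * M.re|} ∪
       {ω | ζ * (n * E) / 8 ≤ |∑ i ∈ Finset.range n, (q (sampleTime T (ω i))).im - n * M.im|}) ∪
      {ω | ζ * (n * E) / 4 ≤ ∑ i ∈ Finset.range n, r (sampleTime T (ω i))} := by
    intro ω hω
    by_contra hcon
    simp only [Set.mem_union, Set.mem_ofPred_eq, not_or, not_le] at hcon
    obtain ⟨⟨h1, h2⟩, h3⟩ := hcon
    simp only [Set.mem_ofPred_eq] at hω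
    set Q : ℂ := ∑ i ∈ Finset.range n, q (sampleTime T (ω i)) with hQ
    have hQM : ‖Q - n * M‖ ≤ ζ * (n * E) / 8 + ζ * (n * E) / 8 := by
      refine (Complex.norm_le_abs_re_add_abs_im _).trans ?_
      have hre : ((n : ℂ) * M).re = n * M.re := by
        rw [← Complex.ofReal_natCast, Complex.re_ofReal_mul]
      have him : ((n : ℂ) * M).im = n * M.im := by
        rw [← Complex.ofReal_natCast, Complex.im_ofReal_mul]
      rw [Complex.sub_re, Complex.sub_im, hre, him, hQ, Complex.re_sum, Complex.im_sum]
      linarith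
    have hL : ‖lagSum (G + d) T β n ω - Q‖ ≤ ∑ i ∈ Finset.range n, r (sampleTime T (ω i)) := by
      rw [lagSum, hQ, ← Finset.sum_sub_distrib]
      exact norm_sum_le _ _
    have hMn : ‖(n : ℂ) * M - e * (n * E : ℝ)‖ ≤ ζ / 4 * (n * E) := by
      have : (n : ℂ) * M - e * (n * E : ℝ) = n * (M - e * (E : ℝ)) := by push_cast; ring
      rw [this, norm_mul, Complex.norm_natCast]
      calc _ ≤ n * (ζ / 4 * E) := by gcongr
        _ = _ := by ring
    have hdec : lagSum (G + d) T β n ω - e * (n * E : ℝ) =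
        (lagSum (G + d) T β n ω - Q) + (Q - n * M) + (n * M - e * (n * E : ℝ)) := by ring
    rw [hdec] at hω
    have := hω.trans norm_add₃_le
    have hpos : 0 < ζ * (n * E) := by positivity
    linarith
  refine (measure_mono hsub).trans ((measure_union_le _ _).trans
    ((add_le_add ((measure_union_le _ _).trans (add_le_add c1 c2)) c3).trans ?_))
  rw [← ENNReal.ofReal_add (by positivity) (by positivity),
    ← ENNReal.ofReal_add (by positivity) (by positivity)]
  apply ENNReal.ofReal_le_ofReal
  apply le_of_eq
  field_simp
  ring

/-- A random multiple of `a` is rarely close to a nonzero integer. -/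
theorem volume_near_nonzero_int_le {a κ : ℝ} (hκ : 0 < κ) (hκ1 : κ ≤ 1 / 100) :
    (volume : Measure unitInterval) {u | ∃ k : ℤ, k ≠ 0 ∧ |a * (1 + (u : ℝ)) - k| ≤ κ} ≤
      ENNReal.ofReal (18 * κ) := by
  wlog ha : 0 ≤ a generalizing a
  · have h := this (a := -a) (by linarith)
    refine (measure_mono ?_).trans h
    rintro u ⟨k, hk, hku⟩
    refine ⟨-k, neg_ne_zero.2 hk, ?_⟩
    rw [← abs_neg]
    convert hku using 2
    push_cast; ring
  -- For `a < 1/4` the multiple stays below `1/2`, away from nonzero integers. Otherwise at most `a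
  -- + 2κ + 1` integers are within reach, and each excludes an interval of `u` of length `2κ/a`.
  rcases lt_or_ge a (1 / 4) with hlt | hge
  · have : {u : unitInterval | ∃ k : ℤ, k ≠ 0 ∧ |a * (1 + (u : ℝ)) - k| ≤ κ} = ∅ := by
      ext u
      simp only [Set.mem_ofPred_eq, Set.mem_empty_iff_false, iff_false]
      rintro ⟨k, hk, hku⟩
      rw [abs_le] at hku
      have h0 := u.2.1
      have h1 := u.2.2
      have hb : a * (1 + (u : ℝ)) ≤ 1 / 2 := by nlinarith
      have hb0 : 0 ≤ a * (1 + (u : ℝ)) := by positivity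
      rcases lt_or_gt_of_ne hk with hneg | hpos
      · have : (k : ℝ) ≤ -1 := by exact_mod_cast Int.le_sub_one_of_lt hneg
        linarith
      · have : (1 : ℝ) ≤ k := by exact_mod_cast hpos
        linarith
    rw [this]; simp
  · set K := Finset.Icc ⌈a - κ⌉ ⌊2 * a + κ⌋
    have ha0 : 0 < a := by linarith
    have hsub : ((↑) : unitInterval → ℝ) ''
        {u : unitInterval | ∃ k : ℤ, k ≠ 0 ∧ |a * (1 + (u : ℝ)) - k| ≤ κ} ⊆
        ⋃ k ∈ K, Set.Icc ((k - κ) / a - 1) ((k + κ) / a - 1) := by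
      rintro _ ⟨u, ⟨k, hk, hku⟩, rfl⟩
      rw [abs_le] at hku
      have h0 := u.2.1
      have h1 := u.2.2
      simp only [Set.mem_iUnion]
      refine ⟨k, Finset.mem_Icc.2 ⟨Int.ceil_le.2 (by nlinarith), Int.le_floor.2 (by nlinarith)⟩, ?_, ?_⟩
      · rw [sub_le_iff_le_add, div_le_iff₀ ha0]; linarith
      · rw [le_sub_iff_add_le, le_div_iff₀ ha0]; linarith
    have hvol : (volume : Measure unitInterval)
        {u : unitInterval | ∃ k : ℤ, k ≠ 0 ∧ |a * (1 + (u : ℝ)) - k| ≤ κ} =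
        volume (((↑) : unitInterval → ℝ) ''
          {u : unitInterval | ∃ k : ℤ, k ≠ 0 ∧ |a * (1 + (u : ℝ)) - k| ≤ κ}) := by
      exact comap_subtype_coe_apply measurableSet_Icc volume _
    rw [hvol]
    refine (measure_mono hsub).trans ((measure_biUnion_finset_le _ _).trans ?_)
    have hcard : (K.card : ℝ) ≤ a + 2 * κ + 1 := by
      rw [Int.card_Icc]
      have h2 : ((⌊2 * a + κ⌋ + 1 - ⌈a - κ⌉).toNat : ℝ) ≤ max (((⌊2 * a + κ⌋ + 1 - ⌈a - κ⌉ : ℤ)) : ℝ) 0 := by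
        rw [← Int.cast_natCast, Int.toNat_eq_max]
        push_cast
        exact le_rfl
      refine h2.trans (max_le ?_ (by linarith))
      push_cast
      have := Int.floor_le (2 * a + κ)
      have := Int.le_ceil (a - κ)
      linarith
    calc _ = ∑ _k ∈ K, ENNReal.ofReal (2 * κ / a) := by
          refine Finset.sum_congr rfl fun k _ => ?_
          rw [Real.volume_Icc]
          congr 1
          ring
      _ = ENNReal.ofReal (K.card * (2 * κ / a)) := by
          rw [Finset.sum_const, nsmul_eq_mul, ENNReal.ofReal_mul (by positivity), ENNReal.ofReal_natCast]
      _ ≤ _ := by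
          apply ENNReal.ofReal_le_ofReal
          calc (K.card : ℝ) * (2 * κ / a) ≤ (a + 2 * κ + 1) * (2 * κ / a) := by gcongr
            _ = (a + 2 * κ + 1) * (2 * κ) / a := by ring
            _ ≤ 18 * κ := by
                rw [div_le_iff₀ ha0]
                nlinarith

end RealRAM

end Batch

/-! ### Reading a frequency off a rotated correlation. -/

section Decision

open ProbabilityTheory
open scoped ComplexConjugate

theorem abs_sin_sub_self_le_cube {x : ℝ} (hx : |x| ≤ 1) : |Real.sin x - x| ≤ |x| ^ 3 := by
  have h := Real.sin_bound hx
  have h2 : |Real.sin x - x| ≤ |Real.sin x - (x - x ^ 3 / 6)| + |x ^ 3 / 6| := by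
    have : Real.sin x - x = (Real.sin x - (x - x ^ 3 / 6)) + -(x ^ 3 / 6) := by ring
    rw [this]
    refine (abs_add_le _ _).trans ?_
    rw [abs_neg]
  have h3 : |x ^ 3 / 6| = |x| ^ 3 / 6 := by rw [abs_div, abs_pow]; norm_num
  have h4 : |x| ^ 4 ≤ |x| ^ 3 := pow_le_pow_of_le_one (abs_nonneg x) hx (by norm_num)
  have h5 : 0 ≤ |x| ^ 3 := by positivity
  have h6 : 0 ≤ |x| ^ 4 := by positivity
  rw [h3] at h2
  nlinarith

/-- A unit vector that is nearly in the direction `1` has an angle near a multiple of `2π`. -/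
theorem angle_near_of_accept {κ ζ y A B : ℝ} (hκ : 0 < κ) (hκ1 : κ ≤ 1 / 100) (hζ : 0 ≤ ζ)
    (hζκ : ζ ≤ κ / 100) (hA : |A - Real.cos y| ≤ ζ) (hB : |B - Real.sin y| ≤ ζ)
    (h1 : -(2 * κ * A) ≤ B) (h2 : B ≤ 2 * κ * A) :
    1 / 2 ≤ A ∧ ∃ k : ℤ, |y - 2 * Real.pi * k| ≤ 4 * κ := by
  rw [abs_le] at hA hB
  -- Acceptance forces `-2κA ≤ 2κA`. If moreover `A < 1/2`, then `cos y` and `sin y` would both be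
  -- too small for `sin² + cos² = 1`.
  have hA0 : 0 ≤ A := by nlinarith
  have hcs := Real.sin_sq_add_cos_sq y
  have hcos1 := Real.cos_le_one y
  have hAhalf : 1 / 2 ≤ A := by
    by_contra hcon
    rw [not_le] at hcon
    have hs1 : Real.sin y ≤ 1 / 50 := by nlinarith
    have hs2 : -(1 / 50) ≤ Real.sin y := by nlinarith
    have hc1 : Real.cos y ≤ 51 / 100 := by nlinarith
    have hc2 : -(1 / 100) ≤ Real.cos y := by nlinarith
    nlinarith
  refine ⟨hAhalf, round (y / (2 * Real.pi)), ?_⟩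
  have hpi := Real.pi_pos
  set k := round (y / (2 * Real.pi)) with hk
  set ϑ := y - 2 * Real.pi * k with hϑ
  have hround := abs_sub_round (y / (2 * Real.pi))
  rw [← hk] at hround
  have hϑpi : |ϑ| ≤ Real.pi := by
    have e : ϑ = 2 * Real.pi * (y / (2 * Real.pi) - k) := by rw [hϑ]; field_simp
    rw [e, abs_mul, abs_of_pos (by positivity)]
    nlinarith
  have hcosϑ : Real.cos ϑ = Real.cos y := by
    rw [hϑ, mul_comm]; exact Real.cos_sub_int_mul_two_pi y k
  have hsinϑ : Real.sin ϑ = Real.sin y := by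
    rw [hϑ, mul_comm]; exact Real.sin_sub_int_mul_two_pi y k
  have hcospos : 0 < Real.cos ϑ := by rw [hcosϑ]; nlinarith
  have hsinabs : |Real.sin ϑ| ≤ 21 / 10 * κ := by
    rw [hsinϑ, abs_le]; constructor <;> nlinarith
  have hϑhalf : |ϑ| ≤ Real.pi / 2 := by
    by_contra hcon
    rw [not_le] at hcon
    have : Real.cos |ϑ| ≤ 0 := Real.cos_nonpos_of_pi_div_two_le_of_le hcon.le (by linarith)
    rw [Real.cos_abs] at this
    linarith
  have hj : 2 / Real.pi * |ϑ| ≤ |Real.sin ϑ| := Real.mul_abs_le_abs_sin hϑhalf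
  have hpi32 := Real.pi_lt_d2
  have : |ϑ| ≤ Real.pi / 2 * (21 / 10 * κ) := by
    have h3 := hj.trans hsinabs
    calc |ϑ| = Real.pi / 2 * (2 / Real.pi * |ϑ|) := by field_simp
      _ ≤ _ := by gcongr
  nlinarith

/-- For `|y| ≤ 4κ`, replacing `sin y` by `y` and `cos y` by `1` makes `B - yA` at most `ζ(1 + |y|)`
plus cubic terms, which is below `κ/8`; dividing by `A ≥ 1/2` doubles it. -/
theorem estimate_error_le {κ ζ y A B : ℝ} (hκ : 0 < κ) (hκ1 : κ ≤ 1 / 100) (hζ : 0 ≤ ζ)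
    (hζκ : ζ ≤ κ / 100) (hA : |A - Real.cos y| ≤ ζ) (hB : |B - Real.sin y| ≤ ζ)
    (hA2 : 1 / 2 ≤ A) (hy : |y| ≤ 4 * κ) : |y - B / A| ≤ κ / 4 := by
  have hA0 : 0 < A := by linarith
  have h1 := abs_sin_sub_self_le_cube (x := y) (by linarith)
  have hcos1 := Real.cos_le_one y
  have hcos2 := Real.one_sub_sq_div_two_le_cos (x := y)
  have h3 : |y * (A - 1)| ≤ |y| * (y ^ 2 / 2 + ζ) := by
    rw [abs_mul]
    gcongr
    rw [abs_le] at hA ⊢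
    constructor <;> nlinarith
  have h4 : |B - y * A| ≤ ζ + |y| ^ 3 + |y| * (y ^ 2 / 2 + ζ) := by
    have e : B - y * A = (B - Real.sin y) + (Real.sin y - y) + -(y * (A - 1)) := by ring
    rw [e]
    refine (abs_add_three _ _ _).trans ?_
    rw [abs_neg]
    linarith
  have hy0 := abs_nonneg y
  have hy2 : y ^ 2 ≤ 16 * κ ^ 2 := by rw [← sq_abs]; nlinarith
  have hy3 : |y| ^ 3 ≤ 64 * κ ^ 3 := by
    calc |y| ^ 3 ≤ (4 * κ) ^ 3 := by gcongr
      _ = _ := by ring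
  have h5 : |y| * (y ^ 2 / 2 + ζ) ≤ 4 * κ * (8 * κ ^ 2 + κ / 100) := by
    gcongr; linarith
  have hκ2 : κ ^ 2 ≤ κ / 100 := by nlinarith
  have hκ3 : κ ^ 3 ≤ κ / 10000 := by nlinarith
  have h6 : |B - y * A| ≤ κ / 8 := by nlinarith
  have e : y - B / A = -(B - y * A) / A := by field_simp; ring
  rw [e, abs_div, abs_neg, abs_of_pos hA0, div_le_iff₀ hA0]
  nlinarith

namespace RealRAM

/-- The angular lag drawn at resolution `w`. -/
noncomputable def lagAngle (κ w u : ℝ) : ℝ := κ * (1 + u) / (2 * w)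

/-- Real part of `Z` rotated back by the frequency `c`. -/
noncomputable def rotRe (α c : ℝ) (Z : ℂ) : ℝ := Z.re * Real.cos (α * c) + Z.im * Real.sin (α * c)

/-- Imaginary part of `Z` rotated back by the frequency `c`. -/
noncomputable def rotIm (α c : ℝ) (Z : ℂ) : ℝ := Z.im * Real.cos (α * c) - Z.re * Real.sin (α * c)

/-- The rotated correlation looks like that of a frequency near the center. -/
def Accepts (κ α c : ℝ) (Z : ℂ) : Prop :=
  -(2 * κ * rotRe α c Z) ≤ rotIm α c Z ∧ rotIm α c Z ≤ 2 * κ * rotRe α c Z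

/-- The corrected center. -/
noncomputable def recenter (α c : ℝ) (Z : ℂ) : ℝ := c + rotIm α c Z / (rotRe α c Z * α)

/-- The step at center `c` and resolution `w` behaves as intended. -/
def GoodOutcome (κ f₀ c w α : ℝ) (Z : ℂ) : Prop :=
  (|f₀ - c| ≤ w → Accepts κ α c Z) ∧ (Accepts κ α c Z → |f₀ - recenter α c Z| ≤ w / 2)

/-- Up to the unknown scale `r`, which affects neither the test nor the corrected centre, the
rotated estimate is `ζ`-close to `(cos y, sin y)` with `y = α(f₀ - c)`. A near centre has `|y| ≤ κ`,
inside the cone of slope `2κ`. Conversely, acceptance puts `y` within `4κ` of a multiple of `2π`,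
which `halias` forces to be `0`; the angular error `κ/4` divided by `α ≥ κ/(2w)` is at most `w/2`.
-/
theorem goodOutcome_of_near {κ ζ f₀ c w α r : ℝ} {Z : ℂ} (hκ : 0 < κ) (hκ1 : κ ≤ 1 / 100)
    (hζ : 0 ≤ ζ) (hζκ : ζ ≤ κ / 100) (hr : 0 < r) (hw : 0 < w) (hα1 : κ / (2 * w) ≤ α)
    (hα2 : α ≤ κ / w)
    (hZ : ‖Z - Complex.exp (α * f₀ * Complex.I) * (r : ℂ)‖ ≤ ζ * r)
    (halias : ∀ k : ℤ, |α * (f₀ - c) - 2 * Real.pi * k| ≤ 4 * κ → k = 0) :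
    GoodOutcome κ f₀ c w α Z := by
  have hα0 : 0 < α := lt_of_lt_of_le (by positivity) hα1
  set x := f₀ - c with hx
  set A := rotRe α c Z / r with hA
  set B := rotIm α c Z / r with hB
  have hrA : rotRe α c Z = A * r := by rw [hA]; field_simp
  have hrB : rotIm α c Z = B * r := by rw [hB]; field_simp
  set D := Z - Complex.exp (α * f₀ * Complex.I) * (r : ℂ) with hD
  have hexp : Complex.exp (α * f₀ * Complex.I) =
      ((Real.cos (α * f₀) : ℝ) : ℂ) + ((Real.sin (α * f₀) : ℝ) : ℂ) * Complex.I := by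
    rw [Complex.exp_mul_I]; push_cast; ring
  have hZre : Z.re = D.re + Real.cos (α * f₀) * r := by
    rw [hD, hexp]
    simp [-Complex.ofReal_cos, -Complex.ofReal_sin]
  have hZim : Z.im = D.im + Real.sin (α * f₀) * r := by
    rw [hD, hexp]
    simp [-Complex.ofReal_cos, -Complex.ofReal_sin]
  set D' := D * Complex.exp (((-(α * c) : ℝ) : ℂ) * Complex.I) with hD'
  have hD'n : ‖D'‖ ≤ ζ * r := by
    rw [hD', norm_mul, Complex.norm_exp_ofReal_mul_I, mul_one]; exact hZ
  have hexp2 : Complex.exp (((-(α * c) : ℝ) : ℂ) * Complex.I) =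
      ((Real.cos (α * c) : ℝ) : ℂ) + ((-Real.sin (α * c) : ℝ) : ℂ) * Complex.I := by
    rw [Complex.exp_mul_I, ← Complex.ofReal_cos, ← Complex.ofReal_sin, Real.cos_neg, Real.sin_neg]
  have hD're : D'.re = D.re * Real.cos (α * c) + D.im * Real.sin (α * c) := by
    rw [hD', hexp2]
    simp [-Complex.ofReal_cos, -Complex.ofReal_sin]
  have hD'im : D'.im = D.im * Real.cos (α * c) - D.re * Real.sin (α * c) := by
    rw [hD', hexp2]
    simp [-Complex.ofReal_cos, -Complex.ofReal_sin]
    ring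
  have hαx : α * x = α * f₀ - α * c := by rw [hx]; ring
  have hAc : |A - Real.cos (α * x)| ≤ ζ := by
    have e : A - Real.cos (α * x) = D'.re / r := by
      rw [hA, hD're, hαx, Real.cos_sub, rotRe, hZre, hZim]
      field_simp
      ring
    rw [e, abs_div, abs_of_pos hr, div_le_iff₀ hr]
    exact (Complex.abs_re_le_norm _).trans hD'n
  have hBs : |B - Real.sin (α * x)| ≤ ζ := by
    have e : B - Real.sin (α * x) = D'.im / r := by
      rw [hB, hD'im, hαx, Real.sin_sub, rotIm, hZre, hZim]
      field_simp
      ring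
    rw [e, abs_div, abs_of_pos hr, div_le_iff₀ hr]
    exact (Complex.abs_im_le_norm _).trans hD'n
  constructor
  · intro hxw
    have hy : |α * x| ≤ κ := by
      rw [abs_mul, abs_of_pos hα0]
      calc α * |x| ≤ κ / w * w := by gcongr
        _ = κ := by field_simp
    have hcos := Real.one_sub_sq_div_two_le_cos (x := α * x)
    have hy2 : (α * x) ^ 2 ≤ κ ^ 2 := by rw [← sq_abs]; gcongr
    have hsin : |Real.sin (α * x)| ≤ κ := (Real.abs_sin_le_abs).trans hy
    rw [abs_le] at hAc hBs hsin
    have hAl : 9 / 10 ≤ A := by nlinarith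
    rw [Accepts, hrA, hrB]
    have hb1 : B ≤ 2 * κ * A := by nlinarith
    have hb2 : -(2 * κ * A) ≤ B := by nlinarith
    constructor
    · have := mul_le_mul_of_nonneg_right hb2 hr.le
      linarith
    · have := mul_le_mul_of_nonneg_right hb1 hr.le
      linarith
  · intro hacc
    rw [Accepts, hrA, hrB] at hacc
    have h1 : -(2 * κ * A) ≤ B := by
      by_contra hcon
      rw [not_le] at hcon
      have := mul_lt_mul_of_pos_right hcon hr
      linarith [hacc.1]
    have h2 : B ≤ 2 * κ * A := by
      by_contra hcon
      rw [not_le] at hcon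
      have := mul_lt_mul_of_pos_right hcon hr
      linarith [hacc.2]
    obtain ⟨hA2, k, hk⟩ := angle_near_of_accept hκ hκ1 hζ hζκ hAc hBs h1 h2
    have hk0 := halias k hk
    rw [hk0] at hk
    have hy : |α * x| ≤ 4 * κ := by simpa using hk
    have hest := estimate_error_le hκ hκ1 hζ hζκ hAc hBs hA2 hy
    have e : f₀ - recenter α c Z = (α * x - B / A) / α := by
      have hA0 : A ≠ 0 := by linarith
      rw [recenter, hrA, hrB, hx]
      field_simp
      ring
    rw [e, abs_div, abs_of_pos hα0, div_le_iff₀ hα0]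
    have : κ / 4 = w / 2 * (κ / (2 * w)) := by field_simp; ring
    calc _ ≤ κ / 4 := hest
      _ = w / 2 * (κ / (2 * w)) := this
      _ ≤ _ := by gcongr

end RealRAM

end Decision

/-! ### Success probability of one step. -/

section StepProbability

open ProbabilityTheory
open scoped ComplexConjugate

namespace RealRAM

theorem measurable_lagSum_comp {Ω : Type*} [MeasurableSpace Ω] {Y : ℝ → ℂ} (hY : Measurable Y)
    (T : ℝ) (n : ℕ) {β : Ω → ℝ} {v : Ω → ℕ → unitInterval} (hβ : Measurable β) (hv : Measurable v) :
    Measurable fun ω => lagSum Y T (β ω) n (v ω) := by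
  unfold lagSum
  refine Finset.measurable_sum _ fun i _ => ?_
  have hi : Measurable fun ω => sampleTime T (v ω i) :=
    (measurable_sampleTime T).comp ((measurable_pi_apply i).comp hv)
  exact (hY.comp (hi.add hβ)).mul (Complex.continuous_conj.measurable.comp (hY.comp hi))

theorem measurable_rotRe_comp {Ω : Type*} [MeasurableSpace Ω] {α c : Ω → ℝ} {Z : Ω → ℂ}
    (hα : Measurable α) (hc : Measurable c) (hZ : Measurable Z) :
    Measurable fun ω => rotRe (α ω) (c ω) (Z ω) := by
  unfold rotRe
  fun_prop

theorem measurable_rotIm_comp {Ω : Type*} [MeasurableSpace Ω] {α c : Ω → ℝ} {Z : Ω → ℂ}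
    (hα : Measurable α) (hc : Measurable c) (hZ : Measurable Z) :
    Measurable fun ω => rotIm (α ω) (c ω) (Z ω) := by
  unfold rotIm
  fun_prop

theorem measurableSet_goodOutcome_comp {Ω : Type*} [MeasurableSpace Ω] {κ f₀ : ℝ}
    {α c w : Ω → ℝ} {Z : Ω → ℂ} (hα : Measurable α) (hc : Measurable c) (hw : Measurable w)
    (hZ : Measurable Z) : MeasurableSet {ω | GoodOutcome κ f₀ (c ω) (w ω) (α ω) (Z ω)} := by
  have hre := measurable_rotRe_comp hα hc hZ
  have him := measurable_rotIm_comp hα hc hZ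
  have hacc : MeasurableSet {ω | Accepts κ (α ω) (c ω) (Z ω)} :=
    (measurableSet_le (hre.const_mul (2 * κ)).neg him).inter
      (measurableSet_le him (hre.const_mul (2 * κ)))
  have hnear : MeasurableSet {ω | |f₀ - c ω| ≤ w ω} :=
    measurableSet_le (continuous_abs.measurable.comp (hc.const_sub f₀)) hw
  have hrec : MeasurableSet {ω | |f₀ - recenter (α ω) (c ω) (Z ω)| ≤ w ω / 2} := by
    refine measurableSet_le ?_ (hw.div_const 2)
    unfold recenter
    exact continuous_abs.measurable.comp ((hc.add (him.div (hre.mul hα))).const_sub f₀)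
  exact (hnear.imp hacc).inter (hacc.imp hrec)

/-- The aperture within which a rotated correlation is accepted. -/
noncomputable def aperture : ℝ := 1 / 10 ^ 6

/-- The outcome of a step at `(c, w)` driven by the coins `ω` is as intended. -/
def GoodStep (Y : ℝ → ℂ) (T : ℝ) (n : ℕ) (f₀ c w : ℝ) (ω : ℕ → unitInterval) : Prop :=
  GoodOutcome aperture f₀ c w (lagAngle aperture w (ω 0))
    (lagSum Y T (lagAngle aperture w (ω 0) / (2 * Real.pi)) n fun i => ω (1 + i))

theorem measurableSet_goodStep_comp {Ω : Type*} [MeasurableSpace Ω] {Y : ℝ → ℂ} (hY : Measurable Y)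
    (T : ℝ) (n : ℕ) (f₀ : ℝ) {c w : Ω → ℝ} {v : Ω → ℕ → unitInterval} (hc : Measurable c)
    (hw : Measurable w) (hv : Measurable v) :
    MeasurableSet {ω | GoodStep Y T n f₀ (c ω) (w ω) (v ω)} := by
  have hα : Measurable fun ω => lagAngle aperture (w ω) (v ω 0 : ℝ) := by
    unfold lagAngle
    have h0 : Measurable fun ω => ((v ω 0 : unitInterval) : ℝ) :=
      measurable_subtype_coe.comp ((measurable_pi_apply 0).comp hv)
    exact ((h0.const_add 1).const_mul _).div (hw.const_mul 2)
  refine measurableSet_goodOutcome_comp hα hc hw ?_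
  refine measurable_lagSum_comp hY T n (hα.div_const _) ?_
  exact measurable_pi_lambda _ fun i => (measurable_pi_apply (1 + i)).comp hv

/-- The tolerance `ζ = 10⁻⁸` is a hundredth of the aperture, as `goodOutcome_of_near` requires. The
failure probability is made up of `18·10⁻⁶` for aliasing, `128R/(ζ²n) ≤ 1.28·10⁻⁵` for sampling and
`12·10⁻¹⁴/ζ = 1.2·10⁻⁵` for noise. -/
theorem measure_not_goodStep_le {G d : ℝ → ℂ} (hG : Measurable G) (hd : Measurable d)
    {T E R f₀ c w : ℝ} {n : ℕ} (hT : 0 < T) (hE : 0 < E) (hR : 1 ≤ R) (hw : 0 < w)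
    (hn : 10 ^ 23 * R ≤ n)
    (hG0 : ∀ t ∉ Set.Icc (-T) T, G t = 0) (hGR : ∀ t, ‖G t‖ ^ 2 ≤ R * E)
    (hG2 : Integrable fun t => ‖G t‖ ^ 2) (hGE : ∫ t, ‖G t‖ ^ 2 = 2 * T * E)
    (hd2 : Integrable fun t => ‖d t‖ ^ 2)
    (hdE : ∫ t, ‖d t‖ ^ 2 ≤ (1 / 10 ^ 14) ^ 2 * (2 * T * E))
    (hcorr : ∀ β : ℝ, 0 ≤ β → 2 * Real.pi * β ≤ aperture / w →
      ‖(∫ t, G (t + β) * conj (G t)) - Complex.exp (2 * Real.pi * f₀ * β * Complex.I) *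
        (2 * T * E : ℝ)‖ ≤ 1 / 10 ^ 8 / 4 * (2 * T * E)) :
    coinLaw {ω | ¬ GoodStep (G + d) T n f₀ c w ω} ≤ ENNReal.ofReal (1 / 10 ^ 4) := by
  have hn0' : (0 : ℝ) < n := lt_of_lt_of_le (by positivity) hn
  have hn0 : 0 < n := by exact_mod_cast hn0'
  have hpi := Real.pi_pos
  have hκ : (0 : ℝ) < aperture := by unfold aperture; positivity
  set α : unitInterval → ℝ := fun u => lagAngle aperture w u with hα
  have hαm : Measurable α := by
    simp only [hα, lagAngle]; fun_prop
  have hα0 : ∀ u, aperture / (2 * w) ≤ α u := by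
    intro u
    simp only [hα, lagAngle]
    gcongr
    exact le_mul_of_one_le_right hκ.le (by linarith [u.2.1])
  have hα1 : ∀ u, α u ≤ aperture / w := by
    intro u
    simp only [hα, lagAngle]
    rw [div_le_div_iff₀ (by positivity) hw]
    nlinarith [u.2.2, mul_pos hκ hw]
  have hαpos : ∀ u, 0 < α u := fun u => lt_of_lt_of_le (by positivity) (hα0 u)
  -- Chosen so that `α(f₀ - c)/(2π) = a(1 + u)`: aliasing means that a random multiple of `a` is
  -- near a nonzero integer.
  set a := aperture * (f₀ - c) / (4 * Real.pi * w) with ha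
  set aliased : Set unitInterval :=
    {u | ∃ k : ℤ, k ≠ 0 ∧ |a * (1 + (u : ℝ)) - k| ≤ aperture} with halias
  have haliasm : MeasurableSet aliased := by
    have : aliased = ⋃ k : ℤ, {u : unitInterval | k ≠ 0 ∧ |a * (1 + (u : ℝ)) - k| ≤ aperture} := by
      ext u; simp [halias]
    rw [this]
    refine MeasurableSet.iUnion fun k => (MeasurableSet.const _).inter ?_
    have hm : Measurable fun u : unitInterval => |a * (1 + (u : ℝ)) - k| :=
      continuous_abs.measurable.comp (by fun_prop)
    exact measurableSet_le hm measurable_const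
  have hY : Measurable (G + d) := hG.add hd
  set dev : Set (ℕ → unitInterval) := {ω | (1 / 10 ^ 8 : ℝ) * (n * E) ≤
    ‖lagSum (G + d) T (α (ω 0) / (2 * Real.pi)) n (fun i => ω (1 + i)) -
      Complex.exp (2 * Real.pi * f₀ * (α (ω 0) / (2 * Real.pi) : ℝ) * Complex.I) *
        (n * E : ℝ)‖} with hdev
  have hα0m : Measurable fun ω : ℕ → unitInterval => α (ω 0) := hαm.comp (measurable_pi_apply 0)
  have hdevm : MeasurableSet dev := by
    refine measurableSet_le measurable_const (Measurable.norm (Measurable.sub ?_ ?_))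
    · exact measurable_lagSum_comp hY T n (hα0m.div_const _)
        (measurable_pi_lambda _ fun i => measurable_pi_apply (1 + i))
    · fun_prop
  have hsub : {ω | ¬ GoodStep (G + d) T n f₀ c w ω} ⊆ ((fun ω => ω 0) ⁻¹' aliased) ∪ dev := by
    intro ω hω
    by_contra hcon
    simp only [Set.mem_union, not_or] at hcon
    apply hω
    obtain ⟨h1, h2⟩ := hcon
    simp only [hdev, Set.mem_ofPred_eq, not_le] at h2
    refine goodOutcome_of_near (ζ := 1 / 10 ^ 8) (r := n * E) hκ (by unfold aperture; norm_num)
      (by positivity) (by unfold aperture; norm_num) (by positivity) hw (hα0 _) (hα1 _) ?_ ?_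
    · refine le_trans (le_of_eq ?_) h2.le
      congr 3
      congr 1
      push_cast
      have : (Real.pi : ℂ) ≠ 0 := by exact_mod_cast hpi.ne'
      simp only [hα]
      field_simp
    · intro k hk
      by_contra hk0
      apply h1
      refine ⟨k, hk0, ?_⟩
      have e : a * (1 + (ω 0 : ℝ)) - k =
          (α (ω 0) * (f₀ - c) - 2 * Real.pi * k) / (2 * Real.pi) := by
        simp only [ha, hα, lagAngle]
        field_simp
        ring
      rw [e, abs_div, abs_of_pos (by positivity : 0 < 2 * Real.pi), div_le_iff₀ (by positivity)]
      refine hk.trans ?_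
      nlinarith [Real.pi_gt_three]
  have p1 : coinLaw ((fun ω => ω 0) ⁻¹' aliased) ≤ ENNReal.ofReal (18 * aperture) := by
    rw [← Measure.map_apply (measurable_pi_apply 0) haliasm, map_eval_coinLaw 0]
    exact volume_near_nonzero_int_le hκ (by unfold aperture; norm_num)
  have p2 : coinLaw dev ≤
      ENNReal.ofReal (128 * R / ((1 / 10 ^ 8) ^ 2 * n) + 12 * (1 / 10 ^ 14) / (1 / 10 ^ 8)) := by
    -- Coin `0` determines the lag and the later coins the sampling times; conditioning on coin `0`
    -- reduces to a fixed lag.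
    rw [← lintegral_indicator_one hdevm,
      lintegral_coinLaw_eq_glue 1 (measurable_one.indicator hdevm)]
    refine (lintegral_mono (g := fun _ => ENNReal.ofReal
      (128 * R / ((1 / 10 ^ 8) ^ 2 * n) + 12 * (1 / 10 ^ 14) / (1 / 10 ^ 8))) fun ω => ?_).trans
      (le_of_eq ?_)
    · have hm : Measurable fun ω' : ℕ → unitInterval => glueCoins 1 (ω, ω') :=
        (measurable_glueCoins 1).comp measurable_prodMk_left
      have e : (fun ω' => dev.indicator 1 (glueCoins 1 (ω, ω'))) =
          ((fun ω' => glueCoins 1 (ω, ω')) ⁻¹' dev).indicator (1 : (ℕ → unitInterval) → ENNReal) := by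
        ext ω'; rfl
      change ∫⁻ ω', dev.indicator 1 (glueCoins 1 (ω, ω')) ∂coinLaw ≤ _
      rw [e, lintegral_indicator_one (hm hdevm)]
      set β := α (ω 0) / (2 * Real.pi) with hβ
      have hβ0 : 0 ≤ β := div_nonneg (hαpos _).le (by positivity)
      refine le_trans (le_of_eq ?_) (measure_lagSum_deviation_le (β := β)
        (e := Complex.exp (2 * Real.pi * f₀ * β * Complex.I)) hG hd hT hE
        (by linarith) (by positivity) (by norm_num) (by positivity) hn0 hG0 hGR hG2 hGE hd2 hdE ?_)
      · congr 1
        ext ω'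
        have h0 : glueCoins 1 (ω, ω') 0 = ω 0 := glueCoins_lt one_pos _
        have h1 : (fun i => glueCoins 1 (ω, ω') (1 + i)) = ω' := by
          ext i; rw [glueCoins_add]
        simp only [hdev, Set.mem_preimage, Set.mem_ofPred_eq, h0, h1, hβ]
      · refine hcorr β hβ0 ?_
        have : 2 * Real.pi * β = α (ω 0) := by rw [hβ]; field_simp
        rw [this]
        exact hα1 _
    · simp
  refine (measure_mono hsub).trans ((measure_union_le _ _).trans ((add_le_add p1 p2).trans ?_))
  rw [← ENNReal.ofReal_add (by positivity) (by positivity)]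
  apply ENNReal.ofReal_le_ofReal
  have h3 : 128 * R / ((1 / 10 ^ 8) ^ 2 * n) ≤ 2 / 10 ^ 5 := by
    rw [div_le_iff₀ (by positivity)]
    linarith
  unfold aperture
  linarith

end RealRAM

end StepProbability

/-! ### Chernoff's bound for adaptive rounds. -/

section AdaptiveChernoff

namespace RealRAM

open Classical in
/-- The number of `i < k` at which the event `b i` occurs. -/
noncomputable def failures (b : ℕ → (ℕ → unitInterval) → Prop) (k : ℕ) (ω : ℕ → unitInterval) : ℕ :=
  ((Finset.range k).filter fun i => b i ω).card

theorem failures_zero (b : ℕ → (ℕ → unitInterval) → Prop) (ω : ℕ → unitInterval) :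
    failures b 0 ω = 0 := by
  simp [failures]

open Classical in
theorem failures_succ (b : ℕ → (ℕ → unitInterval) → Prop) (k : ℕ) (ω : ℕ → unitInterval) :
    failures b (k + 1) ω = failures b k ω + if b k ω then 1 else 0 := by
  unfold failures
  rw [Finset.range_add_one, Finset.filter_insert]
  split_ifs with h
  · rw [Finset.card_insert_of_notMem (by simp)]
  · simp

theorem failures_congr {b : ℕ → (ℕ → unitInterval) → Prop} {k : ℕ} {ω ω' : ℕ → unitInterval}
    (h : ∀ i < k, (b i ω ↔ b i ω')) : failures b k ω = failures b k ω' := by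
  classical
  unfold failures
  congr 1
  exact Finset.filter_congr fun i hi => h i (Finset.mem_range.1 hi)

theorem measurable_failures {b : ℕ → (ℕ → unitInterval) → Prop}
    (hb : ∀ i, MeasurableSet {ω | b i ω}) (k : ℕ) : Measurable (failures b k) := by
  classical
  induction k with
  | zero => exact measurable_const (a := 0)
  | succ k ih =>
    have : failures b (k + 1) = fun ω => failures b k ω + if b k ω then 1 else 0 :=
      funext fun ω => failures_succ b k ω
    rw [this]
    exact ih.add (Measurable.ite (hb k) measurable_const measurable_const)

variable {b : ℕ → (ℕ → unitInterval) → Prop} {B : ℕ}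

/-- Round `i` reads only the first `(i+1)B` coins, so splitting the sequence at coin `kB` fixes the
earlier failures and leaves a fresh block, which contributes a factor of at most `1 + 6560/10^4 ≤
5/3`. The base is `6561 = 3^8`, so that more than `n/8` failures push the moment above `3^n`. -/
theorem lintegral_pow_failures_le (hb : ∀ i, MeasurableSet {ω | b i ω})
    (hpre : ∀ i ω ω', (∀ j < (i + 1) * B, ω j = ω' j) → (b i ω ↔ b i ω'))
    (hp : ∀ i ω, coinLaw {ω' | b i (glueCoins (i * B) (ω, ω'))} ≤ ENNReal.ofReal (1 / 10 ^ 4))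
    (k : ℕ) :
    ∫⁻ ω, (6561 : ENNReal) ^ failures b k ω ∂coinLaw ≤ ENNReal.ofReal ((5 / 3) ^ k) := by
  classical
  have hmeas : ∀ k, Measurable fun ω => (6561 : ENNReal) ^ failures b k ω := fun k =>
    (measurable_from_top (f := fun m : ℕ => (6561 : ENNReal) ^ m)).comp (measurable_failures hb k)
  induction k with
  | zero => simp [failures]
  | succ k ih =>
    rw [lintegral_coinLaw_eq_glue (k * B) (hmeas (k + 1))]
    have hinner : ∀ ω, ∫⁻ ω', (6561 : ENNReal) ^ failures b (k + 1) (glueCoins (k * B) (ω, ω'))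
        ∂coinLaw ≤ (6561 : ENNReal) ^ failures b k ω * ENNReal.ofReal (5 / 3) := by
      intro ω
      have hm : Measurable fun ω' : ℕ → unitInterval => glueCoins (k * B) (ω, ω') :=
        (measurable_glueCoins _).comp measurable_prodMk_left
      have hset : MeasurableSet {ω' | b k (glueCoins (k * B) (ω, ω'))} := hm (hb k)
      have he : ∀ ω', (6561 : ENNReal) ^ failures b (k + 1) (glueCoins (k * B) (ω, ω')) =
          (6561 : ENNReal) ^ failures b k ω *
            (1 + {ω' | b k (glueCoins (k * B) (ω, ω'))}.indicator (fun _ => 6560) ω') := by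
        intro ω'
        rw [failures_succ, pow_add]
        congr 1
        · congr 1
          refine failures_congr fun i hi => hpre i _ _ fun j hj => glueCoins_lt ?_ _
          exact hj.trans_le (Nat.mul_le_mul_right _ hi)
        · by_cases h : b k (glueCoins (k * B) (ω, ω'))
          · simp only [h, if_true, pow_one, Set.indicator, Set.mem_ofPred_eq]; norm_num
          · simp [h, Set.indicator]
      simp_rw [he]
      rw [lintegral_const_mul _ ((measurable_const.indicator hset).const_add 1),
        lintegral_add_left measurable_const, lintegral_indicator_const hset]
      gcongr
      simp only [lintegral_const, measure_univ, mul_one]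
      calc (1 : ENNReal) + 6560 * _ ≤ ENNReal.ofReal 1 + ENNReal.ofReal 6560 *
            ENNReal.ofReal (1 / 10 ^ 4) := by
            refine add_le_add (by simp) (mul_le_mul' (by simp) (hp k ω))
        _ = ENNReal.ofReal (1 + 6560 * (1 / 10 ^ 4)) := by
            rw [← ENNReal.ofReal_mul (by norm_num), ENNReal.ofReal_add (by norm_num) (by norm_num)]
        _ ≤ _ := ENNReal.ofReal_le_ofReal (by norm_num)
    refine (lintegral_mono hinner).trans ?_
    rw [lintegral_mul_const _ (hmeas k), pow_succ, ENNReal.ofReal_mul (by positivity)]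
    gcongr

/-- An adaptive Chernoff bound: events of conditional probability at most `1 / 10 ^ 4` seldom occur
in more than an eighth of all rounds. -/
theorem measure_many_failures_le (hb : ∀ i, MeasurableSet {ω | b i ω})
    (hpre : ∀ i ω ω', (∀ j < (i + 1) * B, ω j = ω' j) → (b i ω ↔ b i ω'))
    (hp : ∀ i ω, coinLaw {ω' | b i (glueCoins (i * B) (ω, ω'))} ≤ ENNReal.ofReal (1 / 10 ^ 4))
    (n : ℕ) :
    coinLaw {ω | n < 8 * failures b n ω} ≤ ENNReal.ofReal ((5 / 9) ^ n) := by
  have h1 : coinLaw {ω | n < 8 * failures b n ω} ≤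
      coinLaw {ω | (3 : ENNReal) ^ n ≤ 6561 ^ failures b n ω} := by
    refine measure_mono fun ω hω => ?_
    simp only [Set.mem_ofPred_eq] at hω ⊢
    calc (3 : ENNReal) ^ n ≤ 3 ^ (8 * failures b n ω) := pow_le_pow_right₀ (by norm_num) hω.le
      _ = _ := by rw [pow_mul]; norm_num
  refine h1.trans ?_
  have hmeas : Measurable fun ω => (6561 : ENNReal) ^ failures b n ω :=
    (measurable_from_top (f := fun m : ℕ => (6561 : ENNReal) ^ m)).comp (measurable_failures hb n)
  refine (meas_ge_le_lintegral_div hmeas.aemeasurable (by positivity) (by simp)).trans ?_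
  refine (ENNReal.div_le_div_right (lintegral_pow_failures_le hb hpre hp n) _).trans (le_of_eq ?_)
  have : (3 : ENNReal) ^ n = ENNReal.ofReal (3 ^ n) := by
    rw [ENNReal.ofReal_pow (by norm_num)]; norm_num
  rw [this, ← ENNReal.ofReal_div_of_pos (by positivity), ← div_pow]
  norm_num

end RealRAM

end AdaptiveChernoff

/-! ### Runs as measurable functions of the coins. -/

section Machine

namespace RealRAM

/-- The registers, the array and the number of draws determine the measurable structure on
configurations. -/
instance : MeasurableSpace State :=
  MeasurableSpace.comap (fun s => (s.reg, s.array, s.draws)) inferInstance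

theorem measurable_state_iff {Ω : Type*} [MeasurableSpace Ω] {s : Ω → State} :
    Measurable s ↔ (Measurable fun x => (s x).reg) ∧ (Measurable fun x => (s x).array) ∧
      Measurable fun x => (s x).draws := by
  rw [measurable_comap_iff]
  constructor
  · intro h
    exact ⟨h.fst, h.snd.fst, h.snd.snd⟩
  · rintro ⟨h1, h2, h3⟩
    exact h1.prodMk (h2.prodMk h3)

variable {Ω : Type*} [MeasurableSpace Ω]

/-- Covers array addresses, draw counters and loop counts, which depend on the sample point but take
countably many values. -/
theorem measurable_apply_nat {β : Type*} [MeasurableSpace β] {F : ℕ → Ω → β}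
    (hF : ∀ n, Measurable (F n)) {n : Ω → ℕ} (hn : Measurable n) : Measurable fun x => F (n x) x :=
  (measurable_from_prod_countable_right (f := fun q : ℕ × Ω => F q.1 q.2) hF).comp
    (hn.prodMk measurable_id)

theorem measurable_eval {s : Ω → State} (hs : Measurable s) (e : Expr) :
    Measurable fun x => e.eval (s x) := by
  obtain ⟨h1, h2, -⟩ := measurable_state_iff.1 hs
  induction e with
  | const q => exact measurable_const
  | pi => exact measurable_const
  | reg i => exact (measurable_pi_apply i).comp h1
  | load e ih =>
    exact measurable_apply_nat (F := fun n x => (s x).array n)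
      (fun n => (measurable_pi_apply n).comp h2) (Nat.measurable_floor.comp ih)
  | add e₁ e₂ ih₁ ih₂ => exact ih₁.add ih₂
  | sub e₁ e₂ ih₁ ih₂ => exact ih₁.sub ih₂
  | mul e₁ e₂ ih₁ ih₂ => exact ih₁.mul ih₂
  | div e₁ e₂ ih₁ ih₂ => exact ih₁.div ih₂
  | sin e ih => exact Real.measurable_sin.comp ih
  | cos e ih => exact Real.measurable_cos.comp ih
  | exp e ih => exact Real.measurable_exp.comp ih
  | log e ih => exact Real.measurable_log.comp ih

theorem measurable_update_comp {f : Ω → ℕ → ℝ} (hf : Measurable f) (i : ℕ) {v : Ω → ℝ}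
    (hv : Measurable v) : Measurable fun x => Function.update (f x) i (v x) := by
  refine measurable_pi_lambda _ fun j => ?_
  by_cases h : j = i
  · subst h; simpa using hv
  · simp only [Function.update_of_ne h]
    exact (measurable_pi_apply j).comp hf

theorem measurable_charge {s : Ω → State} (hs : Measurable s) (n : ℕ) :
    Measurable fun x => (s x).charge n :=
  have h := measurable_state_iff.1 hs
  measurable_state_iff.2 ⟨h.1, h.2.1, h.2.2⟩

/-- A run is a measurable function of the random numbers and of the start configuration. -/
theorem measurable_exec {y : ℝ → ℂ} (hy : Measurable y) {ω : Ω → ℕ → unitInterval}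
    (hω : Measurable ω) (P : Prog) {s : Ω → State} (hs : Measurable s) :
    Measurable fun x => exec y (ω x) P (s x) := by
  induction P generalizing s with
  | skip => exact hs
  | assign i e =>
    obtain ⟨h1, h2, h3⟩ := measurable_state_iff.1 hs
    exact measurable_state_iff.2 ⟨measurable_update_comp h1 i (measurable_eval hs e), h2, h3⟩
  | store addr e =>
    obtain ⟨h1, h2, h3⟩ := measurable_state_iff.1 hs
    exact measurable_state_iff.2 ⟨h1, measurable_apply_nat
      (F := fun n x => Function.update (s x).array n (e.eval (s x)))
      (fun n => measurable_update_comp h2 n (measurable_eval hs e))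
      (Nat.measurable_floor.comp (measurable_eval hs addr)), h3⟩
  | sample i j e =>
    obtain ⟨h1, h2, h3⟩ := measurable_state_iff.1 hs
    have hv := hy.comp (measurable_eval hs e)
    exact measurable_state_iff.2 ⟨measurable_update_comp (measurable_update_comp h1 i
      (Complex.measurable_re.comp hv)) j (Complex.measurable_im.comp hv), h2, h3⟩
  | rand i =>
    obtain ⟨h1, h2, h3⟩ := measurable_state_iff.1 hs
    refine measurable_state_iff.2 ⟨measurable_update_comp h1 i ?_, h2,
      (measurable_from_top (f := fun n : ℕ => n + 1)).comp h3⟩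
    exact measurable_apply_nat (F := fun n x => (ω x n : ℝ))
      (fun n => measurable_subtype_coe.comp ((measurable_pi_apply n).comp hω)) h3
  | seq P Q ihP ihQ => exact ihQ (ihP hs)
  | ite e₁ e₂ P Q ihP ihQ =>
    simp only [exec]
    exact Measurable.ite (measurableSet_le (measurable_eval hs e₁) (measurable_eval hs e₂))
      (ihP (measurable_charge hs _)) (ihQ (measurable_charge hs _))
  | loop e P ih =>
    simp only [exec]
    refine measurable_apply_nat (F := fun n x => (fun s' => (exec y (ω x) P s').charge 1)^[n]
      ((s x).charge (e.cost + 1))) (fun n => ?_) (Nat.measurable_floor.comp (measurable_eval hs e))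
    induction n with
    | zero => exact measurable_charge hs _
    | succ n ihn =>
      simp only [Function.iterate_succ_apply']
      exact measurable_charge (ih ihn) 1

theorem le_draws_exec (y : ℝ → ℂ) (ω : ℕ → unitInterval) (P : Prog) (s : State) :
    s.draws ≤ (exec y ω P s).draws := by
  induction P generalizing s with
  | skip => exact le_rfl
  | assign i e => exact le_rfl
  | store addr e => exact le_rfl
  | sample i j e => exact le_rfl
  | rand i => exact Nat.le_succ _
  | seq P Q ihP ihQ => exact (ihP s).trans (ihQ _)
  | ite e₁ e₂ P Q ihP ihQ =>
    simp only [exec]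
    split_ifs
    · exact ihP (s.charge _)
    · exact ihQ (s.charge _)
  | loop e P ih =>
    simp only [exec]
    generalize ⌊e.eval s⌋₊ = n
    induction n with
    | zero => exact le_rfl
    | succ n ihn =>
      simp only [Function.iterate_succ_apply']
      exact ihn.trans (ih _)

/-- A run depends only on the random numbers that it draws. -/
theorem exec_congr_coins (y : ℝ → ℂ) {ω ω' : ℕ → unitInterval} (P : Prog) (s : State)
    (h : ∀ j < (exec y ω P s).draws, ω j = ω' j) : exec y ω' P s = exec y ω P s := by
  induction P generalizing s with
  | skip => rfl
  | assign i e => rfl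
  | store addr e => rfl
  | sample i j e => rfl
  | rand i =>
    have : ω s.draws = ω' s.draws := h s.draws (Nat.lt_succ_self _)
    simp only [exec, this]
  | seq P Q ihP ihQ =>
    simp only [exec] at h ⊢
    rw [ihP s fun j hj => h j (hj.trans_le (le_draws_exec _ _ _ _))]
    exact ihQ _ h
  | ite e₁ e₂ P Q ihP ihQ =>
    simp only [exec] at h ⊢
    split_ifs at h ⊢
    · exact ihP _ h
    · exact ihQ _ h
  | loop e P ih =>
    simp only [exec] at h ⊢
    revert h
    generalize ⌊e.eval s⌋₊ = n
    intro h
    induction n with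
    | zero => rfl
    | succ n ihn =>
      simp only [Function.iterate_succ_apply'] at h ⊢
      rw [ihn fun j hj => h j (hj.trans_le (le_draws_exec _ _ _ _))]
      exact congrArg (State.charge 1) (ih _ h)

end RealRAM

end Machine

/-! ### The program; even array cells hold the stack of centres, odd cells the records. -/

section Program

open scoped ComplexConjugate

namespace RealRAM

open _root_.RealRAM.Expr _root_.RealRAM.Prog

/-- Draw a time `t`, sample at `t` and at `t + α / 2π`, and add the product to the sum held in
registers `13` and `14`. -/
def accumulate : Prog :=
  seq (rand 15) <| seq (assign 15 (mul (reg 0) (sub (mul (const 2) (reg 15)) (const 1)))) <|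
  seq (sample 16 17 (reg 15)) <|
  seq (sample 18 19 (add (reg 15) (div (reg 12) (mul (const 2) pi)))) <|
  seq (assign 13 (add (reg 13) (add (mul (reg 16) (reg 18)) (mul (reg 17) (reg 19))))) <|
  assign 14 (add (reg 14) (sub (mul (reg 16) (reg 19)) (mul (reg 17) (reg 18))))

/-- Draw an angle `α` for the width in register `8` and estimate the autocorrelation at the lag
`α / 2π`. -/
def probe : Prog :=
  seq (rand 11) <|
  seq (assign 12 (div (mul (const (1 / 10 ^ 6)) (add (const 1) (reg 11)))
    (mul (const 2) (reg 8)))) <|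
  seq (assign 13 (const 0)) <| seq (assign 14 (const 0)) <|
  loop (mul (const (2 * 10 ^ 23)) (reg 3)) accumulate

/-- Record the new centre if the width is small enough, else descend to it. -/
def descend : Prog :=
  ite (reg 8) (mul (const (2 * 10 ^ 4)) (reg 7))
    (seq (store (add (mul (const 2) (reg 10)) (const 1)) (reg 23))
      (assign 10 (add (reg 10) (const 1))))
    (seq (assign 9 (add (reg 9) (const 1))) <| seq (assign 8 (div (reg 8) (const 2))) <|
      store (mul (const 2) (reg 9)) (reg 23))

/-- Return to the previous centre. -/
def ascend : Prog :=
  ite (const 1) (reg 9)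
    (seq (assign 9 (sub (reg 9) (const 1))) (assign 8 (mul (reg 8) (const 2)))) skip

/-- Test the centre on top of the stack against the estimate in registers `13` and `14`. -/
def judge : Prog :=
  seq (assign 20 (load (mul (const 2) (reg 9)))) <|
  seq (assign 21 (add (mul (reg 13) (cos (mul (reg 12) (reg 20))))
    (mul (reg 14) (sin (mul (reg 12) (reg 20)))))) <|
  seq (assign 22 (sub (mul (reg 14) (cos (mul (reg 12) (reg 20))))
    (mul (reg 13) (sin (mul (reg 12) (reg 20)))))) <|
  seq (assign 23 (add (reg 20) (div (reg 22) (mul (reg 21) (reg 12))))) <|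
  ite (sub (const 0) (mul (const (2 / 10 ^ 6)) (reg 21))) (reg 22)
    (ite (reg 22) (mul (const (2 / 10 ^ 6)) (reg 21)) descend ascend) ascend

/-- One round of the search. -/
def searchRound : Prog := seq probe judge

/-- Count the records close to the record of index `reg 24`. -/
def tally : Prog :=
  seq (ite (mul (sub (load (add (mul (const 2) (reg 24)) (const 1)))
        (load (add (mul (const 2) (reg 25)) (const 1))))
      (sub (load (add (mul (const 2) (reg 24)) (const 1)))
        (load (add (mul (const 2) (reg 25)) (const 1)))))
      (mul (mul (const (2 * 10 ^ 4)) (reg 7)) (mul (const (2 * 10 ^ 4)) (reg 7)))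
      (assign 26 (add (reg 26) (const 1))) skip) <|
  assign 25 (add (reg 25) (const 1))

/-- Output the record of index `reg 24` if it is close to most records. -/
def nominate : Prog :=
  seq (assign 25 (const 0)) <| seq (assign 26 (const 0)) <| seq (loop (reg 10) tally) <|
  seq (ite (mul (const 2) (reg 26)) (reg 10) skip
    (assign 0 (load (add (mul (const 2) (reg 24)) (const 1))))) <|
  assign 24 (add (reg 24) (const 1))

/-- Output a record that is close to most records. -/
def vote : Prog := seq (assign 24 (const 0)) (loop (reg 10) nominate)

/-- The main part: search, then vote. -/
def searchAndVote : Prog :=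
  seq (assign 8 (reg 1)) <|
  seq (loop (mul (const 8) (log (div (reg 1) (mul (reg 7) (reg 5))))) searchRound) vote

/-- The frequency estimation algorithm. -/
def estimator (A : ℕ) : Prog :=
  seq (assign 6 (log (add (add (const 2) (reg 3)) (reg 4)))) <|
  seq (assign 7 (add (reg 2) (div (mul (mul (const A) (add (reg 3) (reg 4)))
    (mul (reg 6) (reg 6))) (reg 0)))) <|
  ite (reg 1) (mul (const (10 ^ 4)) (reg 7)) (assign 0 (const 0)) <|
  ite (const 1) (reg 5) (assign 0 (const 0)) searchAndVote

/-- The configuration after `k` iterations of a loop body. -/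
noncomputable def iter (y : ℝ → ℂ) (ω : ℕ → unitInterval) (P : Prog) (k : ℕ) (s : State) : State :=
  (fun s' => (exec y ω P s').charge 1)^[k] s

theorem iter_succ (y : ℝ → ℂ) (ω : ℕ → unitInterval) (P : Prog) (k : ℕ) (s : State) :
    iter y ω P (k + 1) s = (exec y ω P (iter y ω P k s)).charge 1 :=
  Function.iterate_succ_apply' _ _ _

theorem exec_loop (y : ℝ → ℂ) (ω : ℕ → unitInterval) (e : Expr) (P : Prog) (s : State) :
    exec y ω (loop e P) s = iter y ω P ⌊e.eval s⌋₊ (s.charge (e.cost + 1)) := rfl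

theorem iter_accumulate (y : ℝ → ℂ) (ω : ℕ → unitInterval) (s : State) (h13 : s.reg 13 = 0)
    (h14 : s.reg 14 = 0) (k : ℕ) :
    (∀ i, i < 13 ∨ 19 < i → (iter y ω accumulate k s).reg i = s.reg i) ∧
    (iter y ω accumulate k s).reg 13 = (lagSum y (s.reg 0) (s.reg 12 / (2 * Real.pi)) k
      fun i => ω (s.draws + i)).re ∧
    (iter y ω accumulate k s).reg 14 = (lagSum y (s.reg 0) (s.reg 12 / (2 * Real.pi)) k
      fun i => ω (s.draws + i)).im ∧
    (iter y ω accumulate k s).array = s.array ∧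
    (iter y ω accumulate k s).draws = s.draws + k ∧
    (iter y ω accumulate k s).samples = s.samples + 2 * k ∧
    (iter y ω accumulate k s).steps = s.steps + 40 * k := by
  induction k with
  | zero => simp [iter, lagSum, h13, h14]
  | succ k ih =>
    obtain ⟨hr, h1, h2, ha, hd, hsa, hst⟩ := ih
    rw [iter_succ]
    generalize iter y ω accumulate k s = u at *
    have r0 := hr 0 (by omega)
    have r12 := hr 12 (by omega)
    refine ⟨?_, ?_, ?_, ?_, ?_, ?_, ?_⟩
    · intro i hi
      rw [← hr i hi]
      have e1 : i ≠ 13 := by omega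
      have e2 : i ≠ 14 := by omega
      have e3 : i ≠ 15 := by omega
      have e4 : i ≠ 16 := by omega
      have e5 : i ≠ 17 := by omega
      have e6 : i ≠ 18 := by omega
      have e7 : i ≠ 19 := by omega
      simp [accumulate, exec, State.charge, e1, e2, e3, e4, e5, e6, e7]
    · simp [accumulate, exec, State.charge, Expr.eval, h1, hd, r0, r12, lagSum,
        Finset.sum_range_succ, sampleTime]
      ring
    · simp [accumulate, exec, State.charge, Expr.eval, h2, hd, r0, r12, lagSum,
        Finset.sum_range_succ, sampleTime]
      ring
    · simp [accumulate, exec, State.charge, ha]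
    · simp [accumulate, exec, State.charge, hd]; ring
    · simp [accumulate, exec, State.charge, hsa]; ring
    · simp [accumulate, exec, State.charge, hst, Expr.cost]; ring

end RealRAM

end Program

/-! ### The effect of one round on the machine. -/

section SearchRound

open scoped ComplexConjugate

namespace RealRAM

open _root_.RealRAM.Expr _root_.RealRAM.Prog

/-- The registers of a configuration in which the search has a stack of height `d` above its root
and has made `i` records. -/
structure SearchState (T F R D : ℝ) (d i : ℕ) (s : State) : Prop where
  r0 : s.reg 0 = T
  r3 : s.reg 3 = R
  r7 : s.reg 7 = D
  r8 : s.reg 8 = F / 2 ^ d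
  r9 : s.reg 9 = d
  r10 : s.reg 10 = i

/-- The angle that the next round draws. -/
noncomputable def nextAngle (ω : ℕ → unitInterval) (s : State) : ℝ :=
  lagAngle aperture (s.reg 8) (ω s.draws)

/-- The autocorrelation estimate of the next round. -/
noncomputable def nextSum (y : ℝ → ℂ) (T : ℝ) (n : ℕ) (ω : ℕ → unitInterval) (s : State) : ℂ :=
  lagSum y T (nextAngle ω s / (2 * Real.pi)) n fun i => ω (s.draws + (1 + i))

theorem exec_probe (y : ℝ → ℂ) (ω : ℕ → unitInterval) (s : State) {n : ℕ}
    (hn : ⌊(2 * 10 ^ 23 : ℝ) * s.reg 3⌋₊ = n) :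
    (∀ i, i < 11 ∨ 19 < i → (exec y ω probe s).reg i = s.reg i) ∧
    (exec y ω probe s).reg 12 = nextAngle ω s ∧
    (exec y ω probe s).reg 13 = (nextSum y (s.reg 0) n ω s).re ∧
    (exec y ω probe s).reg 14 = (nextSum y (s.reg 0) n ω s).im ∧
    (exec y ω probe s).array = s.array ∧
    (exec y ω probe s).draws = s.draws + (1 + n) ∧
    (exec y ω probe s).samples = s.samples + 2 * n ∧
    (exec y ω probe s).steps = s.steps + (19 + 40 * n) := by
  -- `exec.eq_6` is the equation for `seq`; unfolding nothing else keeps the loop intact.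
  simp only [probe, exec.eq_6]
  rw [exec_loop]
  set u := exec y ω (assign 14 (const 0)) (exec y ω (assign 13 (const 0)) (exec y ω
    (assign 12 (div (mul (const (1 / 10 ^ 6)) (add (const 1) (reg 11))) (mul (const 2) (reg 8))))
      (exec y ω (rand 11) s))) with hu
  have hur : ∀ i, i < 11 ∨ 19 < i → u.reg i = s.reg i := by
    intro i hi
    have e1 : i ≠ 11 := by omega
    have e2 : i ≠ 12 := by omega
    have e3 : i ≠ 13 := by omega
    have e4 : i ≠ 14 := by omega
    simp [hu, exec, e1, e2, e3, e4]
  have hu12 : u.reg 12 = nextAngle ω s := by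
    simp [hu, exec, Expr.eval, nextAngle, lagAngle, aperture]
  have hu13 : u.reg 13 = 0 := by simp [hu, exec, Expr.eval]
  have hu14 : u.reg 14 = 0 := by simp [hu, exec, Expr.eval]
  have hua : u.array = s.array := by simp [hu, exec]
  have hud : u.draws = s.draws + 1 := by simp [hu, exec]
  have husa : u.samples = s.samples := by simp [hu, exec]
  have hust : u.steps = s.steps + 15 := by simp [hu, exec, Expr.cost]
  have hfl : ⌊(mul (const (2 * 10 ^ 23)) (reg 3)).eval u⌋₊ = n := by
    rw [← hn]; simp [Expr.eval, hur 3 (by omega)]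
  rw [hfl]
  clear_value u
  obtain ⟨hr, h1, h2, ha, hd, hsa, hst⟩ := iter_accumulate y ω
    (u.charge ((mul (const (2 * 10 ^ 23)) (reg 3)).cost + 1)) hu13 hu14 n
  refine ⟨fun i hi => (hr i (by omega)).trans (hur i hi), (hr 12 (by omega)).trans hu12, ?_, ?_,
    ha.trans hua, ?_, ?_, ?_⟩
  · rw [h1]
    simp only [State.charge, hu12, hur 0 (by omega), hud, nextSum, add_assoc]
  · rw [h2]
    simp only [State.charge, hu12, hur 0 (by omega), hud, nextSum, add_assoc]
  · rw [hd]; simp only [State.charge, hud, add_assoc]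
  · rw [hsa]; simp only [State.charge, husa]
  · rw [hst]; simp only [State.charge, hust, Expr.cost]; ring

theorem floor_two_mul (d : ℕ) : ⌊(2 : ℝ) * d⌋₊ = 2 * d := by exact_mod_cast Nat.floor_natCast (2 * d)

theorem floor_two_mul_add_one (d : ℕ) : ⌊(2 : ℝ) * d + 1⌋₊ = 2 * d + 1 := by
  exact_mod_cast Nat.floor_natCast (2 * d + 1)

/-- What a round does. -/
inductive RoundOutcome (T F R D α : ℝ) (Z : ℂ) (d i : ℕ) (s s' : State) : Prop
  | record (hacc : Accepts aperture α (s.array (2 * d)) Z) (hw : F / 2 ^ d ≤ 2 * 10 ^ 4 * D)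
      (hs : SearchState T F R D d (i + 1) s')
      (ha : s'.array =
        Function.update s.array (2 * i + 1) (recenter α (s.array (2 * d)) Z))
  | push (hacc : Accepts aperture α (s.array (2 * d)) Z) (hw : 2 * 10 ^ 4 * D < F / 2 ^ d)
      (hs : SearchState T F R D (d + 1) i s')
      (ha : s'.array =
        Function.update s.array (2 * (d + 1)) (recenter α (s.array (2 * d)) Z))
  | pop (hacc : ¬ Accepts aperture α (s.array (2 * d)) Z) (e : ℕ) (he : d = e + 1)
      (hs : SearchState T F R D e i s') (ha : s'.array = s.array)
  | stay (hacc : ¬ Accepts aperture α (s.array (2 * d)) Z) (hd : d = 0)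
      (hs : SearchState T F R D d i s') (ha : s'.array = s.array)

theorem exec_ascend (y : ℝ → ℂ) (ω : ℕ → unitInterval) {T F R D α : ℝ} {Z : ℂ} {d i : ℕ}
    {s u : State} (hs : SearchState T F R D d i u) (ha : u.array = s.array)
    (hacc : ¬ Accepts aperture α (s.array (2 * d)) Z) :
    RoundOutcome T F R D α Z d i s (exec y ω ascend u) ∧
    (exec y ω ascend u).draws = u.draws ∧ (exec y ω ascend u).samples = u.samples ∧
    (exec y ω ascend u).steps ≤ u.steps + 11 := by
  obtain ⟨r0, r3, r7, r8, r9, r10⟩ := hs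
  cases d with
  | zero =>
    have h : ¬ (1 : ℝ) ≤ u.reg 9 := by rw [r9]; norm_num
    refine ⟨.stay hacc rfl ⟨?_, ?_, ?_, ?_, ?_, ?_⟩ ?_, ?_, ?_, ?_⟩ <;>
      simp [ascend, exec, Expr.eval, State.charge, h, Expr.cost]
    any_goals assumption
    · simpa using r8
    · simpa using r9
  | succ e =>
    have h : (1 : ℝ) ≤ u.reg 9 := by rw [r9]; push_cast; linarith [Nat.cast_nonneg (α := ℝ) e]
    refine ⟨.pop hacc e rfl ⟨?_, ?_, ?_, ?_, ?_, ?_⟩ ?_, ?_, ?_, ?_⟩ <;>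
      simp [ascend, exec, Expr.eval, State.charge, h, Expr.cost]
    any_goals assumption
    · rw [r8, pow_succ]; field_simp
    · rw [r9]; push_cast; ring

theorem exec_descend (y : ℝ → ℂ) (ω : ℕ → unitInterval) {T F R D α : ℝ} {Z : ℂ} {d i : ℕ}
    {s u : State} (hs : SearchState T F R D d i u) (ha : u.array = s.array)
    (h23 : u.reg 23 = recenter α (s.array (2 * d)) Z)
    (hacc : Accepts aperture α (s.array (2 * d)) Z) :
    RoundOutcome T F R D α Z d i s (exec y ω descend u) ∧
    (exec y ω descend u).draws = u.draws ∧ (exec y ω descend u).samples = u.samples ∧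
    (exec y ω descend u).steps ≤ u.steps + 20 := by
  obtain ⟨r0, r3, r7, r8, r9, r10⟩ := hs
  by_cases hw : F / 2 ^ d ≤ 2 * 10 ^ 4 * D
  · have h : (reg 8).eval u ≤ (mul (const (2 * 10 ^ 4)) (reg 7)).eval u := by
      simp only [Expr.eval, r7, r8]; push_cast; exact hw
    refine ⟨.record hacc hw ⟨?_, ?_, ?_, ?_, ?_, ?_⟩ ?_, ?_, ?_, ?_⟩ <;>
      simp only [descend, exec, if_pos h] <;>
      simp [Expr.eval, State.charge, Expr.cost, r10, h23, ha, floor_two_mul_add_one]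
    all_goals assumption
  · have h : ¬ (reg 8).eval u ≤ (mul (const (2 * 10 ^ 4)) (reg 7)).eval u := by
      simp only [Expr.eval, r7, r8]; push_cast; exact hw
    have hfl : ⌊(2 : ℝ) * ((d : ℝ) + 1)⌋₊ = 2 * (d + 1) := by
      exact_mod_cast floor_two_mul (d + 1)
    refine ⟨.push hacc (not_le.1 hw) ⟨?_, ?_, ?_, ?_, ?_, ?_⟩ ?_, ?_, ?_, ?_⟩ <;>
      simp only [descend, exec, if_neg h] <;>
      simp [Expr.eval, State.charge, Expr.cost, r9, h23, ha, hfl]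
    any_goals assumption
    rw [r8, pow_succ]; field_simp

theorem exec_judge (y : ℝ → ℂ) (ω : ℕ → unitInterval) {T F R D α : ℝ} {Z : ℂ} {d i : ℕ}
    {s u : State} (hs : SearchState T F R D d i u) (ha : u.array = s.array)
    (h12 : u.reg 12 = α) (h13 : u.reg 13 = Z.re) (h14 : u.reg 14 = Z.im) :
    RoundOutcome T F R D α Z d i s (exec y ω judge u) ∧
    (exec y ω judge u).draws = u.draws ∧ (exec y ω judge u).samples = u.samples ∧
    (exec y ω judge u).steps ≤ u.steps + 100 := by
  simp only [judge, exec.eq_6]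
  set v := exec y ω (assign 23 (add (reg 20) (div (reg 22) (mul (reg 21) (reg 12)))))
    (exec y ω (assign 22 (sub (mul (reg 14) (cos (mul (reg 12) (reg 20))))
      (mul (reg 13) (sin (mul (reg 12) (reg 20))))))
    (exec y ω (assign 21 (add (mul (reg 13) (cos (mul (reg 12) (reg 20))))
      (mul (reg 14) (sin (mul (reg 12) (reg 20))))))
    (exec y ω (assign 20 (load (mul (const 2) (reg 9)))) u))) with hv
  have hvr : ∀ i, i < 20 → v.reg i = u.reg i := by
    intro i hi
    have e1 : i ≠ 20 := by omega
    have e2 : i ≠ 21 := by omega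
    have e3 : i ≠ 22 := by omega
    have e4 : i ≠ 23 := by omega
    simp [hv, exec, e1, e2, e3, e4]
  have hv21 : v.reg 21 = rotRe α (s.array (2 * d)) Z := by
    simp [hv, exec, Expr.eval, hs.r9, floor_two_mul, h12, h13, h14, ha, rotRe]
  have hv22 : v.reg 22 = rotIm α (s.array (2 * d)) Z := by
    simp [hv, exec, Expr.eval, hs.r9, floor_two_mul, h12, h13, h14, ha, rotIm]
  have hv23 : v.reg 23 = recenter α (s.array (2 * d)) Z := by
    simp [hv, exec, Expr.eval, hs.r9, floor_two_mul, h12, h13, h14, ha, rotIm, rotRe, recenter]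
  have hva : v.array = s.array := by simp [hv, exec, ha]
  have hvd : v.draws = u.draws := by simp [hv, exec]
  have hvsa : v.samples = u.samples := by simp [hv, exec]
  have hvst : v.steps = u.steps + 41 := by simp [hv, exec, Expr.cost]
  clear_value v
  have hvs : ∀ m, SearchState T F R D d i (v.charge m) := fun m =>
    ⟨(hvr 0 (by omega)).trans hs.r0, (hvr 3 (by omega)).trans hs.r3, (hvr 7 (by omega)).trans hs.r7,
      (hvr 8 (by omega)).trans hs.r8, (hvr 9 (by omega)).trans hs.r9,
      (hvr 10 (by omega)).trans hs.r10⟩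
  have hvs₂ : ∀ m m', SearchState T F R D d i ((v.charge m).charge m') := fun m m' =>
    ⟨(hvs m).r0, (hvs m).r3, (hvs m).r7, (hvs m).r8, (hvs m).r9, (hvs m).r10⟩
  have hc1 : ∀ m, (sub (const 0) (mul (const (2 / 10 ^ 6)) (reg 21))).eval (v.charge m) ≤
      (reg 22).eval (v.charge m) ↔ -(2 * aperture * rotRe α (s.array (2 * d)) Z) ≤
        rotIm α (s.array (2 * d)) Z := by
    intro m
    simp [Expr.eval, State.charge, hv21, hv22, aperture]
    norm_num
  have hc2 : ∀ m, (reg 22).eval (v.charge m) ≤ (mul (const (2 / 10 ^ 6)) (reg 21)).eval (v.charge m)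
      ↔ rotIm α (s.array (2 * d)) Z ≤ 2 * aperture * rotRe α (s.array (2 * d)) Z := by
    intro m
    simp [Expr.eval, State.charge, hv21, hv22, aperture]
    norm_num
  have hc1' := hc1 0
  rw [show v.charge 0 = v from rfl] at hc1'
  simp only [exec.eq_7, hc1', hc2]
  split_ifs with h1 h2
  · obtain ⟨a, b, c, e⟩ := exec_descend y ω (s := s) (u := (v.charge _).charge _) (hvs₂ _ _) hva hv23
      ⟨h1, h2⟩
    exact ⟨a, b.trans hvd, c.trans hvsa, e.trans (by simp [State.charge, hvst, Expr.cost])⟩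
  · obtain ⟨a, b, c, e⟩ := exec_ascend y ω (s := s) (u := (v.charge _).charge _) (Z := Z) (hvs₂ _ _) hva
      (fun h => h2 h.2)
    exact ⟨a, b.trans hvd, c.trans hvsa, e.trans (by simp [State.charge, hvst, Expr.cost])⟩
  · obtain ⟨a, b, c, e⟩ := exec_ascend y ω (s := s) (u := v.charge _) (Z := Z) (hvs _) hva
      (fun h => h1 h.1)
    exact ⟨a, b.trans hvd, c.trans hvsa, e.trans (by simp [State.charge, hvst, Expr.cost])⟩

theorem exec_searchRound (y : ℝ → ℂ) (ω : ℕ → unitInterval) {T F R D : ℝ} {d i n : ℕ} {s : State}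
    (hs : SearchState T F R D d i s) (hn : ⌊(2 * 10 ^ 23 : ℝ) * R⌋₊ = n) :
    RoundOutcome T F R D (nextAngle ω s) (nextSum y T n ω s) d i s (exec y ω searchRound s) ∧
    (exec y ω searchRound s).draws = s.draws + (1 + n) ∧
    (exec y ω searchRound s).samples = s.samples + 2 * n ∧
    (exec y ω searchRound s).steps ≤ s.steps + (119 + 40 * n) := by
  obtain ⟨hr, h12, h13, h14, ha, hd, hsa, hst⟩ := exec_probe y ω s (n := n) (by rw [hs.r3]; exact hn)
  rw [hs.r0] at h13 h14
  obtain ⟨a, b, c, e⟩ := exec_judge y ω (s := s) (u := exec y ω probe s)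
    ⟨(hr 0 (by omega)).trans hs.r0, (hr 3 (by omega)).trans hs.r3, (hr 7 (by omega)).trans hs.r7,
      (hr 8 (by omega)).trans hs.r8, (hr 9 (by omega)).trans hs.r9,
      (hr 10 (by omega)).trans hs.r10⟩ ha h12 h13 h14
  refine ⟨a, b.trans hd, c.trans hsa, e.trans ?_⟩
  omega

end RealRAM

end SearchRound

/-! ### The potential of the backtracking search. -/

section SearchInvariant

namespace RealRAM

open _root_.RealRAM.Expr _root_.RealRAM.Prog

open Classical in
/-- The number of good centres minus the number of bad ones on a stack. -/
noncomputable def stackBalance (f₀ F : ℝ) (a : ℕ → ℝ) (d : ℕ) : ℤ :=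
  ∑ l ∈ Finset.range (d + 1), if |f₀ - a (2 * l)| ≤ F / 2 ^ l then 1 else -1

open Classical in
/-- The number of records within `10 ^ 4 * D` of `f₀`. -/
noncomputable def goodRecords (f₀ D : ℝ) (a : ℕ → ℝ) (i : ℕ) : ℕ :=
  ((Finset.range i).filter fun j => |f₀ - a (2 * j + 1)| ≤ 10 ^ 4 * D).card

theorem stackBalance_le (f₀ F : ℝ) (a : ℕ → ℝ) (d : ℕ) : stackBalance f₀ F a d ≤ d + 1 := by
  unfold stackBalance
  refine (Finset.sum_le_card_nsmul _ _ 1 fun l _ => ?_).trans (by simp)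
  split_ifs <;> norm_num

theorem stackBalance_congr {f₀ F : ℝ} {a a' : ℕ → ℝ} {d : ℕ} (h : ∀ l ≤ d, a (2 * l) = a' (2 * l)) :
    stackBalance f₀ F a d = stackBalance f₀ F a' d := by
  unfold stackBalance
  refine Finset.sum_congr rfl fun l hl => ?_
  rw [h l (Nat.lt_succ_iff.1 (Finset.mem_range.1 hl))]

theorem stackBalance_succ_of_near {f₀ F : ℝ} {a : ℕ → ℝ} {d : ℕ}
    (h : |f₀ - a (2 * (d + 1))| ≤ F / 2 ^ (d + 1)) :
    stackBalance f₀ F a (d + 1) = stackBalance f₀ F a d + 1 := by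
  unfold stackBalance
  rw [Finset.sum_range_succ _ (d + 1), if_pos h]

theorem stackBalance_succ_of_far {f₀ F : ℝ} {a : ℕ → ℝ} {d : ℕ}
    (h : ¬ |f₀ - a (2 * (d + 1))| ≤ F / 2 ^ (d + 1)) :
    stackBalance f₀ F a (d + 1) = stackBalance f₀ F a d - 1 := by
  unfold stackBalance
  rw [Finset.sum_range_succ _ (d + 1), if_neg h, sub_eq_add_neg]

theorem goodRecords_congr {f₀ D : ℝ} {a a' : ℕ → ℝ} {i : ℕ}
    (h : ∀ j < i, a (2 * j + 1) = a' (2 * j + 1)) : goodRecords f₀ D a i = goodRecords f₀ D a' i := by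
  unfold goodRecords
  congr 1
  refine Finset.filter_congr fun j hj => ?_
  rw [h j (Finset.mem_range.1 hj)]

theorem goodRecords_le_succ (f₀ D : ℝ) (a : ℕ → ℝ) (i : ℕ) :
    goodRecords f₀ D a i ≤ goodRecords f₀ D a (i + 1) :=
  Finset.card_le_card (Finset.filter_subset_filter _ (Finset.range_subset_range.2 (Nat.le_succ i)))

theorem goodRecords_succ {f₀ D : ℝ} {a : ℕ → ℝ} {i : ℕ} (h : |f₀ - a (2 * i + 1)| ≤ 10 ^ 4 * D) :
    goodRecords f₀ D a (i + 1) = goodRecords f₀ D a i + 1 := by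
  classical
  unfold goodRecords
  rw [Finset.range_add_one, Finset.filter_insert, if_pos h, Finset.card_insert_of_notMem (by simp)]

/-- The centre on top of the stack. -/
noncomputable def topCentre (s : State) : ℝ := s.array ⌊2 * s.reg 9⌋₊

/-- The next round misjudges the centre on top of the stack. -/
def RoundFails (y : ℝ → ℂ) (T : ℝ) (n : ℕ) (f₀ : ℝ) (ω : ℕ → unitInterval) (s : State) : Prop :=
  ¬ GoodStep y T n f₀ (topCentre s) (s.reg 8) fun j => ω (s.draws + j)

/-- The state of the search: it has a stack of height `d` and `i` records after `k` rounds, of which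
`m` failed. -/
structure SearchInv (T F R D f₀ : ℝ) (k m d i : ℕ) (s : State) : Prop
    extends SearchState T F R D d i s where
  root : s.array 0 = 0
  width : 10 ^ 4 * D < F / 2 ^ d
  records_le : i ≤ k
  balance : (k : ℤ) + 1 ≤ 2 * m + goodRecords f₀ D s.array i + stackBalance f₀ F s.array d

theorem SearchInv.charge {T F R D f₀ : ℝ} {k m d i : ℕ} {s : State}
    (h : SearchInv T F R D f₀ k m d i s) (c : ℕ) : SearchInv T F R D f₀ k m d i (s.charge c) :=
  ⟨⟨h.r0, h.r3, h.r7, h.r8, h.r9, h.r10⟩, h.root, h.width, h.records_le, h.balance⟩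

theorem SearchState.topCentre_eq {T F R D : ℝ} {d i : ℕ} {s : State}
    (h : SearchState T F R D d i s) : topCentre s = s.array (2 * d) := by
  rw [topCentre, h.r9, floor_two_mul]

-- A round that does not fail adds at least `1` to good records plus stack balance: it records a
-- good value, pushes a good centre or removes a bad one. A failing round subtracts at most `1`,
-- which the term `2m` pays for together with the round itself. The root, centre `0` with width `F`,
-- is always good, so its rejection is a failure.
open Classical in
theorem SearchInv.searchRound {y : ℝ → ℂ} {ω : ℕ → unitInterval} {T F R D f₀ : ℝ} {k m d i n : ℕ}
    {s : State} (hf : |f₀| ≤ F) (h : SearchInv T F R D f₀ k m d i s)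
    (hn : ⌊(2 * 10 ^ 23 : ℝ) * R⌋₊ = n) :
    ∃ d' i', SearchInv T F R D f₀ (k + 1) (m + if RoundFails y T n f₀ ω s then 1 else 0) d' i'
      (exec y ω searchRound s) := by
  obtain ⟨hout, -, -, -⟩ := exec_searchRound y ω h.toSearchState hn
  have hfail : RoundFails y T n f₀ ω s ↔ ¬ GoodOutcome aperture f₀ (s.array (2 * d)) (F / 2 ^ d)
      (nextAngle ω s) (nextSum y T n ω s) := by
    unfold RoundFails
    rw [h.topCentre_eq, ← h.r8]
    rfl
  have hbal := h.balance
  have hi := h.records_le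
  generalize exec y ω RealRAM.searchRound s = s' at hout
  generalize nextAngle ω s = α at hout hfail
  generalize nextSum y T n ω s = Z at hout hfail
  cases hout with
  | record hacc hw hs ha =>
    refine ⟨d, i + 1, hs, ?_, h.width, by omega, ?_⟩
    · rw [ha, Function.update_of_ne (by omega), h.root]
    have h1 : stackBalance f₀ F s'.array d = stackBalance f₀ F s.array d :=
      stackBalance_congr fun l _ => by rw [ha, Function.update_of_ne (by omega)]
    have h2 : goodRecords f₀ D s'.array i = goodRecords f₀ D s.array i :=
      goodRecords_congr fun j hj => by rw [ha, Function.update_of_ne (by omega)]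
    have h3 := goodRecords_le_succ f₀ D s'.array i
    split_ifs with hb
    · push_cast
      omega
    · rw [hfail, not_not] at hb
      -- A record is made only at width at most `2 * 10 ^ 4 * D`, and a good step errs by at most
      -- half the width.
      have h4 := goodRecords_succ (f₀ := f₀) (D := D) (a := s'.array) (i := i) (by
        rw [ha, Function.update_self]
        exact (hb.2 hacc).trans (by linarith))
      push_cast
      omega
  | push hacc hw hs ha =>
    refine ⟨d + 1, i, hs, ?_, ?_, by omega, ?_⟩
    · rw [ha, Function.update_of_ne (by omega), h.root]
    -- A push requires width above `2 * 10 ^ 4 * D`, so half of it still exceeds `10 ^ 4 * D`.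
    · rw [pow_succ (2 : ℝ) d, ← div_div]; linarith
    have h1 : stackBalance f₀ F s'.array d = stackBalance f₀ F s.array d :=
      stackBalance_congr fun l hl => by rw [ha, Function.update_of_ne (by omega)]
    have h2 : goodRecords f₀ D s'.array i = goodRecords f₀ D s.array i :=
      goodRecords_congr fun j hj => by rw [ha, Function.update_of_ne (by omega)]
    by_cases hnear : |f₀ - s'.array (2 * (d + 1))| ≤ F / 2 ^ (d + 1)
    · rw [stackBalance_succ_of_near hnear]
      split_ifs <;> push_cast <;> omega
    · rw [stackBalance_succ_of_far hnear]
      rw [if_pos]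
      · push_cast
        omega
      · rw [hfail]
        intro hb
        apply hnear
        rw [ha, Function.update_self, pow_succ, ← div_div]
        exact hb.2 hacc
  | pop hacc e he hs ha =>
    subst he
    refine ⟨e, i, hs, by rw [ha, h.root], ?_, by omega, ?_⟩
    · refine h.width.trans_le ?_
      have hF : 0 ≤ F := (abs_nonneg _).trans hf
      gcongr
      · norm_num
      · omega
    rw [ha]
    by_cases hnear : |f₀ - s.array (2 * (e + 1))| ≤ F / 2 ^ (e + 1)
    · rw [stackBalance_succ_of_near hnear] at hbal
      rw [if_pos]
      · push_cast
        omega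
      · rw [hfail]
        intro hb
        exact hacc (hb.1 hnear)
    · rw [stackBalance_succ_of_far hnear] at hbal
      split_ifs <;> push_cast <;> omega
  | stay hacc hd hs ha =>
    subst hd
    refine ⟨0, i, hs, by rw [ha, h.root], h.width, by omega, ?_⟩
    rw [ha, if_pos]
    · push_cast
      omega
    · rw [hfail]
      intro hb
      refine hacc (hb.1 ?_)
      simpa [h.root] using hf

theorem SearchInv.iter {y : ℝ → ℂ} {ω : ℕ → unitInterval} {T F R D f₀ : ℝ} {n : ℕ}
    {s : State} (hf : |f₀| ≤ F) (h : SearchInv T F R D f₀ 0 0 0 0 s)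
    (hn : ⌊(2 * 10 ^ 23 : ℝ) * R⌋₊ = n) (k : ℕ) :
    ∃ d i, SearchInv T F R D f₀ k (failures (fun j ω =>
      RoundFails y T n f₀ ω (RealRAM.iter y ω RealRAM.searchRound j s)) k ω) d i
      (RealRAM.iter y ω RealRAM.searchRound k s) := by
  induction k with
  | zero => exact ⟨0, 0, by rw [failures_zero]; exact h⟩
  | succ k ih =>
    obtain ⟨d, i, hk⟩ := ih
    obtain ⟨d', i', hk'⟩ := hk.searchRound (y := y) (ω := ω) hf hn
    refine ⟨d', i', ?_⟩
    rw [iter_succ, failures_succ]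
    exact hk'.charge 1

/-- Every round draws the same number `1 + n` of coins whatever its outcome, so the rounds read
consecutive blocks, as the adaptive Chernoff bound needs. -/
theorem iter_searchRound_counters (y : ℝ → ℂ) (ω : ℕ → unitInterval) {T F R D : ℝ} {n : ℕ}
    {s : State} (h : SearchState T F R D 0 0 s) (hn : ⌊(2 * 10 ^ 23 : ℝ) * R⌋₊ = n) (k : ℕ) :
    (∃ d i, SearchState T F R D d i (iter y ω searchRound k s)) ∧
    (iter y ω searchRound k s).draws = s.draws + k * (1 + n) ∧
    (iter y ω searchRound k s).samples = s.samples + k * (2 * n) ∧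
    (iter y ω searchRound k s).steps ≤ s.steps + k * (120 + 40 * n) := by
  induction k with
  | zero => simpa [iter] using ⟨0, 0, h⟩
  | succ k ih =>
    obtain ⟨⟨d, i, hk⟩, h1, h2, h3⟩ := ih
    obtain ⟨hout, e1, e2, e3⟩ := exec_searchRound y ω hk hn
    rw [iter_succ]
    generalize iter y ω searchRound k s = u at *
    refine ⟨?_, ?_, ?_, ?_⟩
    · have key : ∀ d i, SearchState T F R D d i (exec y ω searchRound u) →
          ∃ d i, SearchState T F R D d i ((exec y ω searchRound u).charge 1) :=
        fun d i hs => ⟨d, i, hs.r0, hs.r3, hs.r7, hs.r8, hs.r9, hs.r10⟩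
      cases hout with
      | record _ _ hs _ => exact key _ _ hs
      | push _ _ hs _ => exact key _ _ hs
      | pop _ _ _ hs _ => exact key _ _ hs
      | stay _ _ hs _ => exact key _ _ hs
    · simp only [State.charge, e1, h1]; ring
    · simp only [State.charge, e2, h2]; ring
    · simp only [State.charge]
      refine (Nat.add_le_add_right e3 1).trans ?_
      have : (k + 1) * (120 + 40 * n) = k * (120 + 40 * n) + (120 + 40 * n) := by ring
      omega

end RealRAM

end SearchInvariant

/-! ### The vote among the records. -/

section Vote

namespace RealRAM

open _root_.RealRAM.Expr _root_.RealRAM.Prog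

open Classical in
/-- The number of `l < k` such that the `l`-th record is within `2 * 10 ^ 4 * D` of the `j`-th. -/
noncomputable def support (D : ℝ) (a : ℕ → ℝ) (j k : ℕ) : ℕ :=
  ((Finset.range k).filter fun l => |a (2 * j + 1) - a (2 * l + 1)| ≤ 2 * 10 ^ 4 * D).card

open Classical in
theorem support_succ (D : ℝ) (a : ℕ → ℝ) (j k : ℕ) : support D a j (k + 1) =
    support D a j k + if |a (2 * j + 1) - a (2 * k + 1)| ≤ 2 * 10 ^ 4 * D then 1 else 0 := by
  unfold support
  rw [Finset.range_add_one, Finset.filter_insert]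
  split_ifs with h
  · rw [Finset.card_insert_of_notMem (by simp)]
  · simp

/-- A record near `f₀` exists and any majority record is near `f₀`, if most records are. -/
theorem majority_near {f₀ D : ℝ} {a : ℕ → ℝ} {i : ℕ} (h : i < 2 * goodRecords f₀ D a i) :
    (∃ j < i, i < 2 * support D a j i) ∧
      ∀ j, i < 2 * support D a j i → |f₀ - a (2 * j + 1)| ≤ 3 * 10 ^ 4 * D := by
  classical
  constructor
  · have hne : ((Finset.range i).filter fun j => |f₀ - a (2 * j + 1)| ≤ 10 ^ 4 * D).Nonempty := by
      rw [← Finset.card_pos]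
      change 0 < goodRecords f₀ D a i
      omega
    obtain ⟨j, hj⟩ := hne
    rw [Finset.mem_filter, Finset.mem_range] at hj
    refine ⟨j, hj.1, h.trans_le (Nat.mul_le_mul_left 2 (Finset.card_le_card fun l hl => ?_))⟩
    rw [Finset.mem_filter] at hl ⊢
    refine ⟨hl.1, ?_⟩
    have h1 := abs_le.1 hj.2
    have h2 := abs_le.1 hl.2
    exact abs_le.2 ⟨by linarith, by linarith⟩
  · intro j hj
    -- The good records and the supporters of `j` are both majorities, so they share some `l`; the
    -- distances `10 ^ 4 * D` and `2 * 10 ^ 4 * D` add up.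
    have hcard : (Finset.range i).card < goodRecords f₀ D a i + support D a j i := by
      rw [Finset.card_range]; omega
    obtain ⟨l, hl⟩ := Finset.inter_nonempty_of_card_lt_card_add_card (Finset.filter_subset _ _)
      (Finset.filter_subset _ _) hcard
    rw [Finset.mem_inter, Finset.mem_filter, Finset.mem_filter] at hl
    have h1 := abs_le.1 hl.1.2
    have h2 := abs_le.1 hl.2.2
    exact abs_le.2 ⟨by linarith, by linarith⟩

theorem iter_tally (y : ℝ → ℂ) (ω : ℕ → unitInterval) {D : ℝ} (hD : 0 ≤ D) {j : ℕ} {s : State}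
    (h7 : s.reg 7 = D) (h24 : s.reg 24 = j) (h25 : s.reg 25 = 0) (h26 : s.reg 26 = 0) (k : ℕ) :
    (∀ i, i < 25 → (iter y ω tally k s).reg i = s.reg i) ∧
    (iter y ω tally k s).reg 25 = k ∧
    (iter y ω tally k s).reg 26 = support D s.array j k ∧
    (iter y ω tally k s).array = s.array ∧
    (iter y ω tally k s).samples = s.samples ∧
    (iter y ω tally k s).steps ≤ s.steps + 50 * k := by
  classical
  induction k with
  | zero => simp [iter, support, h25, h26]
  | succ k ih =>
    obtain ⟨hr, h1, h2, ha, hsa, hst⟩ := ih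
    rw [iter_succ]
    generalize iter y ω tally k s = u at *
    have r7 := (hr 7 (by omega)).trans h7
    have r24 := (hr 24 (by omega)).trans h24
    -- The machine has no absolute value, so `tally` compares squares.
    have hsq : (s.array (2 * j + 1) - s.array (2 * k + 1)) *
        (s.array (2 * j + 1) - s.array (2 * k + 1)) ≤ 2 * 10 ^ 4 * D * (2 * 10 ^ 4 * D) ↔
        |s.array (2 * j + 1) - s.array (2 * k + 1)| ≤ 2 * 10 ^ 4 * D := by
      rw [← sq, ← sq, sq_le_sq, abs_of_nonneg (a := 2 * 10 ^ 4 * D) (by positivity)]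
    by_cases hc : |s.array (2 * j + 1) - s.array (2 * k + 1)| ≤ 2 * 10 ^ 4 * D
    · have hc' := hsq.2 hc
      refine ⟨?_, ?_, ?_, ?_, ?_, ?_⟩
      · intro i hi
        rw [← hr i hi]
        have e1 : i ≠ 25 := by omega
        have e2 : i ≠ 26 := by omega
        simp [tally, exec, State.charge, Expr.eval, r24, h1, ha, r7, floor_two_mul_add_one, hc', e1,
          e2]
      · simp [tally, exec, State.charge, Expr.eval, r24, h1, ha, r7, floor_two_mul_add_one, hc']
      · simp [tally, exec, State.charge, Expr.eval, r24, h1, h2, ha, r7, floor_two_mul_add_one, hc',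
          support_succ, hc]
      · simp [tally, exec, State.charge, Expr.eval, r24, h1, ha, r7, floor_two_mul_add_one, hc']
      · simp [tally, exec, State.charge, Expr.eval, r24, h1, ha, r7, floor_two_mul_add_one, hc', hsa]
      · simp [tally, exec, State.charge, Expr.eval, r24, h1, ha, r7, floor_two_mul_add_one, hc',
          Expr.cost]
        omega
    · have hc' := mt hsq.1 hc
      refine ⟨?_, ?_, ?_, ?_, ?_, ?_⟩
      · intro i hi
        rw [← hr i hi]
        have e1 : i ≠ 25 := by omega
        have e2 : i ≠ 26 := by omega
        simp [tally, exec, State.charge, Expr.eval, r24, h1, ha, r7, floor_two_mul_add_one, hc', e1]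
      · simp [tally, exec, State.charge, Expr.eval, r24, h1, ha, r7, floor_two_mul_add_one, hc']
      · simp [tally, exec, State.charge, Expr.eval, r24, h1, h2, ha, r7, floor_two_mul_add_one, hc',
          support_succ, hc]
      · simp [tally, exec, State.charge, Expr.eval, r24, h1, ha, r7, floor_two_mul_add_one, hc']
      · simp [tally, exec, State.charge, Expr.eval, r24, h1, ha, r7, floor_two_mul_add_one, hc', hsa]
      · simp [tally, exec, State.charge, Expr.eval, r24, h1, ha, r7, floor_two_mul_add_one, hc',
          Expr.cost]
        omega

theorem exec_nominate (y : ℝ → ℂ) (ω : ℕ → unitInterval) {D : ℝ} (hD : 0 ≤ D) {i j : ℕ} {s : State}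
    (h7 : s.reg 7 = D) (h10 : s.reg 10 = i) (h24 : s.reg 24 = j) :
    (exec y ω nominate s).reg 7 = D ∧ (exec y ω nominate s).reg 10 = i ∧
    (exec y ω nominate s).reg 24 = (j + 1 : ℕ) ∧
    (2 * support D s.array j i ≤ i → (exec y ω nominate s).reg 0 = s.reg 0) ∧
    (i < 2 * support D s.array j i → (exec y ω nominate s).reg 0 = s.array (2 * j + 1)) ∧
    (exec y ω nominate s).array = s.array ∧
    (exec y ω nominate s).samples = s.samples ∧
    (exec y ω nominate s).steps ≤ s.steps + (50 * i + 30) := by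
  simp only [nominate, exec.eq_6]
  rw [exec_loop]
  set u := exec y ω (assign 26 (const 0)) (exec y ω (assign 25 (const 0)) s) with hu
  have hur : ∀ i, i < 25 → u.reg i = s.reg i := by
    intro i hi
    have e1 : i ≠ 25 := by omega
    have e2 : i ≠ 26 := by omega
    simp [hu, exec, e1, e2]
  have hu25 : u.reg 25 = 0 := by simp [hu, exec, Expr.eval]
  have hu26 : u.reg 26 = 0 := by simp [hu, exec, Expr.eval]
  have hua : u.array = s.array := by simp [hu, exec]
  have husa : u.samples = s.samples := by simp [hu, exec]
  have hust : u.steps = s.steps + 4 := by simp [hu, exec, Expr.cost]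
  have hfl : ⌊(reg 10).eval u⌋₊ = i := by
    simp only [Expr.eval]; rw [hur 10 (by omega), h10, Nat.floor_natCast]
  rw [hfl]
  clear_value u
  obtain ⟨hr, -, h2, ha, hsa, hst⟩ := iter_tally y ω hD (j := j) (s := u.charge ((reg 10).cost + 1))
    ((hur 7 (by omega)).trans h7) ((hur 24 (by omega)).trans h24) hu25 hu26 i
  generalize iter y ω tally i (u.charge ((reg 10).cost + 1)) = v at *
  have v7 : v.reg 7 = D := (hr 7 (by omega)).trans ((hur 7 (by omega)).trans h7)
  have v10 : v.reg 10 = i := (hr 10 (by omega)).trans ((hur 10 (by omega)).trans h10)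
  have v24 : v.reg 24 = j := (hr 24 (by omega)).trans ((hur 24 (by omega)).trans h24)
  have v0 : v.reg 0 = s.reg 0 := (hr 0 (by omega)).trans (hur 0 (by omega))
  have va : v.array = s.array := ha.trans hua
  have vsa : v.samples = s.samples := hsa.trans husa
  have vst : v.steps ≤ s.steps + 6 + 50 * i := hst.trans (by simp [State.charge, hust, Expr.cost])
  simp only [State.charge, hua] at h2
  by_cases hc : 2 * support D s.array j i ≤ i
  · have hc' : (2 : ℝ) * support D s.array j i ≤ i := by exact_mod_cast hc
    refine ⟨?_, ?_, ?_, fun _ => ?_, fun h => absurd hc (not_le.2 h), ?_, ?_, ?_⟩ <;>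
      simp [exec, State.charge, Expr.eval, h2, v10, hc', Expr.cost]
    any_goals assumption
    omega
  · have hc' : ¬ (2 : ℝ) * support D s.array j i ≤ i := by exact_mod_cast hc
    refine ⟨?_, ?_, ?_, fun h => absurd h hc, fun _ => ?_, ?_, ?_, ?_⟩ <;>
      simp [exec, State.charge, Expr.eval, h2, v10, hc', Expr.cost, v24, floor_two_mul_add_one, va]
    any_goals assumption
    omega

theorem exec_vote (y : ℝ → ℂ) (ω : ℕ → unitInterval) {D : ℝ} (hD : 0 ≤ D) {i : ℕ} {s : State}
    (h7 : s.reg 7 = D) (h10 : s.reg 10 = i) :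
    ((∃ j < i, i < 2 * support D s.array j i) →
      ∃ j, i < 2 * support D s.array j i ∧ (exec y ω vote s).reg 0 = s.array (2 * j + 1)) ∧
    (exec y ω vote s).samples = s.samples ∧
    (exec y ω vote s).steps ≤ s.steps + (i * (50 * i + 31) + 4) := by
  simp only [vote, exec.eq_6]
  rw [exec_loop]
  have hfl : ⌊(reg 10).eval (exec y ω (assign 24 (const 0)) s)⌋₊ = i := by
    simp [exec, Expr.eval, h10]
  rw [hfl]
  set u := (exec y ω (assign 24 (const 0)) s).charge ((reg 10).cost + 1) with hu
  have u7 : u.reg 7 = D := by simp [hu, exec, State.charge, h7]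
  have u10 : u.reg 10 = i := by simp [hu, exec, State.charge, h10]
  have u24 : u.reg 24 = (0 : ℕ) := by simp [hu, exec, State.charge, Expr.eval]
  have ua : u.array = s.array := by simp [hu, exec, State.charge]
  have usa : u.samples = s.samples := by simp [hu, exec, State.charge]
  have ust : u.steps = s.steps + 4 := by simp [hu, exec, State.charge, Expr.cost]
  clear_value u
  have key : ∀ k, (iter y ω nominate k u).reg 7 = D ∧ (iter y ω nominate k u).reg 10 = i ∧
      (iter y ω nominate k u).reg 24 = k ∧ (iter y ω nominate k u).array = s.array ∧
      (iter y ω nominate k u).samples = s.samples ∧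
      (iter y ω nominate k u).steps ≤ s.steps + 4 + k * (50 * i + 31) ∧
      ((∃ j < k, i < 2 * support D s.array j i) → ∃ j, i < 2 * support D s.array j i ∧
        (iter y ω nominate k u).reg 0 = s.array (2 * j + 1)) := by
    intro k
    induction k with
    | zero => simpa [iter, u7, u10, ua, usa, ust] using u24
    | succ k ih =>
      obtain ⟨k7, k10, k24, ka, ksa, kst, kout⟩ := ih
      rw [iter_succ]
      generalize iter y ω nominate k u = v at *
      obtain ⟨n7, n10, n24, n0, n0', na, nsa, nst⟩ := exec_nominate y ω hD k7 k10 k24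
      refine ⟨n7, n10, n24, na.trans ka, nsa.trans ksa, ?_, ?_⟩
      · simp only [State.charge]
        have : (k + 1) * (50 * i + 31) = k * (50 * i + 31) + (50 * i + 31) := by ring
        omega
      · rintro ⟨j, hj, hsup⟩
        rw [ka] at n0 n0'
        -- A later majority record overwrites an earlier one; any of them will do.
        by_cases hk : i < 2 * support D s.array k i
        · exact ⟨k, hk, n0' hk⟩
        · have hjk : j < k := by
            refine lt_of_le_of_ne (Nat.lt_succ_iff.1 hj) ?_
            rintro rfl
            exact hk hsup
          obtain ⟨j', h1, h2⟩ := kout ⟨j, hjk, hsup⟩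
          exact ⟨j', h1, (n0 (not_lt.1 hk)).trans h2⟩
  obtain ⟨-, -, -, -, hsa, hst, hout⟩ := key i
  exact ⟨hout, hsa, by omega⟩

end RealRAM

end Vote

/-! ### Probability that many rounds fail. -/

section SearchProbability

namespace RealRAM

theorem measurable_iter {Ω : Type*} [MeasurableSpace Ω] {y : ℝ → ℂ} (hy : Measurable y)
    {ω : Ω → ℕ → unitInterval} (hω : Measurable ω) (P : Prog) (k : ℕ) (s : State) :
    Measurable fun x => iter y (ω x) P k s := by
  induction k with
  | zero => exact measurable_const
  | succ k ih =>
    simp only [iter_succ]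
    exact measurable_charge (measurable_exec hy hω P ih) 1

theorem iter_congr_coins (y : ℝ → ℂ) {ω ω' : ℕ → unitInterval} (P : Prog) (k : ℕ) (s : State)
    (h : ∀ j < (iter y ω P k s).draws, ω j = ω' j) : iter y ω' P k s = iter y ω P k s := by
  induction k with
  | zero => rfl
  | succ k ih =>
    rw [iter_succ] at h
    rw [iter_succ, iter_succ, ih fun j hj => h j (hj.trans_le (le_draws_exec _ _ _ _))]
    exact congrArg (State.charge 1) (exec_congr_coins y P _ h)

theorem goodStep_congr {y : ℝ → ℂ} {T f₀ c w : ℝ} {n : ℕ} {ω ω' : ℕ → unitInterval}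
    (h : ∀ j < 1 + n, ω j = ω' j) : GoodStep y T n f₀ c w ω ↔ GoodStep y T n f₀ c w ω' := by
  have h0 : ω 0 = ω' 0 := h 0 (by omega)
  have h1 : ∀ β, lagSum y T β n (fun i => ω (1 + i)) = lagSum y T β n fun i => ω' (1 + i) := by
    intro β
    unfold lagSum
    refine Finset.sum_congr rfl fun i hi => ?_
    have := Finset.mem_range.1 hi
    simp only [h (1 + i) (by omega)]
  unfold GoodStep
  rw [h0, h1]

variable {y : ℝ → ℂ} {T F R D f₀ : ℝ} {n : ℕ} {s : State}

theorem measurableSet_roundFails (hy : Measurable y) (P : Prog) (k : ℕ) :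
    MeasurableSet {ω | RoundFails y T n f₀ ω (iter y ω P k s)} := by
  have hS : Measurable fun ω : ℕ → unitInterval => iter y ω P k s :=
    measurable_iter hy measurable_id P k s
  obtain ⟨h1, h2, h3⟩ := measurable_state_iff.1 hS
  have h8 : Measurable fun ω => (iter y ω P k s).reg 8 := (measurable_pi_apply 8).comp h1
  have htop : Measurable fun ω => topCentre (iter y ω P k s) := by
    unfold topCentre
    exact measurable_apply_nat (F := fun m ω => (iter y ω P k s).array m)
      (fun m => (measurable_pi_apply m).comp h2)
      (Nat.measurable_floor.comp (((measurable_pi_apply 9).comp h1).const_mul 2))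
  have hv : Measurable fun (ω : ℕ → unitInterval) j => ω ((iter y ω P k s).draws + j) := by
    refine measurable_pi_lambda _ fun j => ?_
    exact measurable_apply_nat (F := fun m (ω : ℕ → unitInterval) => ω (m + j))
      (fun m => measurable_pi_apply (m + j)) h3
  exact (measurableSet_goodStep_comp hy T n f₀ htop h8 hv).compl

/-- It is unlikely that more than an eighth of the rounds of a search fail. -/
theorem measure_search_failures_le (hy : Measurable y) (hf : |f₀| ≤ F)
    (h : SearchInv T F R D f₀ 0 0 0 0 s) (hs : s.draws = 0) (hn : ⌊(2 * 10 ^ 23 : ℝ) * R⌋₊ = n)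
    (hgood : ∀ c w, 10 ^ 4 * D < w →
      coinLaw {ω | ¬ GoodStep y T n f₀ c w ω} ≤ ENNReal.ofReal (1 / 10 ^ 4)) (k : ℕ) :
    coinLaw {ω | k < 8 * failures (fun j ω =>
      RoundFails y T n f₀ ω (iter y ω searchRound j s)) k ω} ≤ ENNReal.ofReal ((5 / 9) ^ k) := by
  have hdraws : ∀ i ω, (iter y ω searchRound i s).draws = i * (1 + n) := by
    intro i ω
    rw [(iter_searchRound_counters y ω h.toSearchState hn i).2.1, hs, zero_add]
  have hiter : ∀ i {ω ω' : ℕ → unitInterval}, (∀ j < i * (1 + n), ω j = ω' j) →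
      iter y ω' searchRound i s = iter y ω searchRound i s := by
    intro i ω ω' hω
    exact iter_congr_coins y searchRound i s (by rwa [hdraws])
  -- A block has one coin for the lag and one for each of the `n` sampling times.
  refine measure_many_failures_le (B := 1 + n) (fun i => measurableSet_roundFails hy _ i) ?_ ?_ k
  · intro i ω ω' hω
    have hle : i * (1 + n) ≤ (i + 1) * (1 + n) := Nat.mul_le_mul_right _ (Nat.le_succ i)
    rw [hiter i fun j hj => hω j (hj.trans_le hle)]
    unfold RoundFails
    rw [not_iff_not]
    refine goodStep_congr fun j hj => hω _ ?_
    rw [hdraws]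
    have : (i + 1) * (1 + n) = i * (1 + n) + (1 + n) := by ring
    omega
  · intro i ω
    -- The invariant holds for every coin sequence, however many rounds failed, so the width always
    -- stays in the range covered by `hgood`.
    obtain ⟨d, m, hinv⟩ := h.iter (y := y) (ω := ω) hf hn i
    have hw : 10 ^ 4 * D < (iter y ω searchRound i s).reg 8 := by rw [hinv.r8]; exact hinv.width
    refine le_trans (le_of_eq ?_) (hgood (topCentre (iter y ω searchRound i s)) _ hw)
    refine congrArg coinLaw (Set.ext fun ω' => ?_)
    have e : iter y (glueCoins (i * (1 + n)) (ω, ω')) searchRound i s =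
        iter y ω searchRound i s := hiter i fun j hj => (glueCoins_lt hj (ω, ω')).symm
    simp only [Set.mem_ofPred_eq, RoundFails, e, hdraws, glueCoins_add]

/-- If at most an eighth of the rounds fail, most records are near `f₀`. -/
theorem SearchInv.most_records_good {k m d i : ℕ} (h : SearchInv T F R D f₀ k m d i s)
    (hm : 8 * m ≤ k) (hd : 4 * d < k) : i < 2 * goodRecords f₀ D s.array i := by
  -- With `2m ≤ k/4` and `d < k/4`, the balance `k + 1 ≤ 2m + good + (d + 1)` leaves more than `k/2
  -- ≥ i/2` good records.
  have h1 := h.balance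
  have h2 := stackBalance_le f₀ F s.array d
  have h3 := h.records_le
  omega

end RealRAM

end SearchProbability

/-! ### The estimator before and during its search. -/

section Estimator

open scoped ComplexConjugate

namespace RealRAM

open _root_.RealRAM.Expr _root_.RealRAM.Prog

/-- If `F` is at most `10^4 Δ'`, the answer `0` is accurate enough, and if `δ ≥ 1` nothing is
demanded of the output. These exits take no samples, as they must where `log⁺` vanishes. -/
theorem run_estimator_trivial {A : ℕ} {T F Δ R S δ : ℝ} (y : ℝ → ℂ) (ω : ℕ → unitInterval)
    (h : F ≤ 10 ^ 4 * widenedBand A 2 T Δ R S ∨ 1 ≤ δ) :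
    (run (estimator A) [T, F, Δ, R, S, δ] y ω).reg 0 = 0 ∧
    (run (estimator A) [T, F, Δ, R, S, δ] y ω).samples = 0 ∧
    (run (estimator A) [T, F, Δ, R, S, δ] y ω).steps ≤ 60 := by
  by_cases h1 : F ≤ 10 ^ 4 * (Δ + A * (R + S) * (Real.log (2 + R + S) * Real.log (2 + R + S)) / T)
  · refine ⟨?_, ?_, ?_⟩ <;>
      simp [run, estimator, exec, Expr.eval, Expr.cost, State.charge, State.init, h1]
  · have h2 : 1 ≤ δ := h.resolve_left (by rwa [widenedBand, sq])
    refine ⟨?_, ?_, ?_⟩ <;>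
      simp [run, estimator, exec, Expr.eval, Expr.cost, State.charge, State.init, h1, h2]

/-- The preamble uses neither signal nor coins, so the search starts from one fixed configuration.
The zero array already provides the root centre `0`. -/
theorem run_estimator_search {A : ℕ} {T F Δ R S δ : ℝ}
    (h1 : ¬ F ≤ 10 ^ 4 * widenedBand A 2 T Δ R S) (h2 : ¬ 1 ≤ δ) :
    ∃ s : State, SearchState T F R (widenedBand A 2 T Δ R S) 0 0 s ∧ (∀ i, s.array i = 0) ∧
      s.draws = 0 ∧ s.samples = 0 ∧ s.steps ≤ 60 ∧
      ∀ y ω, run (estimator A) [T, F, Δ, R, S, δ] y ω = exec y ω vote (iter y ω searchRound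
        ⌊8 * Real.log (F / (widenedBand A 2 T Δ R S * δ))⌋₊ s) := by
  have hD : widenedBand A 2 T Δ R S =
      Δ + A * (R + S) * (Real.log (2 + R + S) * Real.log (2 + R + S)) / T := by
    rw [widenedBand, sq]
  rw [hD] at h1 ⊢
  set L := Real.log (2 + R + S) with hL
  set D := Δ + A * (R + S) * (L * L) / T with hD'
  refine ⟨{ reg := Function.update (Function.update (Function.update
              (State.init [T, F, Δ, R, S, δ]).reg 6 L) 7 D) 8 F
            array := fun _ => 0
            draws := 0
            samples := 0
            steps := 40 }, ⟨?_, ?_, ?_, ?_, ?_, ?_⟩, fun _ => rfl, rfl, rfl, by norm_num, ?_⟩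
  any_goals simp [State.init]
  intro y ω
  simp only [estimator, searchAndVote, run, exec.eq_6, exec.eq_7]
  rw [if_neg, if_neg]
  · rw [exec_loop]
    refine congrArg (exec y ω vote) ?_
    simp [exec, Expr.eval, Expr.cost, State.charge, State.init, ← hL, ← hD']
  · simpa [exec, Expr.eval, State.charge, State.init] using h2
  · simpa [exec, Expr.eval, State.charge, State.init, ← hL, ← hD'] using h1

/-- Every round of the search succeeds with high probability on a signal with little noise. -/
theorem exists_measure_not_goodStep_le (p : Polynomial ℝ) :
    ∃ A : ℕ, 0 < A ∧ ∀ T Δ R S f₀ : ℝ, ∀ g η : ℝ → ℂ, 0 < T → 0 < Δ → 0 < S → Measurable g →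
      Measurable η → 0 < meanSq T g → FourierSupportIn g (Set.Icc (f₀ - Δ) (f₀ + Δ)) →
      (∀ t ∈ Set.Icc (-T) T, ‖g t‖ ^ 2 ≤ R * meanSq T g) →
      (∀ t ∉ Set.Icc (-T) T, ‖g t‖ ^ 2 ≤ p.eval R * meanSq T g * |t / T| ^ S) →
      IntegrableOn (fun t => ‖η t‖ ^ 2) (Set.Icc (-T) T) →
      meanSq T η ≤ (1 / 10 ^ 14) ^ 2 * meanSq T g →
      ∀ c w : ℝ, 10 ^ 4 * widenedBand A 2 T Δ R S < w →
        coinLaw {ω | ¬ GoodStep ((Set.Icc (-T) T).indicator (g + η)) T ⌊(2 * 10 ^ 23 : ℝ) * R⌋₊ f₀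
          c w ω} ≤ ENNReal.ofReal (1 / 10 ^ 4) := by
  -- Widths above `10^4 Δ'` give `2πβΔ' ≤ 10⁻⁶/10⁴`, so the bias is at most `6s + 4·10⁻¹⁰ = 10⁻⁹`,
  -- below the allowed `10⁻⁸/4`.
  obtain ⟨A, hA, hcorr⟩ := truncated_autocorrelation_bound (s := 1 / 10 ^ 10) (by norm_num)
    (by norm_num) p
  refine ⟨A, hA, fun T Δ R S f₀ g η hT hΔ hS hg hη hE hsupp hin hout hηint hηE c w hw => ?_⟩
  have hR : 1 ≤ R := one_le_of_norm_sq_le_mul_meanSq hg hT hE hin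
  have hD : 0 < widenedBand A 2 T Δ R S := by unfold widenedBand; positivity
  have hw0 : 0 < w := lt_trans (by positivity) hw
  have hnorm : ∀ h : ℝ → ℂ, (fun t => ‖(Set.Icc (-T) T).indicator h t‖ ^ 2) =
      (Set.Icc (-T) T).indicator fun t => ‖h t‖ ^ 2 := by
    intro h; ext t
    by_cases ht : t ∈ Set.Icc (-T) T <;> simp [ht]
  rw [Set.indicator_add']
  refine measure_not_goodStep_le (hg.indicator measurableSet_Icc) (hη.indicator measurableSet_Icc)
    hT hE hR hw0 ?_ (fun t ht => Set.indicator_of_notMem ht _) ?_ ?_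
    (integral_norm_sq_indicator hT g) ?_ ?_ ?_
  -- The factor `2` in the program's sample count absorbs the rounding, because `R ≥ 1`.
  · have := Nat.lt_floor_add_one ((2 * 10 ^ 23 : ℝ) * R)
    linarith
  · intro t
    by_cases ht : t ∈ Set.Icc (-T) T
    · rw [Set.indicator_of_mem ht]; exact hin t ht
    · rw [Set.indicator_of_notMem ht, norm_zero, zero_pow two_ne_zero]; positivity
  · rw [hnorm, integrable_indicator_iff measurableSet_Icc]
    exact integrableOn_norm_sq_of_le hg hin
  · rw [hnorm, integrable_indicator_iff measurableSet_Icc]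
    exact hηint
  · rw [integral_norm_sq_indicator hT η]
    nlinarith
  · intro β hβ hβw
    refine (hcorr T Δ R S f₀ g hT hΔ hS hg hE hsupp hin hout β).trans ?_
    refine mul_le_mul_of_nonneg_right ?_ (by positivity)
    rw [abs_of_nonneg hβ]
    have h1 : 2 * Real.pi * β * widenedBand A 2 T Δ R S ≤ 1 / 10 ^ 10 := by
      calc 2 * Real.pi * β * widenedBand A 2 T Δ R S ≤ aperture / w * (w / 10 ^ 4) := by
            refine mul_le_mul hβw ?_ hD.le (by unfold aperture; positivity)
            rw [le_div_iff₀ (by positivity)]; linarith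
        _ = 1 / 10 ^ 10 := by unfold aperture; field_simp
    linarith

/-- `5/9 ≤ exp (-4/9)`, and `(4/9)(8L - 1) ≥ L`: eight rounds per unit of `L` are ample for the
Chernoff bound. -/
theorem five_ninths_pow_le {L : ℝ} (hL : 1 ≤ L) : ((5 / 9 : ℝ)) ^ ⌊8 * L⌋₊ ≤ Real.exp (-L) := by
  have h1 : (5 / 9 : ℝ) ≤ Real.exp (-(4 / 9)) := by
    have := Real.add_one_le_exp (-(4 / 9 : ℝ)); linarith
  calc ((5 / 9 : ℝ)) ^ ⌊8 * L⌋₊ ≤ Real.exp (-(4 / 9)) ^ ⌊8 * L⌋₊ :=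
        pow_le_pow_left₀ (by norm_num) h1 _
    _ = Real.exp (⌊8 * L⌋₊ * (-(4 / 9))) := (Real.exp_nat_mul _ _).symm
    _ ≤ _ := by
        rw [Real.exp_le_exp]
        have := Nat.lt_floor_add_one (8 * L)
        linarith

end RealRAM

end Estimator

/-! ### Resources and success probability. -/

section Performance

namespace RealRAM

/-- The depth is at most `L / log 2`, and `4 / log 2 < 7`, while `⌊8L⌋ > 8L - 1 ≥ 7L`. Thus the
stack can tie up less than a quarter of the potential. -/
theorem four_mul_depth_lt {d : ℕ} {x L : ℝ} (hx : (2 : ℝ) ^ d ≤ x) (hxL : Real.log x ≤ L)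
    (hL : 1 ≤ L) : 4 * d < ⌊8 * L⌋₊ := by
  have h1 : d * Real.log 2 ≤ L := by
    rw [← Real.log_pow]
    exact (Real.log_le_log (by positivity) hx).trans hxL
  have h2 := Real.log_two_gt_d9
  have h3 := Nat.lt_floor_add_one (8 * L)
  have h4 : (0 : ℝ) ≤ d := Nat.cast_nonneg d
  have : (4 * d : ℝ) < ⌊8 * L⌋₊ := by nlinarith
  exact_mod_cast this

/-- The resources used by the estimator, and its success probability. -/
theorem estimator_performance {A : ℕ} {T F Δ R S δ f₀ : ℝ} {y : ℝ → ℂ} (hy : Measurable y)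
    (hD : 0 < widenedBand A 2 T Δ R S) (hF : 0 < F) (hR : 1 ≤ R) (hS : 0 < S) (hδ : 0 < δ)
    (hf : |f₀| ≤ F)
    (hgood : ∀ c w, 10 ^ 4 * widenedBand A 2 T Δ R S < w →
      coinLaw {ω | ¬ GoodStep y T ⌊(2 * 10 ^ 23 : ℝ) * R⌋₊ f₀ c w ω} ≤ ENNReal.ofReal (1 / 10 ^ 4)) :
    (∀ ω, ((run (estimator A) [T, F, Δ, R, S, δ] y ω).samples : ℝ) ≤
        10 ^ 26 * R * Real.posLog (F / (widenedBand A 2 T Δ R S * δ)) ∧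
      ((run (estimator A) [T, F, Δ, R, S, δ] y ω).steps : ℝ) ≤
        10 ^ 26 * (1 + R + S + Real.posLog (F / (widenedBand A 2 T Δ R S * δ))) ^ 2) ∧
    ENNReal.ofReal (1 - δ) ≤ coinLaw {ω |
      |f₀ - (run (estimator A) [T, F, Δ, R, S, δ] y ω).reg 0| ≤
        10 ^ 26 * widenedBand A 2 T Δ R S} := by
  by_cases htriv : F ≤ 10 ^ 4 * widenedBand A 2 T Δ R S ∨ 1 ≤ δ
  · have hpos := Real.posLog_nonneg (x := F / (widenedBand A 2 T Δ R S * δ))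
    refine ⟨fun ω => ?_, ?_⟩
    · obtain ⟨-, h2, h3⟩ := run_estimator_trivial y ω htriv
      refine ⟨by rw [h2, Nat.cast_zero]; positivity, (Nat.cast_le.2 h3).trans ?_⟩
      push_cast
      nlinarith
    · rcases htriv with h | h
      · have huniv : {ω | |f₀ - (run (estimator A) [T, F, Δ, R, S, δ] y ω).reg 0| ≤
            10 ^ 26 * widenedBand A 2 T Δ R S} = Set.univ := by
          refine Set.eq_univ_of_forall fun ω => ?_
          rw [Set.mem_ofPred_eq, (run_estimator_trivial y ω (Or.inl h)).1, sub_zero]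
          exact (hf.trans h).trans (by nlinarith)
        rw [huniv, measure_univ]
        exact ENNReal.ofReal_le_one.2 (by linarith)
      · rw [ENNReal.ofReal_of_nonpos (by linarith)]
        exact zero_le
  rw [not_or] at htriv
  obtain ⟨h1, h2⟩ := htriv
  obtain ⟨s, hs, harr, hdraws, hsamp, hsteps, hrun⟩ := run_estimator_search h1 h2
  rw [not_le] at h1 h2
  set D := widenedBand A 2 T Δ R S with hDdef
  set L := Real.log (F / (D * δ)) with hLdef
  have hFD : 10 ^ 4 < F / D := by rw [lt_div_iff₀ hD]; exact h1
  have hFDδ : F / D ≤ F / (D * δ) := by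
    gcongr
    exact mul_le_of_le_one_right hD.le h2.le
  -- Past the early exits `F / D > 10 ^ 4` and `δ < 1`, so `log⁺` is a true logarithm, large enough
  -- to absorb all rounding.
  have hL : 1 ≤ L := by
    rw [hLdef, Real.le_log_iff_exp_le (by positivity)]
    have := Real.exp_one_lt_d9
    linarith
  have hpos : Real.posLog (F / (D * δ)) = L := max_eq_right (by linarith)
  rw [hpos]
  have hinv : SearchInv T F R D f₀ 0 0 0 0 s := by
    -- The root alone gives balance `1`, since `|f₀| ≤ F`.
    refine ⟨hs, harr 0, by simpa using h1, le_rfl, ?_⟩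
    simp [goodRecords, stackBalance, harr, hf]
  set N := ⌊8 * L⌋₊ with hN
  set n := ⌊(2 * 10 ^ 23 : ℝ) * R⌋₊ with hn
  have hNle : (N : ℝ) ≤ 8 * L := Nat.floor_le (by linarith)
  have hnle : (n : ℝ) ≤ 2 * 10 ^ 23 * R := Nat.floor_le (by positivity)
  clear_value n N
  refine ⟨fun ω => ?_, ?_⟩
  · obtain ⟨d, i, hk⟩ := hinv.iter (y := y) (ω := ω) hf hn.symm N
    obtain ⟨-, -, c2, c3⟩ := iter_searchRound_counters y ω hs hn.symm N
    obtain ⟨-, v2, v3⟩ := exec_vote y ω hD.le hk.r7 hk.r10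
    have hi := hk.records_le
    rw [← hrun] at v2 v3
    rw [c2, hsamp] at v2
    constructor
    · rw [v2]
      push_cast
      have : (N : ℝ) * n ≤ 8 * L * (2 * 10 ^ 23 * R) := by gcongr
      have : 0 ≤ R * L := by positivity
      linarith
    · have hst : (run (estimator A) [T, F, Δ, R, S, δ] y ω).steps ≤
          60 + N * (120 + 40 * n) + (N * (50 * N + 31) + 4) := by
        have : i * (50 * i + 31) ≤ N * (50 * N + 31) := by gcongr
        omega
      refine (Nat.cast_le.2 hst).trans ?_
      push_cast
      set X := 1 + R + S + L with hX
      have hX1 : 1 ≤ X := by linarith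
      have hNX : (N : ℝ) ≤ 8 * X := by linarith
      have hnX : (n : ℝ) ≤ 2 * 10 ^ 23 * X := by linarith
      have e1 : (N : ℝ) * (120 + 40 * n) ≤ 8 * X * (120 * X + 40 * (2 * 10 ^ 23 * X)) := by
        gcongr
        linarith
      have e2 : (N : ℝ) * (50 * N + 31) ≤ 8 * X * (50 * (8 * X) + 31 * X) := by
        gcongr
        linarith
      have e3 : 1 ≤ X ^ 2 := by nlinarith
      nlinarith
  · set bad : Set (ℕ → unitInterval) := {ω | N < 8 * failures (fun j ω =>
      RoundFails y T n f₀ ω (iter y ω searchRound j s)) N ω} with hbad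
    have hbadle : coinLaw bad ≤ ENNReal.ofReal δ := by
      refine (measure_search_failures_le hy hf hinv hdraws hn.symm hgood N).trans ?_
      apply ENNReal.ofReal_le_ofReal
      rw [hN]
      refine (five_ninths_pow_le hL).trans ?_
      -- `exp (-L) = Dδ/F`, which is at most `δ` because `D < F`.
      rw [Real.exp_neg, hLdef, Real.exp_log (by positivity), inv_div, div_le_iff₀ hF]
      nlinarith
    have hsub : badᶜ ⊆ {ω | |f₀ - (run (estimator A) [T, F, Δ, R, S, δ] y ω).reg 0| ≤
        10 ^ 26 * D} := by
      intro ω hω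
      simp only [hbad, Set.mem_compl_iff, Set.mem_ofPred_eq, not_lt] at hω
      obtain ⟨d, i, hk⟩ := hinv.iter (y := y) (ω := ω) hf hn.symm N
      have hd : 4 * d < N := by
        rw [hN]
        refine four_mul_depth_lt (x := F / D) ?_ (Real.log_le_log (by positivity) hFDδ) hL
        have hw := hk.width
        rw [lt_div_iff₀ (by positivity)] at hw
        rw [le_div_iff₀ hD]
        have : 0 < D * 2 ^ d := by positivity
        nlinarith
      obtain ⟨hex, hnear⟩ := majority_near (hk.most_records_good hω hd)
      obtain ⟨hout, -, -⟩ := exec_vote y ω hD.le hk.r7 hk.r10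
      obtain ⟨j, hj, hreg⟩ := hout hex
      rw [← hrun] at hreg
      rw [Set.mem_ofPred_eq, hreg]
      exact (hnear j hj).trans (by nlinarith)
    refine le_trans ?_ (measure_mono hsub)
    rw [ENNReal.ofReal_sub _ hδ.le, ENNReal.ofReal_one, tsub_le_iff_right]
    calc (1 : ENNReal) = coinLaw (badᶜ ∪ bad) := by rw [Set.compl_union_self, measure_univ]
      _ ≤ coinLaw badᶜ + coinLaw bad := measure_union_le _ _
      _ ≤ _ := by gcongr

end RealRAM

end Performance

/-! ### The theorem. -/

theorem mainTheorem6 :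
    ∃ ε : ℝ, 0 < ε ∧ ∀ p : Polynomial ℝ,
      ∃ (A C : ℝ) (a c : ℕ) (P : RealRAM.Prog), 0 < A ∧ 0 < C ∧
        ∀ T F Δ R S δ : ℝ, 0 < T → 0 < F → 0 < Δ → 0 < S → 0 < δ →
        ∀ (f₀ : ℝ) (g η : ℝ → ℂ), f₀ ∈ Set.Icc (-F) F →
          Measurable g → Measurable η →
          0 < meanSq T g →
          FourierSupportIn g (Set.Icc (f₀ - Δ) (f₀ + Δ)) →
          (∀ t ∈ Set.Icc (-T) T, ‖g t‖ ^ 2 ≤ R * meanSq T g) →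
          (∀ t ∉ Set.Icc (-T) T, ‖g t‖ ^ 2 ≤ p.eval R * meanSq T g * |t / T| ^ S) →
          MeasureTheory.IntegrableOn (fun t => ‖η t‖ ^ 2) (Set.Icc (-T) T) →
          meanSq T η ≤ ε * meanSq T g →
          (∀ ω : ℕ → unitInterval,
            ((RealRAM.run P [T, F, Δ, R, S, δ]
                ((Set.Icc (-T) T).indicator (g + η)) ω).samples : ℝ)
              ≤ C * R * Real.posLog (F / (widenedBand A a T Δ R S * δ)) ∧
            ((RealRAM.run P [T, F, Δ, R, S, δ]
                ((Set.Icc (-T) T).indicator (g + η)) ω).steps : ℝ)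
              ≤ C * (1 + R + S + Real.posLog (F / (widenedBand A a T Δ R S * δ))) ^ c) ∧
          ENNReal.ofReal (1 - δ) ≤ RealRAM.coinLaw {ω |
            |f₀ - (RealRAM.run P [T, F, Δ, R, S, δ]
                ((Set.Icc (-T) T).indicator (g + η)) ω).reg 0|
              ≤ C * widenedBand A a T Δ R S} := by
  -- Noise of relative amplitude `10⁻¹⁴` is what Markov's inequality tolerates at the precision
  -- `10⁻⁸` of a step.
  refine ⟨(1 / 10 ^ 14) ^ 2, by norm_num, fun p => ?_⟩
  obtain ⟨A, hA, hgood⟩ := RealRAM.exists_measure_not_goodStep_le p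
  -- Of the two logarithms in `Δ'`, one comes from the number `k` of factors and one from the
  -- harmonic sum. The constant `10 ^ 26` is dictated by the step count, whose main term is `8 · 40
  -- · 2 · 10²³ = 6.4 · 10²⁵`.
  refine ⟨A, 10 ^ 26, 2, 2, RealRAM.estimator A, by exact_mod_cast hA, by norm_num, ?_⟩
  intro T F Δ R S δ hT hF hΔ hS hδ f₀ g η hf hg hη hE hsupp hin hout hηint hηE
  have hR : 1 ≤ R := one_le_of_norm_sq_le_mul_meanSq hg hT hE hin
  have hD : 0 < widenedBand A 2 T Δ R S := by unfold widenedBand; positivity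
  exact RealRAM.estimator_performance ((hg.add hη).indicator measurableSet_Icc) hD hF hR hS hδ
    (abs_le.2 hf) (hgood T Δ R S f₀ g η hT hΔ hS hg hη hE hsupp hin hout hηint hηE)
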